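/- Let $N\in\mathbb N$ and $1<p<N$, and put $p^*=\frac{Np}{N-p}$. Let $A:\mathbb R^N\to\mathbb R$ be measurable with $A>0$ a.e., $A\in L^\infty(\mathbb R^N)$ and $A^{-1/(p-1)}\in L^1_{\mathrm{loc}}(\mathbb R^N)$. Let $W_A$ be the closure of $C_0^\infty(\mathbb R^N)$ for the norm $\|u\|_{W_A}=\big(\int_{\mathbb R^N}|\nabla u|^p+A|u|^p\,dx\big)^{1/p}$ (an element of $W_A$ is a function, up to equality a.e., and $\nabla u$ is its weak gradient), let $$\lambda_A=\inf_{u\in W_A\setminus\{0\}}\frac{\int_{\mathbb R^N}|\nabla u|^p\,dx}{\int_{\mathbb R^N}A|u|^p\,dx},$$ and let $\lambda\in\mathbb R$ satisfy $\lambda<\lambda_A$. Let $g:\mathbb R^N\times\mathbb R\to\mathbb R$ satisfy, with $G(x,s)=\int_0^s g(x,t)\,dt$: (g1) $g$ is a Carathéodory function, $g(x,\cdot)\in C^1(\mathbb R)$ for a.e. $x\in\mathbb R^N$, and there are $q\in(p,p^*)$ and $B\in L^{p^*/(p^*-q)}(\mathbb R^N)\cap L^\infty(\mathbb R^N)$ with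 $B>0$ a.e. such that $|g_s(x,s)|\le B(x)|s|^{q-2}$ for a.e. $x\in\mathbb R^N$ and all $s\in\mathbb R\setminus\{0\}$; (g2) there are $\theta>p$ and $R>0$ such that $g(x,s)s\ge\theta G(x,s)>0$ for a.e. $x\in\mathbb R^N$ and all $|s|\ge R$; (g3) for a.e. $x\in\mathbb R^N$ the map $s\mapsto g(x,s)/|s|^{p-1}$ is strictly increasing on $\mathbb R\setminus\{0\}$. For $u\in W_A$ put $$S_\lambda(u)=\frac1p\int_{\mathbb R^N}\big(|\nabla u|^p-\lambda A|u|^p\big)\,dx-\int_{\mathbb R^N}G(x,u)\,dx,$$ $$J_\lambda(u)=\int_{\mathbb R^N}\big(|\nabla u|^p-\lambda A|u|^p\big)\,dx-\int_{\mathbb R^N}g(x,u)u\,dx,$$ and, with $u^\pm=\pm\max\{\pm u,0\}$ (so that $u=u^++u^-$), $$N_\lambda=\{u\in W_A\setminus\{0\}:J_\lambda(u)=0\},\qquad M_\lambda=\{u\in W_A:u^+\in N_\lambda\text{ and }u^-\in N_\lambda\}.$$ Then $m_\lambda:=\inf_{M_\lambda}S_\lambda$ is a finite infimum and it is attained: there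 is $u\in M_\lambda$ with $S_\lambda(u)=m_\lambda$. -/

import Mathlib

open MeasureTheory Set Filter Topology
open scoped ContDiff ENNReal

noncomputable section

namespace NodalNehari

/-- The space `ℝ^N` with its Euclidean norm. -/
abbrev RN (N : ℕ) : Type := EuclideanSpace ℝ (Fin N)

/-- The class `C_0^∞(ℝ^N)` of smooth functions with compact support. -/
def TestFun {N : ℕ} (φ : RN N → ℝ) : Prop :=
  ContDiff ℝ ∞ φ ∧ HasCompactSupport φ

/-- `V` is a weak (distributional) gradient of `u` on `ℝ^N`. -/
structure IsWeakGradient {N : ℕ} (u : RN N → ℝ) (V : RN N → RN N) : Prop where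
  locInt : LocallyIntegrable u volume
  locIntGrad : LocallyIntegrable V volume
  integral_eq : ∀ ψ : RN N → ℝ, TestFun ψ →
    ∫ x, u x • gradient ψ x = - ∫ x, ψ x • V x

open Classical in
/-- The weak gradient `∇u` of `u` (unique up to null sets when it exists; `0` otherwise). -/
def weakGrad {N : ℕ} (u : RN N → ℝ) : RN N → RN N :=
  if h : ∃ V, IsWeakGradient u V then h.choose else 0

/-- The weighted Sobolev space `W_A(ℝ^N)`: the closure of `C_0^∞(ℝ^N)` for the norm
`(∫ |∇u|^p + A |u|^p)^(1/p)`. Its elements are classes of functions modulo equality a.e. -/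
def WA {N : ℕ} (p : ℝ) (A : RN N → ℝ) : Set (RN N →ₘ[volume] ℝ) :=
  {u | (∃ V, IsWeakGradient u V) ∧
    ∃ φ : ℕ → RN N → ℝ, (∀ n, TestFun (φ n)) ∧
      Tendsto (fun n => ∫⁻ x, (‖gradient (φ n) x - weakGrad u x‖ₑ ^ p
        + ENNReal.ofReal (A x) * ‖φ n x - u x‖ₑ ^ p)) atTop (𝓝 0)}

/-- Assumption (A1) on the weight `A`. -/
structure CondA1 {N : ℕ} (p : ℝ) (A : RN N → ℝ) : Prop where
  meas : AEMeasurable A volume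
  pos : ∀ᵐ x, 0 < A x
  bdd : MemLp A ⊤ volume
  locInt : LocallyIntegrable (fun x => A x ^ (-1 / (p - 1))) volume

/-- `λ_A`, the infimum over `u ∈ W_A`, `u ≠ 0`, of `∫ |∇u|^p / ∫ A |u|^p`. -/
def lamA {N : ℕ} (p : ℝ) (A : RN N → ℝ) : ℝ :=
  sInf ((fun u : RN N →ₘ[volume] ℝ => (∫ x, ‖weakGrad u x‖ ^ p) / ∫ x, A x * |u x| ^ p) ''
    {u | u ∈ WA p A ∧ u ≠ 0})

/-- The critical Sobolev exponent `p^* = N p / (N - p)`. -/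
def pStar (N : ℕ) (p : ℝ) : ℝ := N * p / (N - p)

/-- The primitive `G(x,s) = ∫_0^s g(x,t) dt`. -/
def primG {N : ℕ} (g : RN N → ℝ → ℝ) (x : RN N) (s : ℝ) : ℝ := ∫ t in (0 : ℝ)..s, g x t

/-- `g` is a Carathéodory function. -/
def Caratheodory {N : ℕ} (g : RN N → ℝ → ℝ) : Prop :=
  (∀ s, AEMeasurable (fun x => g x s) volume) ∧ ∀ᵐ x, Continuous (g x)

/-- Assumption (g1): `g` is `C^1` in `s` and subcritical. The growth bound is imposed for `s ≠ 0`: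
for `q ≥ 2` the case `s = 0` follows by continuity of `g_s(x,·)`, and for `q < 2` the right-hand
side is infinite at `s = 0`. -/
def CondG1 {N : ℕ} (p : ℝ) (g : RN N → ℝ → ℝ) : Prop :=
  Caratheodory g ∧ (∀ᵐ x, ContDiff ℝ 1 (g x)) ∧
    ∃ q : ℝ, p < q ∧ q < pStar N p ∧ ∃ B : RN N → ℝ,
      MemLp B (ENNReal.ofReal (pStar N p / (pStar N p - q))) volume ∧ MemLp B ⊤ volume ∧
      (∀ᵐ x, 0 < B x) ∧
      ∀ᵐ x, ∀ s : ℝ, s ≠ 0 → |deriv (g x) s| ≤ B x * |s| ^ (q - 2)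

/-- Assumption (g2): `g` is `p`-superlinear. -/
def CondG2 {N : ℕ} (p : ℝ) (g : RN N → ℝ → ℝ) : Prop :=
  ∃ θ : ℝ, p < θ ∧ ∃ R : ℝ, 0 < R ∧
    ∀ᵐ x, ∀ s : ℝ, R ≤ |s| → θ * primG g x s ≤ g x s * s ∧ 0 < primG g x s

/-- Assumption (g3): `s ↦ g(x,s) / |s|^(p-1)` is strictly increasing on `ℝ \ {0}`. -/
def CondG3 {N : ℕ} (p : ℝ) (g : RN N → ℝ → ℝ) : Prop :=
  ∀ᵐ x, StrictMonoOn (fun s : ℝ => g x s / |s| ^ (p - 1)) {0}ᶜ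

/-- `‖u‖_λ^p = ∫ |∇u|^p - λ A |u|^p`. -/
def normLamPow {N : ℕ} (p lam : ℝ) (A : RN N → ℝ) (u : RN N →ₘ[volume] ℝ) : ℝ :=
  ∫ x, (‖weakGrad u x‖ ^ p - lam * A x * |u x| ^ p)

/-- The functional `S_λ(u) = (1/p) ∫ (|∇u|^p - λ A |u|^p) - ∫ G(x,u)`. -/
def Slam {N : ℕ} (p lam : ℝ) (A : RN N → ℝ) (g : RN N → ℝ → ℝ) (u : RN N →ₘ[volume] ℝ) : ℝ :=
  (1 / p) * normLamPow p lam A u - ∫ x, primG g x (u x)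

/-- `J_λ(u) = ⟨S_λ'(u), u⟩ = ‖u‖_λ^p - ∫ g(x,u) u`. -/
def Jlam {N : ℕ} (p lam : ℝ) (A : RN N → ℝ) (g : RN N → ℝ → ℝ) (u : RN N →ₘ[volume] ℝ) : ℝ :=
  normLamPow p lam A u - ∫ x, g x (u x) * u x

/-- The Nehari manifold `N_λ`. -/
def Nlam {N : ℕ} (p lam : ℝ) (A : RN N → ℝ) (g : RN N → ℝ → ℝ) : Set (RN N →ₘ[volume] ℝ) :=
  {u | u ∈ WA p A ∧ u ≠ 0 ∧ Jlam p lam A g u = 0}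

/-- The positive part `u^+ = max {u, 0}`. -/
def uPlus {N : ℕ} (u : RN N →ₘ[volume] ℝ) : RN N →ₘ[volume] ℝ := u ⊔ 0

/-- The (nonpositive) negative part `u^- = - max {-u, 0}`, so that `u = u^+ + u^-`. -/
def uMinus {N : ℕ} (u : RN N →ₘ[volume] ℝ) : RN N →ₘ[volume] ℝ := -(-u ⊔ 0)

/-- The nodal Nehari set `M_λ`. -/
def Mlam {N : ℕ} (p lam : ℝ) (A : RN N → ℝ) (g : RN N → ℝ → ℝ) : Set (RN N →ₘ[volume] ℝ) :=
  {u | u ∈ WA p A ∧ uPlus u ∈ Nlam p lam A g ∧ uMinus u ∈ Nlam p lam A g}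

/-- `m_λ`, the infimum of `S_λ` over `M_λ`. -/
def mlam {N : ℕ} (p lam : ℝ) (A : RN N → ℝ) (g : RN N → ℝ → ℝ) : ℝ :=
  sInf (Slam p lam A g '' Mlam p lam A g)

end NodalNehari

end

/-! ### The energy and its completion, as pairs of a function and a gradient -/

namespace NodalNehari

variable {N : ℕ} {p : ℝ} {A : RN N → ℝ}

/-! The direct method is applied to the positive and negative parts of a minimising sequence
separately. Write S and J for the functionals. By (g3), every w with J(w) = 0 satisfies S(tw) ≤ S(w)
for 0 ≤ t ≤ 1 (`action_smul_le`); t = 0 gives S(w) ≥ 0. Parts of opposite sign have disjoint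
supports and a gradient vanishes a.e. on the zero set of its function (`IsWA.grad_eq_zero_ae`), so
S(u) = S(u⁺) + S(u⁻) (`action_add`) and the two parts can be rescaled independently.

Let w_n be one of the parts along the minimising sequence. Superlinearity bounds its energy
(`exists_energy_le`), and a Rellich argument gives an a.e. limit w' of a subsequence
(`exists_subseq_ae_tendsto`). The weight B makes the nonlinear integrals converge
(`IsSubcritical.tendsto_integral`); they are bounded away from zero on the Nehari manifold
(`exists_nonlinInt_ge`), so w' ≠ 0. The form ∫ |∇w|^p - λA|w|^p is weakly lower semicontinuous
(`eventually_lamForm_le`), hence J(w') ≤ 0 and some t in (0,1] puts tw' on the Nehari manifold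
(`exists_isNehari_smul_of_le`). Finally S(tw') ≤ liminf S(tw_n) ≤ liminf S(w_n). Adding the
inequalities for the two parts yields a minimiser. Neither strong convergence nor differentiability
of S is needed.

Lower semicontinuity is delicate for λ > 0, because A need not decay and ∫ A|w|^p may lose mass at
infinity. A cutoff splits the form: near the origin the weighted term is compact, and far away λ <
λ_A keeps the form almost nonnegative (`exists_tail_bound`).

Weak compactness is obtained by hand: almost energy-minimal elements of the convex hulls of the
tails form a Cauchy sequence by uniform convexity, and they inherit a.e. limits and convex bounds
(`exists_grad_of_tendsto_ae`). Throughout, an element is a pair `IsWA` of a function and its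
gradient, which makes linearity and closedness formal; `mem_WA_iff` translates back to `WA`. -/

/-- The energy `∫ ‖V‖^p + A |u|^p` as an extended nonnegative number. -/
noncomputable def energy (p : ℝ) (A : RN N → ℝ) (u : RN N → ℝ) (V : RN N → RN N) : ℝ≥0∞ :=
  ∫⁻ x, (‖V x‖ₑ ^ p + ENNReal.ofReal (A x) * ‖u x‖ₑ ^ p)

/-- `(u, V)` is a limit of pairs `(φ, ∇φ)`, `φ` a test function, for the energy. -/
structure IsWA (p : ℝ) (A : RN N → ℝ) (u : RN N → ℝ) (V : RN N → RN N) : Prop where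
  aesm : AEStronglyMeasurable u volume
  aesmGrad : AEStronglyMeasurable V volume
  approx : ∃ φ : ℕ → RN N → ℝ, (∀ n, TestFun (φ n)) ∧
    Tendsto (fun n => energy p A (φ n - u) (gradient (φ n) - V)) atTop (𝓝 0)

/-! ### Test functions -/

lemma TestFun.differentiable {φ : RN N → ℝ} (h : TestFun φ) : Differentiable ℝ φ :=
  h.1.differentiable (by simp)

lemma TestFun.continuous {φ : RN N → ℝ} (h : TestFun φ) : Continuous φ := h.1.continuous

lemma TestFun.add {φ ψ : RN N → ℝ} (h : TestFun φ) (h' : TestFun ψ) : TestFun (φ + ψ) :=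
  ⟨h.1.add h'.1, h.2.add h'.2⟩

lemma TestFun.const_smul {φ : RN N → ℝ} (h : TestFun φ) (c : ℝ) : TestFun (c • φ) :=
  ⟨h.1.const_smul c, h.2.smul_left (f := fun _ => c)⟩

lemma TestFun.mul {φ ψ : RN N → ℝ} (h : TestFun φ) (h' : TestFun ψ) : TestFun (φ * ψ) :=
  ⟨h.1.mul h'.1, h.2.mul_right⟩

lemma gradient_add' {φ ψ : RN N → ℝ} (h : Differentiable ℝ φ) (h' : Differentiable ℝ ψ) :
    gradient (φ + ψ) = gradient φ + gradient ψ := by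
  ext1 x
  simp [gradient, fderiv_add (h x) (h' x)]

lemma gradient_const_smul' {φ : RN N → ℝ} (h : Differentiable ℝ φ) (c : ℝ) :
    gradient (c • φ) = c • gradient φ := by
  ext1 x
  simp [gradient, fderiv_const_smul (h x)]

lemma gradient_mul' {φ ψ : RN N → ℝ} (h : Differentiable ℝ φ) (h' : Differentiable ℝ ψ) :
    gradient (φ * ψ) = fun x => φ x • gradient ψ x + ψ x • gradient φ x := by
  ext1 x
  simp [gradient, fderiv_mul (h x) (h' x)]

lemma norm_gradient (φ : RN N → ℝ) (x : RN N) : ‖gradient φ x‖ = ‖fderiv ℝ φ x‖ := by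
  simp [gradient]

lemma inner_gradient (φ : RN N → ℝ) (x v : RN N) : inner ℝ (gradient φ x) v = fderiv ℝ φ x v := by
  simp [gradient]

lemma TestFun.continuous_gradient {φ : RN N → ℝ} (h : TestFun φ) : Continuous (gradient φ) :=
  (LinearIsometryEquiv.continuous _).comp (h.1.continuous_fderiv (by simp))

lemma TestFun.hasCompactSupport_gradient {φ : RN N → ℝ} (h : TestFun φ) :
    HasCompactSupport (gradient φ) :=
  (h.2.fderiv ℝ).comp_left (g := (InnerProductSpace.toDual ℝ (RN N)).symm) (map_zero _)

/-! ### Measure-theoretic helpers -/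

/-- Functions whose integrals tend to zero have an a.e. null subsequence. -/
lemma exists_subseq_ae_tendsto_zero {α : Type*} [MeasurableSpace α] {μ : Measure α}
    {f : ℕ → α → ℝ≥0∞} (hf : ∀ n, AEMeasurable (f n) μ)
    (h : Tendsto (fun n => ∫⁻ x, f n x ∂μ) atTop (𝓝 0)) :
    ∃ ns : ℕ → ℕ, StrictMono ns ∧ ∀ᵐ x ∂μ, Tendsto (fun n => f (ns n) x) atTop (𝓝 0) := by
  -- Along a subsequence with summable integrals the pointwise series has finite integral, so it
  -- converges a.e. and its terms tend to zero.
  obtain ⟨ε, hε, hsum⟩ := ENNReal.exists_pos_sum_of_countable (ε := 1) one_ne_zero ℕ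
  obtain ⟨ns, hns, hle⟩ := extraction_forall_of_eventually
    (P := fun n k => ∫⁻ x, f k x ∂μ < ε n) fun n =>
      h.eventually (gt_mem_nhds (by exact_mod_cast hε n))
  refine ⟨ns, hns, ?_⟩
  have : ∫⁻ x, ∑' n, f (ns n) x ∂μ ≠ ⊤ := by
    rw [lintegral_tsum fun n => hf _]
    exact ((ENNReal.tsum_le_tsum fun n => (hle n).le).trans_lt (hsum.trans ENNReal.one_lt_top)).ne
  filter_upwards [ae_lt_top' (AEMeasurable.tsum fun n => hf _) this] with x hx
  exact ENNReal.tendsto_atTop_zero_of_tsum_ne_top hx.ne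

lemma enorm_add_rpow_le {E : Type*} [NormedAddCommGroup E] {r : ℝ} (hr : 1 ≤ r) (a b : E) :
    ‖a + b‖ₑ ^ r ≤ 2 ^ (r - 1) * (‖a‖ₑ ^ r + ‖b‖ₑ ^ r) :=
  (ENNReal.rpow_le_rpow (enorm_add_le a b) (by linarith)).trans
    (ENNReal.rpow_add_le_mul_rpow_add_rpow _ _ hr)

lemma enorm_rpow_tendsto_zero_iff {E : Type*} [NormedAddCommGroup E] {r : ℝ} (hr : 0 < r)
    {a : ℕ → E} :
    Tendsto (fun n => ‖a n‖ₑ ^ r) atTop (𝓝 0) ↔ Tendsto (fun n => ‖a n‖) atTop (𝓝 0) := by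
  have key : Tendsto (fun n => ‖a n‖ₑ) atTop (𝓝 0) ↔ Tendsto (fun n => ‖a n‖) atTop (𝓝 0) := by
    rw [← ENNReal.tendsto_toReal_iff (by simp) (by simp)]
    simp
  rw [← key]
  constructor
  · intro h
    have := (ENNReal.continuous_rpow_const (y := r⁻¹)).tendsto 0 |>.comp h
    simpa [Function.comp_def, ← ENNReal.rpow_mul, hr.ne', hr] using this
  · intro h
    have := (ENNReal.continuous_rpow_const (y := r)).tendsto 0 |>.comp h
    simpa [Function.comp_def, hr] using this

/-! ### The energy -/

lemma energy_congr {u u' : RN N → ℝ} {V V' : RN N → RN N} (h : u =ᵐ[volume] u')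
    (h' : V =ᵐ[volume] V') : energy p A u V = energy p A u' V' := by
  refine lintegral_congr_ae ?_
  filter_upwards [h, h'] with x hx hx'
  rw [hx, hx']

/-- The energy is the p-th power of a norm, so it obeys the triangle inequality only up to the
factor 2^(p-1). This suffices for every argument about energies tending to zero. -/
lemma energy_add_le (hp : 1 ≤ p) {u u' : RN N → ℝ} {V V' : RN N → RN N}
    (hA : AEMeasurable A volume)
    (hu : AEStronglyMeasurable u volume) (hV : AEStronglyMeasurable V volume) :
    energy p A (u + u') (V + V') ≤ 2 ^ (p - 1) * (energy p A u V + energy p A u' V') := by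
  have hm : AEMeasurable (fun x => ‖V x‖ₑ ^ p + ENNReal.ofReal (A x) * ‖u x‖ₑ ^ p) volume :=
    (hV.enorm.pow_const _).add (hA.ennreal_ofReal.mul (hu.enorm.pow_const _))
  unfold energy
  rw [← lintegral_add_left' hm, ← lintegral_const_mul' _ _ (by simp)]
  refine lintegral_mono fun x => ?_
  calc ‖V x + V' x‖ₑ ^ p + ENNReal.ofReal (A x) * ‖u x + u' x‖ₑ ^ p
      ≤ 2 ^ (p - 1) * (‖V x‖ₑ ^ p + ‖V' x‖ₑ ^ p) +
        ENNReal.ofReal (A x) * (2 ^ (p - 1) * (‖u x‖ₑ ^ p + ‖u' x‖ₑ ^ p)) := by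
        gcongr <;> exact enorm_add_rpow_le hp _ _
    _ = _ := by ring

lemma energy_const_smul (hp : 0 ≤ p) (c : ℝ) (u : RN N → ℝ) (V : RN N → RN N) :
    energy p A (c • u) (c • V) = ‖c‖ₑ ^ p * energy p A u V := by
  unfold energy
  rw [← lintegral_const_mul' _ _ (by simp [hp])]
  refine lintegral_congr fun x => ?_
  simp only [Pi.smul_apply, enorm_smul, ENNReal.mul_rpow_of_nonneg _ _ hp]
  ring

lemma energy_sub_comm (u u' : RN N → ℝ) (V V' : RN N → RN N) :
    energy p A (u - u') (V - V') = energy p A (u' - u) (V' - V) := by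
  simp only [energy, Pi.sub_apply, enorm_sub_rev (u _), enorm_sub_rev (V _)]

lemma lintegral_grad_le_energy (u : RN N → ℝ) (V : RN N → RN N) :
    ∫⁻ x, ‖V x‖ₑ ^ p ≤ energy p A u V :=
  lintegral_mono fun _ => le_self_add

lemma lintegral_weight_le_energy (u : RN N → ℝ) (V : RN N → RN N) :
    ∫⁻ x, ENNReal.ofReal (A x) * ‖u x‖ₑ ^ p ≤ energy p A u V :=
  lintegral_mono fun _ => le_add_self

lemma energy_eq_add {u : RN N → ℝ} {V : RN N → RN N} (hV : AEStronglyMeasurable V volume) :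
    energy p A u V = (∫⁻ x, ‖V x‖ₑ ^ p) + ∫⁻ x, ENNReal.ofReal (A x) * ‖u x‖ₑ ^ p :=
  lintegral_add_left' (hV.enorm.pow_const _) _

lemma lintegral_enorm_rpow_lt_top_of_hasCompactSupport {E : Type*} [NormedAddCommGroup E]
    {f : RN N → E} (hf : Continuous f) (hc : HasCompactSupport f) {r : ℝ} (hr : 0 < r) :
    ∫⁻ x, ‖f x‖ₑ ^ r < ⊤ := by
  have := (hf.memLp_of_hasCompactSupport (p := ENNReal.ofReal r) (μ := volume) hc)
  have h2 := lintegral_rpow_enorm_lt_top_of_eLpNorm_lt_top (by simpa using hr) (by simp) this.2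
  simpa [ENNReal.toReal_ofReal hr.le] using h2

lemma TestFun.energy_lt_top (hp : 0 < p) (hA : MemLp A ⊤ volume) {φ : RN N → ℝ} (h : TestFun φ) :
    energy p A φ (gradient φ) < ⊤ := by
  rw [energy_eq_add h.continuous_gradient.aestronglyMeasurable]
  refine ENNReal.add_lt_top.2 ⟨lintegral_enorm_rpow_lt_top_of_hasCompactSupport
    h.continuous_gradient h.hasCompactSupport_gradient hp, ?_⟩
  have hb : ∀ᵐ x, ENNReal.ofReal (A x) ≤ eLpNorm A ⊤ volume := by
    filter_upwards [ae_le_eLpNormEssSup (f := A) (μ := volume)] with x hx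
    rw [eLpNorm_exponent_top]
    refine le_trans ?_ hx
    rw [← ofReal_norm]
    exact ENNReal.ofReal_le_ofReal (Real.le_norm_self _)
  calc ∫⁻ x, ENNReal.ofReal (A x) * ‖φ x‖ₑ ^ p
      ≤ ∫⁻ x, eLpNorm A ⊤ volume * ‖φ x‖ₑ ^ p :=
        lintegral_mono_ae (hb.mono fun x hx => by gcongr)
    _ = eLpNorm A ⊤ volume * ∫⁻ x, ‖φ x‖ₑ ^ p := lintegral_const_mul' _ _ hA.2.ne
    _ < ⊤ := ENNReal.mul_lt_top hA.2
        (lintegral_enorm_rpow_lt_top_of_hasCompactSupport h.continuous h.2 hp)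

/-! ### Linear structure and closedness -/

lemma TestFun.isWA (hp : 0 < p) {φ : RN N → ℝ} (h : TestFun φ) : IsWA p A φ (gradient φ) :=
  ⟨h.continuous.aestronglyMeasurable, h.continuous_gradient.aestronglyMeasurable,
    fun _ => φ, fun _ => h, by simp [energy, hp]⟩

lemma IsWA.congr {u u' : RN N → ℝ} {V V' : RN N → RN N} (h : IsWA p A u V)
    (hu : u =ᵐ[volume] u') (hV : V =ᵐ[volume] V') : IsWA p A u' V' := by
  refine ⟨h.aesm.congr hu, h.aesmGrad.congr hV, ?_⟩
  obtain ⟨φ, hφ, hlim⟩ := h.approx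
  refine ⟨φ, hφ, hlim.congr fun n => energy_congr ?_ ?_⟩
  · exact (EventuallyEq.refl _ _).sub hu
  · exact (EventuallyEq.refl _ _).sub hV

lemma IsWA.add (hp : 1 ≤ p) (hA : AEMeasurable A volume) {u u' : RN N → ℝ} {V V' : RN N → RN N}
    (h : IsWA p A u V) (h' : IsWA p A u' V') : IsWA p A (u + u') (V + V') := by
  refine ⟨h.aesm.add h'.aesm, h.aesmGrad.add h'.aesmGrad, ?_⟩
  obtain ⟨φ, hφ, hlim⟩ := h.approx
  obtain ⟨φ', hφ', hlim'⟩ := h'.approx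
  refine ⟨fun n => φ n + φ' n, fun n => (hφ n).add (hφ' n), ?_⟩
  have hz : Tendsto (fun n => (2 : ℝ≥0∞) ^ (p - 1) * (energy p A (φ n - u) (gradient (φ n) - V) +
      energy p A (φ' n - u') (gradient (φ' n) - V'))) atTop (𝓝 0) := by
    simpa using ENNReal.Tendsto.const_mul (hlim.add hlim') (Or.inr (by simp))
  refine tendsto_of_tendsto_of_tendsto_of_le_of_le tendsto_const_nhds hz (fun _ => zero_le) ?_
  intro n
  have e1 : φ n + φ' n - (u + u') = (φ n - u) + (φ' n - u') := by abel
  have e2 : gradient (φ n + φ' n) - (V + V') = (gradient (φ n) - V) + (gradient (φ' n) - V') := by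
    rw [gradient_add' (hφ n).differentiable (hφ' n).differentiable]; abel
  simp only [e1, e2]
  exact energy_add_le hp hA ((hφ n).continuous.aestronglyMeasurable.sub h.aesm)
    ((hφ n).continuous_gradient.aestronglyMeasurable.sub h.aesmGrad)

lemma IsWA.const_smul (hp : 0 < p) {u : RN N → ℝ} {V : RN N → RN N}
    (h : IsWA p A u V) (c : ℝ) : IsWA p A (c • u) (c • V) := by
  refine ⟨h.aesm.const_smul c, h.aesmGrad.const_smul c, ?_⟩
  obtain ⟨φ, hφ, hlim⟩ := h.approx
  refine ⟨fun n => c • φ n, fun n => (hφ n).const_smul c, ?_⟩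
  have hz : Tendsto (fun n => ‖c‖ₑ ^ p * (energy p A (φ n - u) (gradient (φ n) - V)))
      atTop (𝓝 0) := by
    simpa using ENNReal.Tendsto.const_mul hlim (Or.inr (ENNReal.rpow_ne_top_of_nonneg hp.le (by simp)))
  refine hz.congr fun n => ?_
  rw [gradient_const_smul' (hφ n).differentiable, ← smul_sub, ← smul_sub, energy_const_smul hp.le]

lemma IsWA.sub (hp : 1 ≤ p) (hA : AEMeasurable A volume) {u u' : RN N → ℝ} {V V' : RN N → RN N}
    (h : IsWA p A u V) (h' : IsWA p A u' V') : IsWA p A (u - u') (V - V') := by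
  have := h.add hp hA (h'.const_smul (by linarith) (-1))
  simpa [sub_eq_add_neg] using this

lemma IsWA.energy_lt_top (hp : 1 ≤ p) (hA : MemLp A ⊤ volume) {u : RN N → ℝ} {V : RN N → RN N}
    (h : IsWA p A u V) : energy p A u V < ⊤ := by
  have hA' := hA.1.aemeasurable
  obtain ⟨φ, hφ, hlim⟩ := h.approx
  obtain ⟨n, hn⟩ := (hlim.eventually (gt_mem_nhds (zero_lt_one (α := ℝ≥0∞)))).exists
  have e1 : u = φ n + (u - φ n) := by abel
  have e2 : V = gradient (φ n) + (V - gradient (φ n)) := by abel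
  rw [e1, e2]
  refine (energy_add_le hp hA' (hφ n).continuous.aestronglyMeasurable
    (hφ n).continuous_gradient.aestronglyMeasurable).trans_lt ?_
  rw [energy_sub_comm u]
  refine ENNReal.mul_lt_top (ENNReal.rpow_lt_top_of_nonneg (by linarith) (by simp)) (ENNReal.add_lt_top.2 ⟨?_, hn.trans ENNReal.one_lt_top⟩)
  exact (hφ n).energy_lt_top (by linarith) hA

/-- The space is closed for the energy. -/
lemma IsWA.of_tendsto (hp : 1 ≤ p) (hA : AEMeasurable A volume) {u : ℕ → RN N → ℝ}
    {V : ℕ → RN N → RN N} {u' : RN N → ℝ} {V' : RN N → RN N}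
    (h : ∀ n, IsWA p A (u n) (V n)) (hu : AEStronglyMeasurable u' volume)
    (hV : AEStronglyMeasurable V' volume)
    (hlim : Tendsto (fun n => energy p A (u n - u') (V n - V')) atTop (𝓝 0)) :
    IsWA p A u' V' := by
  refine ⟨hu, hV, ?_⟩
  -- One test function within 1/(n+1) of each term gives a single approximating sequence for the
  -- limit.
  have h1 : ∀ n : ℕ, ∃ φ : RN N → ℝ, TestFun φ ∧
      energy p A (φ - u n) (gradient φ - V n) < ((n : ℝ≥0∞) + 1)⁻¹ := by
    intro n
    obtain ⟨φ, hφ, hl⟩ := (h n).approx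
    have hn : (0 : ℝ≥0∞) < ((n : ℝ≥0∞) + 1)⁻¹ := by simp
    obtain ⟨k, hk⟩ := (hl.eventually (gt_mem_nhds hn)).exists
    exact ⟨φ k, hφ k, hk⟩
  choose φ hφ hlt using h1
  refine ⟨φ, hφ, ?_⟩
  have hinv : Tendsto (fun n : ℕ => ((n : ℝ≥0∞) + 1)⁻¹) atTop (𝓝 0) := by
    have := (tendsto_add_atTop_iff_nat 1).2 ENNReal.tendsto_inv_nat_nhds_zero
    simpa using this
  have hz : Tendsto (fun n : ℕ => (2 : ℝ≥0∞) ^ (p - 1) * (((n : ℝ≥0∞) + 1)⁻¹ +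
      energy p A (u n - u') (V n - V'))) atTop (𝓝 0) := by
    simpa using ENNReal.Tendsto.const_mul (hinv.add hlim) (Or.inr (by simp))
  refine tendsto_of_tendsto_of_tendsto_of_le_of_le tendsto_const_nhds hz (fun _ => zero_le) ?_
  intro n
  have e1 : φ n - u' = (φ n - u n) + (u n - u') := by abel
  have e2 : gradient (φ n) - V' = (gradient (φ n) - V n) + (V n - V') := by abel
  simp only [e1, e2]
  refine (energy_add_le hp hA ((hφ n).continuous.aestronglyMeasurable.sub (h n).aesm)
    ((hφ n).continuous_gradient.aestronglyMeasurable.sub (h n).aesmGrad)).trans ?_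
  gcongr
  exact (hlt n).le

/-- Energy convergence implies a.e. convergence along a subsequence. -/
lemma exists_subseq_ae_of_energy (hp : 0 < p) (hA : AEMeasurable A volume)
    (hpos : ∀ᵐ x, 0 < A x) {u : ℕ → RN N → ℝ}
    {V : ℕ → RN N → RN N} (hu : ∀ n, AEStronglyMeasurable (u n) volume)
    (hV : ∀ n, AEStronglyMeasurable (V n) volume)
    (hlim : Tendsto (fun n => energy p A (u n) (V n)) atTop (𝓝 0)) :
    ∃ ns : ℕ → ℕ, StrictMono ns ∧ ∀ᵐ x, Tendsto (fun n => u (ns n) x) atTop (𝓝 0) := by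
  obtain ⟨ns, hns, h⟩ := exists_subseq_ae_tendsto_zero (μ := volume)
    (f := fun n x => ‖V n x‖ₑ ^ p + ENNReal.ofReal (A x) * ‖u n x‖ₑ ^ p)
    (fun n => ((hV n).enorm.pow_const _).add (hA.ennreal_ofReal.mul ((hu n).enorm.pow_const _)))
    hlim
  refine ⟨ns, hns, ?_⟩
  filter_upwards [h, hpos] with x hx hAx
  rw [tendsto_zero_iff_norm_tendsto_zero, ← enorm_rpow_tendsto_zero_iff hp]
  have h1 : Tendsto (fun n => ENNReal.ofReal (A x) * ‖u (ns n) x‖ₑ ^ p) atTop (𝓝 0) :=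
    tendsto_of_tendsto_of_tendsto_of_le_of_le tendsto_const_nhds hx (fun _ => zero_le)
      fun n => le_add_self
  -- The weighted term controls `u` pointwise because A(x) > 0 can be divided out.
  have h0 : ENNReal.ofReal (A x) ≠ 0 := by simpa using hAx
  have h2 := ENNReal.Tendsto.const_mul (a := (ENNReal.ofReal (A x))⁻¹) h1
    (Or.inr (by simpa using hAx))
  simp only [mul_zero] at h2
  refine h2.congr fun n => ?_
  rw [← mul_assoc, ENNReal.inv_mul_cancel h0 (by simp), one_mul]

end NodalNehari

/-! ### Sobolev embedding, weak gradients, and gradients on zero sets -/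

namespace NodalNehari

variable {N : ℕ} {p : ℝ} {A : RN N → ℝ}

/-! ### The Sobolev inequality -/

lemma lt_pStar (hp : 1 < p) (hpN : p < N) : p < pStar N p := by
  unfold pStar
  rw [lt_div_iff₀ (by linarith)]
  nlinarith

lemma pStar_pos (hp : 1 < p) (hpN : p < N) : 0 < pStar N p := by
  linarith [lt_pStar hp hpN]

/-- The Gagliardo–Nirenberg–Sobolev inequality raised to the power p^*, so that only lower integrals
occur and Fatou's lemma applies directly. -/
lemma sobolev_testFun (hp : 1 < p) (hpN : p < N) : ∃ C : ℝ≥0∞, C ≠ ⊤ ∧ ∀ φ : RN N → ℝ, TestFun φ →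
    ∫⁻ x, ‖φ x‖ₑ ^ pStar N p ≤ C * (∫⁻ x, ‖gradient φ x‖ₑ ^ p) ^ (pStar N p / p) := by
  have hs := pStar_pos hp hpN
  have hN : 0 < N := by
    have : (0 : ℝ) < N := by linarith
    exact_mod_cast this
  let C₀ : ℝ≥0∞ := SNormLESNormFDerivOfEqConst (E := RN N) ℝ volume p.toNNReal
  refine ⟨C₀ ^ pStar N p, ENNReal.rpow_ne_top_of_nonneg hs.le (by simp [C₀]), fun φ hφ => ?_⟩
  have key := eLpNorm_le_eLpNorm_fderiv_of_eq (volume : Measure (RN N)) (u := φ)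
    (hφ.1.of_le (by simp)) hφ.2 (p := p.toNNReal) (p' := (pStar N p).toNNReal)
    (by simpa using hp.le) (by simpa using hN) (by
      rw [Real.coe_toNNReal _ hs.le, NNReal.coe_inv, Real.coe_toNNReal _ (by linarith)]
      simp only [finrank_euclideanSpace, Fintype.card_fin, pStar]
      have : (N : ℝ) ≠ 0 := by positivity
      have : p ≠ 0 := by linarith
      have : (N : ℝ) - p ≠ 0 := by linarith
      field_simp)
  have hp0 : 0 < p := by linarith
  have ne1 : ((p.toNNReal : NNReal) : ℝ≥0∞) ≠ 0 := by simpa using hp0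
  have ne2 : (((pStar N p).toNNReal : NNReal) : ℝ≥0∞) ≠ 0 := by simpa using hs
  rw [eLpNorm_eq_lintegral_rpow_enorm_toReal ne2 (by simp),
    eLpNorm_eq_lintegral_rpow_enorm_toReal ne1 (by simp)] at key
  simp only [ENNReal.coe_toReal, Real.coe_toNNReal _ hs.le, Real.coe_toNNReal _ hp0.le] at key
  have key2 := ENNReal.rpow_le_rpow key hs.le
  rw [← ENNReal.rpow_mul, ENNReal.mul_rpow_of_nonneg _ _ hs.le, ← ENNReal.rpow_mul,
    one_div_mul_cancel hs.ne', ENNReal.rpow_one] at key2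
  have e1 : ∀ x, ‖gradient φ x‖ₑ = ‖fderiv ℝ φ x‖ₑ := fun x => by
    rw [← ofReal_norm, norm_gradient, ofReal_norm]
  have e2 : pStar N p / p = 1 / p * pStar N p := by ring
  simp only [e1, e2, C₀, Real.coe_toNNReal _ hp0.le]
  exact key2

/-- Fatou's lemma along an a.e. convergent subsequence of test functions. The factor 2^(p-1) comes
from splitting ∇φ_n as V + (∇φ_n - V), and the second term vanishes in the limit. -/
lemma IsWA.sobolev (hp : 1 < p) (hpN : p < N) (hA : AEMeasurable A volume)
    (hpos : ∀ᵐ x, 0 < A x) {C : ℝ≥0∞} (hC : C ≠ ⊤)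
    (hsob : ∀ φ : RN N → ℝ, TestFun φ →
      ∫⁻ x, ‖φ x‖ₑ ^ pStar N p ≤ C * (∫⁻ x, ‖gradient φ x‖ₑ ^ p) ^ (pStar N p / p))
    {u : RN N → ℝ} {V : RN N → RN N} (h : IsWA p A u V) :
    ∫⁻ x, ‖u x‖ₑ ^ pStar N p ≤
      C * (2 ^ (p - 1) * ∫⁻ x, ‖V x‖ₑ ^ p) ^ (pStar N p / p) := by
  have hs := pStar_pos hp hpN
  have hp0 : 0 < p := by linarith
  obtain ⟨φ, hφ, hlim⟩ := h.approx
  obtain ⟨ns, hns, hae⟩ := exists_subseq_ae_of_energy hp0 hA hpos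
    (fun n => (hφ n).continuous.aestronglyMeasurable.sub h.aesm)
    (fun n => (hφ n).continuous_gradient.aestronglyMeasurable.sub h.aesmGrad) hlim
  have hlim' := hlim.comp hns.tendsto_atTop
  have hg : Tendsto (fun n => ∫⁻ x, ‖(gradient (φ (ns n)) - V) x‖ₑ ^ p) atTop (𝓝 0) :=
    tendsto_of_tendsto_of_tendsto_of_le_of_le tendsto_const_nhds hlim' (fun _ => zero_le)
      fun n => lintegral_grad_le_energy _ _
  have hbd : Tendsto (fun n => C * (2 ^ (p - 1) * ((∫⁻ x, ‖V x‖ₑ ^ p) +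
      ∫⁻ x, ‖(gradient (φ (ns n)) - V) x‖ₑ ^ p)) ^ (pStar N p / p)) atTop
      (𝓝 (C * (2 ^ (p - 1) * ((∫⁻ x, ‖V x‖ₑ ^ p) + 0)) ^ (pStar N p / p))) := by
    refine ENNReal.Tendsto.const_mul ?_ (Or.inr hC)
    refine (ENNReal.continuous_rpow_const.tendsto _).comp ?_
    exact ENNReal.Tendsto.const_mul (tendsto_const_nhds.add hg)
      (Or.inr (ENNReal.rpow_ne_top_of_nonneg (by linarith) (by simp)))
  rw [add_zero] at hbd
  calc ∫⁻ x, ‖u x‖ₑ ^ pStar N p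
      = ∫⁻ x, liminf (fun n => ‖φ (ns n) x‖ₑ ^ pStar N p) atTop := by
        refine lintegral_congr_ae (hae.mono fun x hx => ?_)
        have h1 : Tendsto (fun n => φ (ns n) x) atTop (𝓝 (u x)) := by
          simpa using hx.add_const (u x)
        exact (((ENNReal.continuous_rpow_const.tendsto _).comp
          ((continuous_enorm.tendsto _).comp h1)).liminf_eq).symm
    _ ≤ liminf (fun n => ∫⁻ x, ‖φ (ns n) x‖ₑ ^ pStar N p) atTop :=
        lintegral_liminf_le' fun n => (hφ _).continuous.aestronglyMeasurable.enorm.pow_const _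
    _ ≤ liminf (fun n => C * (2 ^ (p - 1) * ((∫⁻ x, ‖V x‖ₑ ^ p) +
      ∫⁻ x, ‖(gradient (φ (ns n)) - V) x‖ₑ ^ p)) ^ (pStar N p / p)) atTop := by
        refine liminf_le_liminf (Eventually.of_forall fun n => ?_)
        refine (hsob _ (hφ _)).trans ?_
        gcongr
        rw [← lintegral_add_left' (h.aesmGrad.enorm.pow_const _),
          ← lintegral_const_mul' _ _ (ENNReal.rpow_ne_top_of_nonneg (by linarith) (by simp))]
        refine lintegral_mono fun x => ?_
        have := enorm_add_rpow_le hp.le (V x) ((gradient (φ (ns n)) - V) x)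
        simpa using this
    _ = _ := hbd.liminf_eq

/-- The Sobolev inequality on `W_A`, with a constant independent of the function. -/
lemma exists_sobolev (hp : 1 < p) (hpN : p < N) (hA : AEMeasurable A volume)
    (hpos : ∀ᵐ x, 0 < A x) : ∃ C : ℝ≥0∞, C ≠ ⊤ ∧
    ∀ (u : RN N → ℝ) (V : RN N → RN N), IsWA p A u V →
      ∫⁻ x, ‖u x‖ₑ ^ pStar N p ≤ C * (∫⁻ x, ‖V x‖ₑ ^ p) ^ (pStar N p / p) := by
  have hs := pStar_pos hp hpN
  have hp0 : 0 < p := by linarith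
  obtain ⟨C, hC, hsob⟩ := sobolev_testFun (N := N) hp hpN
  refine ⟨C * (2 ^ (p - 1)) ^ (pStar N p / p), ENNReal.mul_ne_top hC
    (ENNReal.rpow_ne_top_of_nonneg (by positivity)
      (ENNReal.rpow_ne_top_of_nonneg (by linarith) (by simp))), fun u V h => ?_⟩
  have := h.sobolev hp hpN hA hpos hC hsob
  rwa [ENNReal.mul_rpow_of_nonneg _ _ (by positivity), ← mul_assoc] at this

lemma memLp_of_lintegral_lt_top {α E : Type*} [MeasurableSpace α] {μ : Measure α}
    [NormedAddCommGroup E] {f : α → E} {r : ℝ} (hr : 0 < r)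
    (hf : AEStronglyMeasurable f μ) (h : ∫⁻ x, ‖f x‖ₑ ^ r ∂μ < ⊤) :
    MemLp f (ENNReal.ofReal r) μ := by
  refine ⟨hf, ?_⟩
  rw [eLpNorm_lt_top_iff_lintegral_rpow_enorm_lt_top (by simpa using hr) (by simp)]
  simpa [ENNReal.toReal_ofReal hr.le] using h

lemma IsWA.lintegral_grad_lt_top (hp : 1 ≤ p) (hA : MemLp A ⊤ volume) {u : RN N → ℝ}
    {V : RN N → RN N} (h : IsWA p A u V) : ∫⁻ x, ‖V x‖ₑ ^ p < ⊤ :=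
  (lintegral_grad_le_energy u V).trans_lt (h.energy_lt_top hp hA)

lemma IsWA.memLp_grad (hp : 1 ≤ p) (hA : MemLp A ⊤ volume) {u : RN N → ℝ} {V : RN N → RN N}
    (h : IsWA p A u V) : MemLp V (ENNReal.ofReal p) volume :=
  memLp_of_lintegral_lt_top (by linarith) h.aesmGrad (h.lintegral_grad_lt_top hp hA)

lemma IsWA.lintegral_pStar_lt_top (hp : 1 < p) (hpN : p < N) (hA : MemLp A ⊤ volume)
    (hpos : ∀ᵐ x, 0 < A x) {u : RN N → ℝ} {V : RN N → RN N}
    (h : IsWA p A u V) : ∫⁻ x, ‖u x‖ₑ ^ pStar N p < ⊤ := by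
  obtain ⟨C, hC, hsob⟩ := exists_sobolev hp hpN hA.1.aemeasurable hpos
  refine (hsob u V h).trans_lt (ENNReal.mul_lt_top hC.lt_top ?_)
  exact ENNReal.rpow_lt_top_of_nonneg
    (div_nonneg (pStar_pos hp hpN).le (by linarith)) (h.lintegral_grad_lt_top hp.le hA).ne

lemma IsWA.locallyIntegrable (hp : 1 < p) (hpN : p < N) (hA : MemLp A ⊤ volume)
    (hpos : ∀ᵐ x, 0 < A x) {u : RN N → ℝ} {V : RN N → RN N}
    (h : IsWA p A u V) : LocallyIntegrable u volume :=
  (memLp_of_lintegral_lt_top (pStar_pos hp hpN) h.aesm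
    (h.lintegral_pStar_lt_top hp hpN hA hpos)).locallyIntegrable
    (by simpa using (hp.trans (lt_pStar hp hpN)).le)

lemma IsWA.locallyIntegrable_grad (hp : 1 ≤ p) (hA : MemLp A ⊤ volume) {u : RN N → ℝ}
    {V : RN N → RN N} (h : IsWA p A u V) : LocallyIntegrable V volume :=
  (h.memLp_grad hp hA).locallyIntegrable (by simpa using hp)

/-! ### Weak gradients -/

/-- `L^r` convergence implies `L^1` convergence on sets of finite measure. -/
lemma tendsto_setLIntegral_of_rpow {α E : Type*} [MeasurableSpace α] {μ : Measure α}
    [NormedAddCommGroup E] {f : ℕ → α → E} {r : ℝ} (hr : 1 ≤ r)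
    (hf : ∀ n, AEStronglyMeasurable (f n) μ)
    (h : Tendsto (fun n => ∫⁻ x, ‖f n x‖ₑ ^ r ∂μ) atTop (𝓝 0)) {K : Set α} (hK : μ K ≠ ⊤) :
    Tendsto (fun n => ∫⁻ x in K, ‖f n x‖ₑ ∂μ) atTop (𝓝 0) := by
  have hr0 : 0 < r := by linarith
  have hb : ∀ n, ∫⁻ x in K, ‖f n x‖ₑ ∂μ ≤
      (∫⁻ x, ‖f n x‖ₑ ^ r ∂μ) ^ (1 / r) * μ K ^ (1 - 1 / r) := by
    intro n
    have h1 := eLpNorm_le_eLpNorm_mul_rpow_measure_univ (μ := μ.restrict K) (p := 1)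
      (q := ENNReal.ofReal r) (by simpa using hr) (hf n).restrict
    rw [eLpNorm_one_eq_lintegral_enorm, eLpNorm_eq_lintegral_rpow_enorm_toReal
      (by simpa using hr0) (by simp), ENNReal.toReal_ofReal hr0.le] at h1
    refine h1.trans ?_
    simp only [ENNReal.toReal_one, Measure.restrict_apply_univ, div_one]
    gcongr
    exact Measure.restrict_le_self
  have hz : Tendsto (fun n => (∫⁻ x, ‖f n x‖ₑ ^ r ∂μ) ^ (1 / r) * μ K ^ (1 - 1 / r))
      atTop (𝓝 0) := by
    have h1 := (ENNReal.continuous_rpow_const (y := 1 / r)).tendsto 0 |>.comp h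
    rw [ENNReal.zero_rpow_of_pos (by positivity)] at h1
    have := ENNReal.Tendsto.mul_const (b := μ K ^ (1 - 1 / r)) h1
      (Or.inr (ENNReal.rpow_ne_top_of_nonneg
        (by rw [sub_nonneg, div_le_one hr0]; exact hr) hK))
    simpa using this
  exact tendsto_of_tendsto_of_tendsto_of_le_of_le tendsto_const_nhds hz (fun _ => zero_le) hb

/-- `L^r` convergence implies convergence of integrals against bounded functions
with support of finite measure. -/
lemma tendsto_integral_smul_of_rpow {E : Type*} [NormedAddCommGroup E]
    [NormedSpace ℝ E] {f : ℕ → RN N → E} {f' : RN N → E} {r : ℝ}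
    (hr : 1 ≤ r) (hf : ∀ n, LocallyIntegrable (f n) volume) (hf' : LocallyIntegrable f' volume)
    (h : Tendsto (fun n => ∫⁻ x, ‖f n x - f' x‖ₑ ^ r) atTop (𝓝 0))
    {ψ : RN N → ℝ} (hψ : Continuous ψ) (hc : HasCompactSupport ψ) :
    Tendsto (fun n => ∫ x, ψ x • f n x) atTop (𝓝 (∫ x, ψ x • f' x)) := by
  obtain ⟨M, hM⟩ := hc.exists_bound_of_continuous hψ
  have h1 := tendsto_setLIntegral_of_rpow hr
    (fun n => (hf n).aestronglyMeasurable.sub hf'.aestronglyMeasurable) h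
    (K := tsupport ψ) hc.measure_lt_top.ne
  refine tendsto_integral_of_L1' _ ?_ (Eventually.of_forall fun n => ?_) ?_
  · exact (hf'.integrable_smul_left_of_hasCompactSupport hψ hc).aestronglyMeasurable
  · exact (hf n).integrable_smul_left_of_hasCompactSupport hψ hc
  · have hz : Tendsto (fun n => ENNReal.ofReal M * ∫⁻ x in tsupport ψ, ‖(f n - f') x‖ₑ)
        atTop (𝓝 0) := by
      simpa using ENNReal.Tendsto.const_mul h1 (Or.inr (by simp))
    refine tendsto_of_tendsto_of_tendsto_of_le_of_le tendsto_const_nhds hz (fun _ => zero_le) ?_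
    intro n
    simp only
    rw [eLpNorm_one_eq_lintegral_enorm, ← lintegral_const_mul' _ _ (by simp),
      ← lintegral_indicator (isClosed_tsupport ψ).measurableSet]
    refine lintegral_mono fun x => ?_
    by_cases hx : x ∈ tsupport ψ
    · simp only [Pi.sub_apply, indicator_of_mem hx, ← smul_sub, enorm_smul]
      gcongr
      rw [← ofReal_norm]
      exact ENNReal.ofReal_le_ofReal (hM x)
    · simp [image_eq_zero_of_notMem_tsupport hx]

/-- Pairing with a fixed vector reduces this to scalar integration by parts. No compact support is
asked of φ, because the lemma is applied to compositions f ∘ φ_n with f(0) possibly nonzero. -/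
lemma integral_smul_gradient_eq_neg {φ ψ : RN N → ℝ} (hφ : ContDiff ℝ 1 φ) (hψ : TestFun ψ) :
    ∫ x, φ x • gradient ψ x = - ∫ x, ψ x • gradient φ x := by
  have hgφ : Continuous (gradient φ) :=
    (LinearIsometryEquiv.continuous _).comp (hφ.continuous_fderiv (by simp))
  have i1 : Integrable (fun x => φ x • gradient ψ x) :=
    (hφ.continuous.smul hψ.continuous_gradient).integrable_of_hasCompactSupport
      hψ.hasCompactSupport_gradient.smul_left
  have i2 : Integrable (fun x => ψ x • gradient φ x) :=
    (hψ.continuous.smul hgφ).integrable_of_hasCompactSupport hψ.2.smul_right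
  refine ext_inner_right ℝ fun v => ?_
  rw [inner_neg_left, real_inner_comm, real_inner_comm v, ← integral_inner i1, ← integral_inner i2]
  simp only [inner_smul_right]
  have e1 : ∀ x, fderiv ℝ φ x v = inner ℝ v (gradient φ x) := fun x => by
    rw [real_inner_comm, inner_gradient]
  have e2 : ∀ x, fderiv ℝ ψ x v = inner ℝ v (gradient ψ x) := fun x => by
    rw [real_inner_comm, inner_gradient]
  simp only [← e1, ← e2]
  rw [integral_mul_fderiv_eq_neg_fderiv_mul_of_integrable]
  · simp only [mul_comm]
  · simp only [e1]
    have := i2.const_inner (𝕜 := ℝ) v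
    simpa [inner_smul_right, mul_comm] using this
  · simp only [e2]
    have := i1.const_inner (𝕜 := ℝ) v
    simpa [inner_smul_right, mul_comm] using this
  · exact (hφ.continuous.mul hψ.continuous).integrable_of_hasCompactSupport hψ.2.mul_left
  · exact fun x _ => hφ.differentiable (by simp) x
  · exact fun x _ => hψ.differentiable x

end NodalNehari

namespace NodalNehari

variable {N : ℕ} {p : ℝ} {A : RN N → ℝ}

lemma IsWeakGradient.ae_unique {u u' : RN N → ℝ} {V V' : RN N → RN N} (h : IsWeakGradient u V)
    (h' : IsWeakGradient u' V') (hu : u =ᵐ[volume] u') : V =ᵐ[volume] V' := by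
  refine ae_eq_of_integral_contDiff_smul_eq h.locIntGrad h'.locIntGrad fun ψ hψ hc => ?_
  have h1 := h.integral_eq ψ ⟨hψ, hc⟩
  have h2 := h'.integral_eq ψ ⟨hψ, hc⟩
  rw [integral_congr_ae (hu.mono fun x hx => by rw [hx]), h2] at h1
  exact (neg_injective h1).symm

lemma weakGrad_ae_eq {u : RN N → ℝ} {V : RN N → RN N} (h : IsWeakGradient u V) :
    weakGrad u =ᵐ[volume] V := by
  have hex : ∃ V, IsWeakGradient u V := ⟨V, h⟩
  rw [weakGrad, dif_pos hex]
  exact hex.choose_spec.ae_unique h EventuallyEq.rfl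

/-- The differences to an approximating sequence tend to zero in `L^{p^*}`. -/
lemma tendsto_lintegral_pStar (hp : 1 < p) (hpN : p < N) (hA : MemLp A ⊤ volume)
    (hpos : ∀ᵐ x, 0 < A x) {u : ℕ → RN N → ℝ} {V : ℕ → RN N → RN N}
    (h : ∀ n, IsWA p A (u n) (V n))
    (hlim : Tendsto (fun n => energy p A (u n) (V n)) atTop (𝓝 0)) :
    Tendsto (fun n => ∫⁻ x, ‖u n x‖ₑ ^ pStar N p) atTop (𝓝 0) := by
  have hs := pStar_pos hp hpN
  obtain ⟨C, hC, hsob⟩ := exists_sobolev hp hpN hA.1.aemeasurable hpos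
  have hr : 0 < pStar N p / p := div_pos hs (by linarith)
  have h1 := ((ENNReal.continuous_rpow_const (y := pStar N p / p)).tendsto 0).comp hlim
  rw [ENNReal.zero_rpow_of_pos hr] at h1
  have hz := ENNReal.Tendsto.const_mul h1 (Or.inr hC)
  rw [mul_zero] at hz
  refine tendsto_of_tendsto_of_tendsto_of_le_of_le tendsto_const_nhds hz (fun _ => zero_le) ?_
  intro n
  refine (hsob _ _ (h n)).trans ?_
  simp only [Function.comp]
  gcongr
  exact lintegral_grad_le_energy _ _

/-- Test functions approximating an element of the space, with all the modes of convergence. -/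
lemma IsWA.exists_approx (hp : 1 < p) (hpN : p < N) (hA : MemLp A ⊤ volume)
    (hpos : ∀ᵐ x, 0 < A x) {u : RN N → ℝ} {V : RN N → RN N} (h : IsWA p A u V) :
    ∃ φ : ℕ → RN N → ℝ, (∀ n, TestFun (φ n)) ∧
      Tendsto (fun n => energy p A (φ n - u) (gradient (φ n) - V)) atTop (𝓝 0) ∧
      Tendsto (fun n => ∫⁻ x, ‖φ n x - u x‖ₑ ^ pStar N p) atTop (𝓝 0) ∧
      Tendsto (fun n => ∫⁻ x, ‖gradient (φ n) x - V x‖ₑ ^ p) atTop (𝓝 0) ∧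
      ∀ᵐ x, Tendsto (fun n => φ n x) atTop (𝓝 (u x)) := by
  have hp0 : 0 < p := by linarith
  obtain ⟨φ, hφ, hlim⟩ := h.approx
  have hW : ∀ n, IsWA p A (φ n - u) (gradient (φ n) - V) := fun n =>
    ((hφ n).isWA hp0).sub hp.le hA.1.aemeasurable h
  obtain ⟨ns, hns, hae⟩ := exists_subseq_ae_of_energy hp0 hA.1.aemeasurable hpos
    (fun n => (hW n).aesm) (fun n => (hW n).aesmGrad) hlim
  have hlim' := hlim.comp hns.tendsto_atTop
  refine ⟨fun n => φ (ns n), fun n => hφ _, hlim', ?_, ?_, ?_⟩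
  · exact tendsto_lintegral_pStar hp hpN hA hpos (fun n => hW (ns n)) hlim'
  · exact tendsto_of_tendsto_of_tendsto_of_le_of_le tendsto_const_nhds hlim' (fun _ => zero_le)
      fun n => lintegral_grad_le_energy (φ (ns n) - u) _
  · filter_upwards [hae] with x hx
    simpa using hx.add_const (u x)

/-- Integration by parts for the approximating test functions passes to the limit: the functions
converge in L^{p^*}, their gradients in L^p, and both are tested against compactly supported
factors. -/
lemma IsWA.isWeakGradient (hp : 1 < p) (hpN : p < N) (hA : MemLp A ⊤ volume)
    (hpos : ∀ᵐ x, 0 < A x) {u : RN N → ℝ} {V : RN N → RN N} (h : IsWA p A u V) :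
    IsWeakGradient u V := by
  have hu := h.locallyIntegrable hp hpN hA hpos
  have hV := h.locallyIntegrable_grad hp.le hA
  refine ⟨hu, hV, fun ψ hψ => ?_⟩
  obtain ⟨φ, hφ, -, h1, h2, -⟩ := h.exists_approx hp hpN hA hpos
  have l2 := tendsto_integral_smul_of_rpow hp.le
    (fun n => (hφ n).continuous_gradient.locallyIntegrable) hV h2 hψ.continuous hψ.2
  have l1 : Tendsto (fun n => ∫ x, φ n x • gradient ψ x) atTop (𝓝 (∫ x, u x • gradient ψ x)) := by
    have i1 : ∀ f : RN N → ℝ, LocallyIntegrable f volume →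
        Integrable (fun x => f x • gradient ψ x) := fun f hf =>
      hf.integrable_smul_right_of_hasCompactSupport hψ.continuous_gradient
        hψ.hasCompactSupport_gradient
    obtain ⟨M, hM⟩ := hψ.hasCompactSupport_gradient.exists_bound_of_continuous
      hψ.continuous_gradient
    have h3 := tendsto_setLIntegral_of_rpow (f := fun n => φ n - u)
      ((hp.trans (lt_pStar hp hpN)).le)
      (fun n => (hφ n).continuous.aestronglyMeasurable.sub h.aesm) h1
      (K := tsupport (gradient ψ)) hψ.hasCompactSupport_gradient.measure_lt_top.ne
    refine tendsto_integral_of_L1' _ (i1 u hu).aestronglyMeasurable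
      (Eventually.of_forall fun n => i1 _ (hφ n).continuous.locallyIntegrable) ?_
    have hz := ENNReal.Tendsto.const_mul (a := ENNReal.ofReal M) h3 (Or.inr (by simp))
    rw [mul_zero] at hz
    refine tendsto_of_tendsto_of_tendsto_of_le_of_le tendsto_const_nhds hz (fun _ => zero_le) ?_
    intro n
    simp only
    rw [eLpNorm_one_eq_lintegral_enorm, ← lintegral_const_mul' _ _ (by simp),
      ← lintegral_indicator (isClosed_tsupport _).measurableSet]
    refine lintegral_mono fun x => ?_
    by_cases hx : x ∈ tsupport (gradient ψ)
    · simp only [Pi.sub_apply, indicator_of_mem hx, ← sub_smul, enorm_smul]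
      rw [mul_comm]
      gcongr
      rw [← ofReal_norm]
      exact ENNReal.ofReal_le_ofReal (hM x)
    · simp [image_eq_zero_of_notMem_tsupport hx]
  refine tendsto_nhds_unique l1 (l2.neg.congr fun n => ?_)
  exact (integral_smul_gradient_eq_neg ((hφ n).1.of_le (by simp)) hψ).symm

lemma IsWA.weakGrad_ae_eq (hp : 1 < p) (hpN : p < N) (hA : MemLp A ⊤ volume)
    (hpos : ∀ᵐ x, 0 < A x) {u : RN N → ℝ} {V : RN N → RN N} (h : IsWA p A u V) :
    weakGrad u =ᵐ[volume] V :=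
  NodalNehari.weakGrad_ae_eq (h.isWeakGradient hp hpN hA hpos)

lemma IsWA.ae_unique (hp : 1 < p) (hpN : p < N) (hA : MemLp A ⊤ volume)
    (hpos : ∀ᵐ x, 0 < A x) {u u' : RN N → ℝ} {V V' : RN N → RN N} (h : IsWA p A u V)
    (h' : IsWA p A u' V') (hu : u =ᵐ[volume] u') : V =ᵐ[volume] V' :=
  (h.isWeakGradient hp hpN hA hpos).ae_unique (h'.isWeakGradient hp hpN hA hpos) hu

/-- Membership in `W_A` in terms of `IsWA`. -/
lemma mem_WA_iff (hp : 1 < p) (hpN : p < N) (hA : MemLp A ⊤ volume)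
    (hpos : ∀ᵐ x, 0 < A x) (u : RN N →ₘ[volume] ℝ) :
    u ∈ WA p A ↔ IsWA p A u (weakGrad u) := by
  constructor
  · rintro ⟨⟨V, hV⟩, φ, hφ, hlim⟩
    refine ⟨u.aestronglyMeasurable, ?_, φ, hφ, hlim⟩
    exact hV.locIntGrad.aestronglyMeasurable.congr (NodalNehari.weakGrad_ae_eq hV).symm
  · intro h
    obtain ⟨φ, hφ, hlim⟩ := h.approx
    exact ⟨⟨_, h.isWeakGradient hp hpN hA hpos⟩, φ, hφ, hlim⟩

lemma mem_WA_of_isWA (hp : 1 < p) (hpN : p < N) (hA : MemLp A ⊤ volume)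
    (hpos : ∀ᵐ x, 0 < A x) {u : RN N →ₘ[volume] ℝ} {f : RN N → ℝ} {V : RN N → RN N}
    (h : IsWA p A f V) (hu : u =ᵐ[volume] f) : u ∈ WA p A := by
  have h' : IsWA p A u V := h.congr hu.symm EventuallyEq.rfl
  exact (mem_WA_iff hp hpN hA hpos u).2
    (h'.congr EventuallyEq.rfl (h'.weakGrad_ae_eq hp hpN hA hpos).symm)

/-! ### The gradient vanishes on level sets -/

/-- The chain rule for `f ∘ u` with `f` bounded and `C^1` with bounded derivative. -/
lemma IsWA.integral_comp_smul_gradient (hp : 1 < p) (hpN : p < N) (hA : MemLp A ⊤ volume)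
    (hpos : ∀ᵐ x, 0 < A x) {u : RN N → ℝ} {V : RN N → RN N} (h : IsWA p A u V)
    {f : ℝ → ℝ} (hf : ContDiff ℝ 1 f) {M : ℝ} (hM : ∀ s, |f s| ≤ M) (hM' : ∀ s, |deriv f s| ≤ M)
    {ψ : RN N → ℝ} (hψ : TestFun ψ) :
    ∫ x, f (u x) • gradient ψ x = - ∫ x, (ψ x * deriv f (u x)) • V x := by
  have hM0 : 0 ≤ M := (abs_nonneg _).trans (hM 0)
  have hcd : Continuous (deriv f) := hf.continuous_deriv (by simp)
  obtain ⟨φ, hφ, -, h1, h2, hae⟩ := h.exists_approx hp hpN hA hpos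
  have hV := h.locallyIntegrable_grad hp.le hA
  have hgc : ∀ n x, gradient (f ∘ φ n) x = deriv f (φ n x) • gradient (φ n) x := by
    intro n x
    have hd : DifferentiableAt ℝ f (φ n x) := hf.differentiable (by simp) _
    simp only [gradient]
    rw [fderiv_comp x hd ((hφ n).differentiable x), ← map_smul]
    congr 1
    ext v
    simp [mul_comm]
  have hparts : ∀ n, ∫ x, f (φ n x) • gradient ψ x =
      - ∫ x, (ψ x * deriv f (φ n x)) • gradient (φ n) x := by
    intro n
    have := integral_smul_gradient_eq_neg (φ := f ∘ φ n)
      (hf.comp ((hφ n).1.of_le (by simp))) hψ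
    simpa only [Function.comp, hgc n, smul_smul] using this
  have l1 : Tendsto (fun n => ∫ x, f (φ n x) • gradient ψ x) atTop
      (𝓝 (∫ x, f (u x) • gradient ψ x)) := by
    refine tendsto_integral_of_dominated_convergence (fun x => M * ‖gradient ψ x‖)
      (fun n => ((hf.continuous.comp (hφ n).continuous).smul
        hψ.continuous_gradient).aestronglyMeasurable) ?_ ?_ ?_
    · exact (hψ.continuous_gradient.integrable_of_hasCompactSupport
        hψ.hasCompactSupport_gradient).norm.const_mul M
    · refine fun n => Eventually.of_forall fun x => ?_
      rw [norm_smul]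
      gcongr
      exact hM _
    · filter_upwards [hae] with x hx
      exact ((hf.continuous.tendsto _).comp hx).smul_const _
  have hVψ : Integrable (fun x => ψ x • V x) :=
    hV.integrable_smul_left_of_hasCompactSupport hψ.continuous hψ.2
  have l2 : Tendsto (fun n => ∫ x, (ψ x * deriv f (φ n x)) • V x) atTop
      (𝓝 (∫ x, (ψ x * deriv f (u x)) • V x)) := by
    refine tendsto_integral_of_dominated_convergence (fun x => M * ‖ψ x • V x‖)
      (fun n => ((hψ.continuous.mul (hcd.comp
        (hφ n).continuous)).aestronglyMeasurable).smul h.aesmGrad) (hVψ.norm.const_mul M) ?_ ?_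
    · refine fun n => Eventually.of_forall fun x => ?_
      rw [mul_comm, mul_smul, norm_smul]
      gcongr
      exact hM' _
    · filter_upwards [hae] with x hx
      exact (((hcd.tendsto _).comp hx).const_mul _).smul_const _
  have i1 : ∀ n, Integrable (fun x => (ψ x * deriv f (φ n x)) • gradient (φ n) x) := fun n =>
    ((hψ.continuous.mul (hcd.comp (hφ n).continuous)).smul
      (hφ n).continuous_gradient).integrable_of_hasCompactSupport (hψ.2.mul_right.smul_right)
  have i2 : ∀ n, Integrable (fun x => (ψ x * deriv f (φ n x)) • V x) := fun n =>
    hV.integrable_smul_left_of_hasCompactSupport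
      (hψ.continuous.mul (hcd.comp (hφ n).continuous)) hψ.2.mul_right
  have hnorm : ∀ n, LocallyIntegrable (fun x => ‖gradient (φ n) x - V x‖) volume := fun n => by
    have hl := (hφ n).continuous_gradient.locallyIntegrable.sub hV
    exact hl.mono hl.aestronglyMeasurable.norm (Eventually.of_forall fun x => by simp)
  -- Both f'(φ_n) and ∇φ_n depend on n. The gradient is first replaced by V, at a cost bounded by M
  -- ∫ |ψ| |∇φ_n - V|; the factor f'(φ_n) is then handled by dominated convergence in `l2`.
  have l3 : Tendsto (fun n => (∫ x, (ψ x * deriv f (φ n x)) • gradient (φ n) x) -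
      ∫ x, (ψ x * deriv f (φ n x)) • V x) atTop (𝓝 0) := by
    have hl := tendsto_integral_smul_of_rpow (f := fun n x => ‖gradient (φ n) x - V x‖)
      (f' := fun _ => (0 : ℝ)) hp.le hnorm (locallyIntegrable_const 0) (by simpa using h2) hψ.continuous.abs
        (hψ.2.comp_left (g := fun s : ℝ => |s|) abs_zero)
    have hz := hl.const_mul M
    simp only [smul_zero, integral_zero, mul_zero] at hz
    refine squeeze_zero_norm (fun n => ?_) hz
    rw [← integral_sub (i1 n) (i2 n), ← integral_const_mul]
    refine norm_integral_le_of_norm_le ?_ (Eventually.of_forall fun x => ?_)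
    · exact ((hnorm n).integrable_smul_left_of_hasCompactSupport hψ.continuous.abs
        (hψ.2.comp_left (g := fun s : ℝ => |s|) abs_zero)).const_mul M
    · rw [← smul_sub, norm_smul, norm_mul, mul_comm ‖ψ x‖, mul_assoc]
      have := hM' (φ n x)
      simp only [Real.norm_eq_abs, smul_eq_mul] at this ⊢
      gcongr
  have l4 := l3.add l2
  simp only [sub_add_cancel, zero_add] at l4
  exact tendsto_nhds_unique l1 (l4.neg.congr fun n => (hparts n).symm)

/-- The weak gradient of `u` vanishes a.e. on `{u = 0}`. -/
lemma IsWA.grad_eq_zero_ae (hp : 1 < p) (hpN : p < N) (hA : MemLp A ⊤ volume)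
    (hpos : ∀ᵐ x, 0 < A x) {u : RN N → ℝ} {V : RN N → RN N} (h : IsWA p A u V) :
    ∀ᵐ x, u x = 0 → V x = 0 := by
  have hV := h.locallyIntegrable_grad hp.le hA
  have hnull : NullMeasurableSet {x | u x = 0} volume :=
    h.aesm.nullMeasurableSet_eq_fun aestronglyMeasurable_const
  set W : RN N → RN N := {x | u x = 0}.indicator V with hW
  have hWm : AEStronglyMeasurable W volume := h.aesmGrad.indicator₀ hnull
  have hWle : ∀ x, ‖W x‖ ≤ ‖V x‖ := fun x => norm_indicator_le_norm_self _ _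
  have hWi : LocallyIntegrable W volume := hV.mono hWm (Eventually.of_forall hWle)
  have key := ae_eq_zero_of_integral_contDiff_smul_eq_zero hWi (fun ψ hψ1 hψ2 => by
    have hψ : TestFun ψ := ⟨hψ1, hψ2⟩
    have hVψ : Integrable (fun x => ψ x • V x) :=
      hV.integrable_smul_left_of_hasCompactSupport hψ.continuous hψ.2
    -- The functions ε arctan(s/ε) tend to 0 uniformly, while their derivatives 1/(1+(s/ε)²) tend
    -- boundedly to the indicator of s = 0. The chain rule therefore gives ∫ ψ 1_{u=0} V = 0 for
    -- every test function ψ.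
    let ε : ℕ → ℝ := fun n => 1 / ((n : ℝ) + 1)
    have hε : ∀ n, 0 < ε n := fun n => by positivity
    have hε1 : ∀ n, ε n ≤ 1 := fun n => by
      simp only [ε]; rw [div_le_one (by positivity)]; linarith [n.cast_nonneg (α := ℝ)]
    have hε0 : Tendsto ε atTop (𝓝 0) := tendsto_one_div_add_atTop_nhds_zero_nat
    have hder : ∀ n s, HasDerivAt (fun s => ε n * Real.arctan (s / ε n))
        (1 / (1 + (s / ε n) ^ 2)) s := by
      intro n s
      have := ((Real.hasDerivAt_arctan (s / ε n)).comp s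
        ((hasDerivAt_id s).div_const (ε n))).const_mul (ε n)
      refine this.congr_deriv ?_
      have := (hε n).ne'
      field_simp
    have harc : ∀ n s, |ε n * Real.arctan (s / ε n)| ≤ 2 * ε n := by
      intro n s
      rw [abs_mul, abs_of_pos (hε n), mul_comm]
      refine mul_le_mul_of_nonneg_right ?_ (hε n).le
      rw [abs_le]
      constructor <;> linarith [Real.neg_pi_div_two_lt_arctan (s / ε n),
        Real.arctan_lt_pi_div_two (s / ε n), Real.pi_lt_four]
    have hd1 : ∀ n s, |1 / (1 + (s / ε n) ^ 2)| ≤ 1 := by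
      intro n s
      rw [abs_of_nonneg (by positivity), div_le_one (by positivity)]
      linarith [sq_nonneg (s / ε n)]
    have hch : ∀ n, ∫ x, (ε n * Real.arctan (u x / ε n)) • gradient ψ x =
        - ∫ x, (ψ x * (1 / (1 + (u x / ε n) ^ 2))) • V x := by
      intro n
      have := h.integral_comp_smul_gradient hp hpN hA hpos
        (f := fun s => ε n * Real.arctan (s / ε n)) (M := 2)
        (contDiff_const.mul (Real.contDiff_arctan.comp (contDiff_id.div_const _)))
        (fun s => (harc n s).trans (by linarith [hε1 n]))
        (fun s => by rw [(hder n s).deriv]; linarith [hd1 n s]) hψ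
      simpa only [(hder n _).deriv] using this
    have l1 : Tendsto (fun n => ∫ x, (ε n * Real.arctan (u x / ε n)) • gradient ψ x) atTop
        (𝓝 0) := by
      have hi := (hψ.continuous_gradient.integrable_of_hasCompactSupport (μ := volume)
        hψ.hasCompactSupport_gradient).norm
      have hz : Tendsto (fun n => 2 * ε n * ∫ x, ‖gradient ψ x‖) atTop (𝓝 0) := by
        simpa using (hε0.const_mul 2).mul_const (∫ x, ‖gradient ψ x‖)
      refine squeeze_zero_norm (fun n => ?_) hz
      rw [← integral_const_mul]
      refine norm_integral_le_of_norm_le (hi.const_mul _) (Eventually.of_forall fun x => ?_)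
      rw [norm_smul]
      gcongr
      exact harc n _
    have l2 : Tendsto (fun n => ∫ x, (ψ x * (1 / (1 + (u x / ε n) ^ 2))) • V x) atTop
        (𝓝 (∫ x, ψ x • W x)) := by
      refine tendsto_integral_of_dominated_convergence (fun x => ‖ψ x • V x‖)
        (fun n => ?_) hVψ.norm (fun n => Eventually.of_forall fun x => ?_)
        (Eventually.of_forall fun x => ?_)
      · have hc : Continuous fun s : ℝ => 1 / (1 + (s / ε n) ^ 2) :=
          continuous_const.div (by fun_prop) fun s => by positivity
        exact (hψ.continuous.aestronglyMeasurable.mul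
          (hc.comp_aestronglyMeasurable h.aesm)).smul h.aesmGrad
      · rw [mul_comm, mul_smul, norm_smul]
        exact mul_le_of_le_one_left (norm_nonneg _) (hd1 n _)
      · by_cases hx : u x = 0
        · simp [hW, hx]
        · have hW0 : W x = 0 := by simp [hW, hx]
          rw [hW0, smul_zero, ← zero_smul ℝ (V x), ← mul_zero (ψ x)]
          refine (Tendsto.const_mul _ ?_).smul_const _
          simp only [one_div]
          refine Tendsto.inv_tendsto_atTop (tendsto_atTop_add_const_left _ _ ?_)
          have e : ∀ n, (u x / ε n) ^ 2 = (u x) ^ 2 * ((n : ℝ) + 1) ^ 2 := fun n => by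
            simp only [ε]; field_simp
          simp only [e]
          refine Tendsto.const_mul_atTop (by positivity) ?_
          exact (tendsto_pow_atTop two_ne_zero).comp
            (tendsto_atTop_add_const_right _ _ tendsto_natCast_atTop_atTop)
    have := tendsto_nhds_unique l1 (l2.neg.congr fun n => (hch n).symm)
    simpa using this.symm)
  filter_upwards [key] with x hx hux
  simpa [hW, hux] using hx

end NodalNehari

/-! ### Compactness: uniform convexity, convex combinations, Rellich -/

namespace NodalNehari

variable {N : ℕ} {p : ℝ} {A : RN N → ℝ}

/-! ### Uniform convexity of `‖·‖^p` -/

/-- If the norms agree, strictness comes from strict convexity of the Hilbert ball; if they differ,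
from strict convexity of s ↦ s^p. -/
lemma norm_rpow_midpoint_lt {E : Type*} [NormedAddCommGroup E] [InnerProductSpace ℝ E]
    (hp : 1 < p) {a b : E} (hab : a ≠ b) :
    ‖(1 / 2 : ℝ) • (a + b)‖ ^ p < (1 / 2) * ‖a‖ ^ p + (1 / 2) * ‖b‖ ^ p := by
  have hp0 : 0 < p := by linarith
  have hle : ‖(1 / 2 : ℝ) • (a + b)‖ ≤ (1 / 2) * ‖a‖ + (1 / 2) * ‖b‖ := by
    rw [norm_smul, ← mul_add]
    norm_num
    exact norm_add_le a b
  by_cases hn : ‖a‖ = ‖b‖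
  · have hlt : ‖(1 / 2 : ℝ) • a + (1 / 2 : ℝ) • b‖ < ‖b‖ :=
      norm_combo_lt_of_ne hn.le le_rfl hab (by norm_num) (by norm_num) (by norm_num)
    rw [← smul_add] at hlt
    calc ‖(1 / 2 : ℝ) • (a + b)‖ ^ p < ‖b‖ ^ p := Real.rpow_lt_rpow (norm_nonneg _) hlt hp0
      _ = _ := by rw [hn]; ring
  · obtain ⟨-, hsc⟩ := strictConvexOn_rpow hp
    have := hsc (norm_nonneg a) (norm_nonneg b) hn (by norm_num : (0 : ℝ) < 1 / 2)
      (by norm_num : (0 : ℝ) < 1 / 2) (by norm_num)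
    simp only [smul_eq_mul] at this
    exact (Real.rpow_le_rpow (norm_nonneg _) hle hp0.le).trans_lt this

/-- By p-homogeneity it is enough to treat the unit sphere of E × E, which is compact in finite
dimension. Where ‖a - b‖^p is at least ε(‖a‖^p + ‖b‖^p), one has a ≠ b, so the convexity defect is
positive and attains a positive minimum. All p > 1 are treated at once, without separate Clarkson
inequalities for p < 2 and p ≥ 2. -/
lemma exists_uniform_convexity (E : Type*) [NormedAddCommGroup E] [InnerProductSpace ℝ E]
    [FiniteDimensional ℝ E] (hp : 1 < p) {ε : ℝ} (hε : 0 < ε) : ∃ C : ℝ, 0 ≤ C ∧ ∀ a b : E,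
      ‖a - b‖ ^ p + C * ‖(1 / 2 : ℝ) • (a + b)‖ ^ p ≤
        ε * (‖a‖ ^ p + ‖b‖ ^ p) + C * ((1 / 2) * ‖a‖ ^ p + (1 / 2) * ‖b‖ ^ p) := by
  have hp0 : 0 < p := by linarith
  let D : E × E → ℝ := fun z =>
    (1 / 2) * ‖z.1‖ ^ p + (1 / 2) * ‖z.2‖ ^ p - ‖(1 / 2 : ℝ) • (z.1 + z.2)‖ ^ p
  have hcp : Continuous fun s : ℝ => s ^ p := Real.continuous_rpow_const hp0.le
  have hDc : Continuous D := by
    have h1 : Continuous fun z : E × E => ‖z.1‖ ^ p := hcp.comp (by fun_prop)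
    have h2 : Continuous fun z : E × E => ‖z.2‖ ^ p := hcp.comp (by fun_prop)
    have h3 : Continuous fun z : E × E => ‖(1 / 2 : ℝ) • (z.1 + z.2)‖ ^ p :=
      hcp.comp (by fun_prop)
    fun_prop
  have hD0 : ∀ z, 0 ≤ D z := fun z => by
    by_cases h : z.1 = z.2
    · simp only [D, h, ← two_smul ℝ z.2, smul_smul]
      norm_num
      linarith
    · have := norm_rpow_midpoint_lt hp h
      simp only [D]; linarith
  let K : Set (E × E) := Metric.sphere 0 1 ∩
    {z | ε * (‖z.1‖ ^ p + ‖z.2‖ ^ p) ≤ ‖z.1 - z.2‖ ^ p}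
  have hK : IsCompact K := by
    refine (isCompact_sphere _ _).inter_right (isClosed_le ?_ (hcp.comp (by fun_prop)))
    exact continuous_const.mul ((hcp.comp (by fun_prop)).add (hcp.comp (by fun_prop)))
  have hunit : ∃ C : ℝ, 0 ≤ C ∧ ∀ z ∈ Metric.sphere (0 : E × E) 1,
      ‖z.1 - z.2‖ ^ p ≤ ε * (‖z.1‖ ^ p + ‖z.2‖ ^ p) + C * D z := by
    rcases K.eq_empty_or_nonempty with hKe | hKne
    · refine ⟨0, le_rfl, fun z hz => ?_⟩
      by_contra! hcon
      have : z ∈ K := ⟨hz, by simpa using hcon.le⟩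
      simp [hKe] at this
    · obtain ⟨z₀, hz₀, hmin⟩ := hK.exists_isMinOn hKne hDc.continuousOn
      have hd : 0 < D z₀ := by
        have hne : z₀.1 ≠ z₀.2 := by
          intro h
          have h1 := hz₀.2
          have h2 : ‖z₀‖ = 1 := by simpa using hz₀.1
          simp only [mem_ofPred_eq, h, sub_self, norm_zero, Real.zero_rpow hp0.ne'] at h1
          have h3 : ‖z₀.2‖ = 1 := by rw [← h2, Prod.norm_def, h, max_self]
          rw [h3, Real.one_rpow] at h1
          linarith
        have := norm_rpow_midpoint_lt hp hne
        simp only [D]; linarith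
      -- On the unit sphere ‖a - b‖^p ≤ 2^p, so this constant makes the defect term dominate on the
      -- critical set `K`; off `K` the ε-term alone suffices.
      refine ⟨2 ^ p / D z₀, by positivity, fun z hz => ?_⟩
      have hz1 : ‖z‖ = 1 := by simpa using hz
      have hdiff : ‖z.1 - z.2‖ ^ p ≤ 2 ^ p := by
        refine Real.rpow_le_rpow (norm_nonneg _) ((norm_sub_le _ _).trans ?_) hp0.le
        have := norm_fst_le z
        have := norm_snd_le z
        linarith
      by_cases hzK : z ∈ K
      · have h1 : D z₀ ≤ D z := hmin hzK
        have h2 : (2 : ℝ) ^ p ≤ 2 ^ p / D z₀ * D z := by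
          rw [div_mul_eq_mul_div, le_div_iff₀ hd]
          gcongr
        have : 0 ≤ ε * (‖z.1‖ ^ p + ‖z.2‖ ^ p) := by positivity
        linarith
      · have h1 : ‖z.1 - z.2‖ ^ p < ε * (‖z.1‖ ^ p + ‖z.2‖ ^ p) := by
          by_contra! hcon
          exact hzK ⟨hz, hcon⟩
        have : 0 ≤ 2 ^ p / D z₀ * D z := mul_nonneg (by positivity) (hD0 z)
        linarith
  obtain ⟨C, hC, hsphere⟩ := hunit
  refine ⟨C, hC, fun a b => ?_⟩
  by_cases h0 : (a, b) = (0 : E × E)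
  · obtain ⟨rfl, rfl⟩ := Prod.mk.inj h0
    simp [hp0.ne']
  · have hs : 0 < ‖(a, b)‖ := norm_pos_iff.2 h0
    set s := ‖(a, b)‖ with hsdef
    have hmem : s⁻¹ • (a, b) ∈ Metric.sphere (0 : E × E) 1 := by
      rw [mem_sphere_zero_iff_norm, norm_smul, norm_inv, ← hsdef, Real.norm_eq_abs, abs_of_pos hs,
        inv_mul_cancel₀ hs.ne']
    have key := hsphere _ hmem
    have hsc : ∀ x : E, ‖s⁻¹ • x‖ ^ p = (s ^ p)⁻¹ * ‖x‖ ^ p := fun x => by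
      rw [norm_smul, Real.mul_rpow (norm_nonneg _) (norm_nonneg _), norm_inv, Real.norm_eq_abs,
        abs_of_pos hs, Real.inv_rpow hs.le]
    simp only [D, Prod.smul_fst, Prod.smul_snd, ← smul_add, ← smul_sub, hsc,
      smul_comm (1 / 2 : ℝ) s⁻¹] at key
    have hsp : 0 < s ^ p := Real.rpow_pos_of_pos hs p
    have key2 := mul_le_mul_of_nonneg_left key hsp.le
    have e1 : s ^ p * ((s ^ p)⁻¹ * ‖a - b‖ ^ p) = ‖a - b‖ ^ p := by field_simp
    rw [e1] at key2
    refine (add_le_add_left key2 _).trans (le_of_eq ?_)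
    field_simp
    ring

/-- Since the defect is nonnegative the constant may be enlarged freely, which allows a common one
for function values in ℝ and gradients in ℝ^N. -/
lemma exists_uniform_convexity_enorm (E : Type*) [NormedAddCommGroup E] [InnerProductSpace ℝ E]
    [FiniteDimensional ℝ E] (hp : 1 < p) {ε : ℝ} (hε : 0 < ε) : ∃ C : ℝ, 0 ≤ C ∧
    ∀ C', C ≤ C' → ∀ a b : E,
      ‖a - b‖ₑ ^ p + ENNReal.ofReal C' * ‖(1 / 2 : ℝ) • (a + b)‖ₑ ^ p ≤
        ENNReal.ofReal ε * (‖a‖ₑ ^ p + ‖b‖ₑ ^ p) +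
          ENNReal.ofReal C' * (2⁻¹ * ‖a‖ₑ ^ p + 2⁻¹ * ‖b‖ₑ ^ p) := by
  have hp0 : 0 < p := by linarith
  obtain ⟨C, hC, h⟩ := exists_uniform_convexity E hp hε
  refine ⟨C, hC, fun C' hCC a b => ?_⟩
  have hC' := hC.trans hCC
  have hmid : ‖(1 / 2 : ℝ) • (a + b)‖ ^ p ≤ (1 / 2) * ‖a‖ ^ p + (1 / 2) * ‖b‖ ^ p := by
    by_cases hab : a = b
    · subst hab
      rw [← two_smul ℝ a, smul_smul]
      norm_num
      linarith
    · exact (norm_rpow_midpoint_lt hp hab).le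
  have key : ‖a - b‖ ^ p + C' * ‖(1 / 2 : ℝ) • (a + b)‖ ^ p ≤
        ε * (‖a‖ ^ p + ‖b‖ ^ p) + C' * (2⁻¹ * ‖a‖ ^ p + 2⁻¹ * ‖b‖ ^ p) := by
    have := h a b
    have h3 := mul_le_mul_of_nonneg_left hmid (sub_nonneg.2 hCC)
    simp only [one_div] at *
    linarith
  have e : ∀ x : E, ‖x‖ₑ ^ p = ENNReal.ofReal (‖x‖ ^ p) := fun x => by
    rw [← ofReal_norm, ENNReal.ofReal_rpow_of_nonneg (norm_nonneg _) hp0.le]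
  have e2 : (2⁻¹ : ℝ≥0∞) = ENNReal.ofReal (2⁻¹) := by
    rw [ENNReal.ofReal_inv_of_pos (by norm_num)]; simp
  simp only [e, e2]
  rw [← ENNReal.ofReal_mul hC', ← ENNReal.ofReal_add (by positivity) (by positivity),
    ← ENNReal.ofReal_add (by positivity) (by positivity), ← ENNReal.ofReal_mul hε.le,
    ← ENNReal.ofReal_mul (by norm_num), ← ENNReal.ofReal_mul (by norm_num),
    ← ENNReal.ofReal_add (by positivity) (by positivity), ← ENNReal.ofReal_mul hC',
    ← ENNReal.ofReal_add (by positivity) (by positivity)]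
  exact ENNReal.ofReal_le_ofReal key

/-- Uniform convexity of the energy. -/
lemma energy_uniform_convexity (hp : 1 < p) (hA : AEMeasurable A volume) {ε : ℝ} (hε : 0 < ε) :
    ∃ C : ℝ, 0 ≤ C ∧ ∀ (u u' : RN N → ℝ) (V V' : RN N → RN N),
      AEStronglyMeasurable u volume → AEStronglyMeasurable V volume →
      AEStronglyMeasurable u' volume → AEStronglyMeasurable V' volume →
      energy p A (u - u') (V - V') + ENNReal.ofReal C *
        energy p A ((1 / 2 : ℝ) • (u + u')) ((1 / 2 : ℝ) • (V + V')) ≤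
      ENNReal.ofReal ε * (energy p A u V + energy p A u' V') +
        ENNReal.ofReal C * (2⁻¹ * energy p A u V + 2⁻¹ * energy p A u' V') := by
  obtain ⟨C₁, hC₁, h1⟩ := exists_uniform_convexity_enorm (RN N) hp hε
  obtain ⟨C₂, hC₂, h2⟩ := exists_uniform_convexity_enorm ℝ hp hε
  refine ⟨max C₁ C₂, hC₁.trans (le_max_left _ _), fun u u' V V' hu hV hu' hV' => ?_⟩
  have hm : ∀ {u : RN N → ℝ} {V : RN N → RN N}, AEStronglyMeasurable u volume →
      AEStronglyMeasurable V volume →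
      AEMeasurable (fun x => ‖V x‖ₑ ^ p + ENNReal.ofReal (A x) * ‖u x‖ₑ ^ p) volume :=
    fun hu hV => (hV.enorm.pow_const _).add (hA.ennreal_ofReal.mul (hu.enorm.pow_const _))
  have t2 : (2⁻¹ : ℝ≥0∞) ≠ ⊤ := by simp
  unfold energy
  rw [← lintegral_const_mul' _ _ (by simp), ← lintegral_const_mul' _ _ t2,
    ← lintegral_const_mul' _ _ t2, ← lintegral_add_left' (hm hu hV),
    ← lintegral_const_mul' _ _ (by simp), ← lintegral_add_left' ((hm hu hV).const_mul _),
    ← lintegral_const_mul' _ _ (by simp), ← lintegral_add_left' (hm (hu.sub hu') (hV.sub hV')),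
    ← lintegral_add_left' (((hm hu hV).fun_add (hm hu' hV')).const_mul _)]
  refine lintegral_mono fun x => ?_
  have k1 := h1 _ (le_max_left C₁ C₂) (V x) (V' x)
  have k2 := h2 _ (le_max_right C₁ C₂) (u x) (u' x)
  have k3 := add_le_add k1 (mul_le_mul_right k2 (ENNReal.ofReal (A x)))
  refine le_trans (le_of_eq ?_) (k3.trans (le_of_eq ?_))
  · simp only [Pi.sub_apply, Pi.smul_apply, Pi.add_apply]; ring
  · ring

end NodalNehari

namespace NodalNehari

variable {N : ℕ} {p : ℝ} {A : RN N → ℝ}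

/-! ### Weak compactness via convex combinations -/

lemma enorm_convex_combination_rpow_le {E : Type*} [NormedAddCommGroup E] [NormedSpace ℝ E]
    (hp : 1 ≤ p) {s t : ℝ} (hs : 0 ≤ s) (ht : 0 ≤ t) (hst : s + t = 1) (a b : E) :
    ‖s • a + t • b‖ₑ ^ p ≤ ENNReal.ofReal s * ‖a‖ₑ ^ p + ENNReal.ofReal t * ‖b‖ₑ ^ p := by
  have h1 : ‖s • a + t • b‖ₑ ≤ ENNReal.ofReal s * ‖a‖ₑ + ENNReal.ofReal t * ‖b‖ₑ := by
    refine (enorm_add_le _ _).trans (le_of_eq ?_)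
    rw [enorm_smul, enorm_smul, Real.enorm_of_nonneg hs, Real.enorm_of_nonneg ht]
  refine (ENNReal.rpow_le_rpow h1 (by linarith)).trans ?_
  refine ENNReal.rpow_arith_mean_le_arith_mean2_rpow _ _ _ _ ?_ hp
  rw [← ENNReal.ofReal_add hs ht, hst, ENNReal.ofReal_one]

/-- Convexity of weighted sublevel sets: a bound shared by all terms of a sequence holds on the
convex hull of the sequence. -/
lemma lintegral_convex_combination_le {E : Type*} [NormedAddCommGroup E] [NormedSpace ℝ E]
    (hp : 1 ≤ p) {w : RN N → ℝ≥0∞} (hw : AEMeasurable w volume) {f g : RN N → E} {c : ℝ≥0∞}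
    (hf : AEStronglyMeasurable f volume)
    (hfc : ∫⁻ x, w x * ‖f x‖ₑ ^ p ≤ c) (hgc : ∫⁻ x, w x * ‖g x‖ₑ ^ p ≤ c)
    {s t : ℝ} (hs : 0 ≤ s) (ht : 0 ≤ t) (hst : s + t = 1) :
    ∫⁻ x, w x * ‖(s • f + t • g) x‖ₑ ^ p ≤ c := by
  calc ∫⁻ x, w x * ‖(s • f + t • g) x‖ₑ ^ p
      ≤ ∫⁻ x, (ENNReal.ofReal s * (w x * ‖f x‖ₑ ^ p) + ENNReal.ofReal t * (w x * ‖g x‖ₑ ^ p)) := by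
        refine lintegral_mono fun x => ?_
        refine (mul_le_mul_right (enorm_convex_combination_rpow_le hp hs ht hst (f x) (g x))
          (w x)).trans (le_of_eq ?_)
        ring
    _ = ENNReal.ofReal s * (∫⁻ x, w x * ‖f x‖ₑ ^ p) +
          ENNReal.ofReal t * ∫⁻ x, w x * ‖g x‖ₑ ^ p := by
        rw [lintegral_add_left' ((hw.fun_mul (hf.enorm.pow_const _)).const_mul _),
          lintegral_const_mul' _ _ (by simp), lintegral_const_mul' _ _ (by simp)]
    _ ≤ ENNReal.ofReal s * c + ENNReal.ofReal t * c := by gcongr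
    _ = c := by rw [← add_mul, ← ENNReal.ofReal_add hs ht, hst, ENNReal.ofReal_one, one_mul]

/-- A sequence in `L^p` that is Cauchy for `∫ ‖·‖^p` converges. -/
lemma exists_limit_of_cauchy {E : Type*} [NormedAddCommGroup E] [CompleteSpace E] {α : Type*}
    [MeasurableSpace α] {μ : Measure α} (hp : 1 ≤ p)
    {V : ℕ → α → E} (hV : ∀ n, AEStronglyMeasurable (V n) μ)
    (hfin : ∀ n, ∫⁻ x, ‖V n x‖ₑ ^ p ∂μ < ⊤)
    (hc : ∀ ε : ℝ, 0 < ε → ∃ J, ∀ j ≥ J, ∀ k ≥ J,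
      ∫⁻ x, ‖V j x - V k x‖ₑ ^ p ∂μ ≤ ENNReal.ofReal ε) :
    ∃ V' : α → E, AEStronglyMeasurable V' μ ∧
      Tendsto (fun n => ∫⁻ x, ‖V n x - V' x‖ₑ ^ p ∂μ) atTop (𝓝 0) := by
  have hp0 : 0 < p := by linarith
  have : Fact (1 ≤ ENNReal.ofReal p) := ⟨by simpa using hp⟩
  have hm : ∀ n, MemLp (V n) (ENNReal.ofReal p) μ := fun n =>
    memLp_of_lintegral_lt_top hp0 (hV n) (hfin n)
  have hnorm : ∀ f : α → E, eLpNorm f (ENNReal.ofReal p) μ =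
      (∫⁻ x, ‖f x‖ₑ ^ p ∂μ) ^ (1 / p) := fun f => by
    rw [eLpNorm_eq_lintegral_rpow_enorm_toReal (by simpa using hp0) (by simp),
      ENNReal.toReal_ofReal hp0.le]
  have hcs : CauchySeq fun n => (hm n).toLp (V n) := by
    rw [EMetric.cauchySeq_iff]
    intro ε hε
    obtain ⟨δ, hδ, hδε⟩ : ∃ δ : ℝ, 0 < δ ∧ ENNReal.ofReal δ < ε := by
      obtain ⟨δ, h1, h2⟩ := ENNReal.lt_iff_exists_nnreal_btwn.1 hε
      exact ⟨δ, by exact_mod_cast h1, by simpa using h2⟩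
    obtain ⟨J, hJ⟩ := hc (δ ^ p) (by positivity)
    refine ⟨J, fun j hj k hk => ?_⟩
    rw [Lp.edist_toLp_toLp, hnorm]
    refine lt_of_le_of_lt (ENNReal.rpow_le_rpow (hJ j hj k hk) (by positivity)) ?_
    rwa [ENNReal.ofReal_rpow_of_nonneg (by positivity) (by positivity), ← Real.rpow_mul hδ.le,
      mul_one_div_cancel hp0.ne', Real.rpow_one]
  obtain ⟨V', hV'⟩ := cauchySeq_tendsto_of_complete hcs
  refine ⟨V', Lp.aestronglyMeasurable V', ?_⟩
  have h1 := (Lp.tendsto_Lp_iff_tendsto_eLpNorm' _ _).1 hV'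
  have h2 : Tendsto (fun n => (eLpNorm (V n - ⇑V') (ENNReal.ofReal p) μ) ^ p) atTop (𝓝 0) := by
    have := ((ENNReal.continuous_rpow_const (y := p)).tendsto 0).comp h1
    rw [ENNReal.zero_rpow_of_pos hp0] at this
    refine this.congr fun n => ?_
    simp only [Function.comp]
    rw [eLpNorm_congr_ae ((hm n).coeFn_toLp.sub EventuallyEq.rfl)]
  refine h2.congr fun n => ?_
  rw [hnorm, ← ENNReal.rpow_mul, one_div_mul_cancel hp0.ne', ENNReal.rpow_one]
  rfl

/-- Passing to the limit a.e. in weighted integrals. -/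
lemma lintegral_le_of_tendsto_ae {E : Type*} [NormedAddCommGroup E] {α : Type*}
    [MeasurableSpace α] {μ : Measure α} {w : α → ℝ≥0∞} (hw : AEMeasurable w μ)
    {V : ℕ → α → E} {V' : α → E} (hV : ∀ n, AEStronglyMeasurable (V n) μ)
    (hae : ∀ᵐ x ∂μ, Tendsto (fun n => V n x) atTop (𝓝 (V' x))) {c : ℝ≥0∞}
    (hc : ∀ᶠ n in atTop, ∫⁻ x, w x * ‖V n x‖ₑ ^ p ∂μ ≤ c) :
    ∫⁻ x, w x * ‖V' x‖ₑ ^ p ∂μ ≤ c := by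
  calc ∫⁻ x, w x * ‖V' x‖ₑ ^ p ∂μ
      ≤ ∫⁻ x, liminf (fun n => w x * ‖V n x‖ₑ ^ p) atTop ∂μ := by
        refine lintegral_mono_ae (hae.mono fun x hx => ?_)
        have hl : Tendsto (fun n => ‖V n x‖ₑ ^ p) atTop (𝓝 (‖V' x‖ₑ ^ p)) :=
          ((ENNReal.continuous_rpow_const.comp continuous_enorm).tendsto _).comp hx
        -- The weight may be infinite at x, and multiplication by ∞ is not continuous at 0. If the
        -- limit vanishes the left side is 0, so the inequality is trivial.
        by_cases h0 : ‖V' x‖ₑ ^ p = 0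
        · simp [h0]
        · exact (ENNReal.Tendsto.const_mul hl (Or.inl h0)).liminf_eq.ge
    _ ≤ liminf (fun n => ∫⁻ x, w x * ‖V n x‖ₑ ^ p ∂μ) atTop :=
        lintegral_liminf_le' fun n => hw.mul ((hV n).enorm.pow_const _)
    _ ≤ c := (liminf_le_liminf hc).trans (by simp)

/-- A.e. limits of sequences with bounded energy stay in the space, and weighted gradient
integrals are lower semicontinuous. -/
theorem exists_grad_of_tendsto_ae (hp : 1 < p) (hA : MemLp A ⊤ volume)
    {u : ℕ → RN N → ℝ} {V : ℕ → RN N → RN N} (h : ∀ n, IsWA p A (u n) (V n)) {C : ℝ≥0∞}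
    (hC : C ≠ ⊤) (hb : ∀ n, energy p A (u n) (V n) ≤ C) {u' : RN N → ℝ}
    (hae : ∀ᵐ x, Tendsto (fun n => u n x) atTop (𝓝 (u' x))) :
    ∃ V' : RN N → RN N, IsWA p A u' V' ∧ ∀ w : RN N → ℝ≥0∞, AEMeasurable w volume →
      ∀ c : ℝ≥0∞, (∀ n, ∫⁻ x, w x * ‖V n x‖ₑ ^ p ≤ c) → ∫⁻ x, w x * ‖V' x‖ₑ ^ p ≤ c := by
  have hp0 : 0 < p := by linarith
  have hAm := hA.1.aemeasurable
  -- Convex hulls of the tails. The least energies over `K n` increase to a finite `D`. Elements `z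
  -- j` with energy nearly `D` in late hulls will be Cauchy, since midpoints stay in a hull and
  -- cannot have energy much below `D`.
  let K : ℕ → Set ((RN N → ℝ) × (RN N → RN N)) := fun n =>
    convexHull ℝ ((fun k => (u k, V k)) '' Ici n)
  let Φ : (RN N → ℝ) × (RN N → RN N) → ℝ≥0∞ := fun z => energy p A z.1 z.2
  have hKanti : Antitone K := fun m n hmn => convexHull_mono (image_mono (Ici_subset_Ici.2 hmn))
  have hKmem : ∀ n, (u n, V n) ∈ K n := fun n => subset_convexHull _ _ ⟨n, mem_Ici.2 le_rfl, rfl⟩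
  have hKsub : ∀ n, ∀ S : Set ((RN N → ℝ) × (RN N → RN N)), Convex ℝ S →
      (∀ k ≥ n, (u k, V k) ∈ S) → K n ⊆ S := fun n S hS hk => by
    refine convexHull_min ?_ hS
    rintro _ ⟨k, hkn, rfl⟩
    exact hk k hkn
  have hKW : ∀ n, ∀ z ∈ K n, IsWA p A z.1 z.2 := fun n => by
    refine hKsub n {z | IsWA p A z.1 z.2} (fun z hz z' hz' s t _ _ _ => ?_) fun k _ => h k
    exact (hz.const_smul hp0 s).add hp.le hAm (hz'.const_smul hp0 t)
  let d : ℕ → ℝ≥0∞ := fun n => ⨅ z ∈ K n, Φ z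
  have hdmono : Monotone d := fun m n hmn => biInf_mono (hKanti hmn)
  let D : ℝ≥0∞ := ⨆ n, d n
  have hDC : D ≤ C := iSup_le fun n => (iInf₂_le _ (hKmem n)).trans (hb n)
  have hDtop : D ≠ ⊤ := ne_top_of_le_ne_top hC hDC
  have hdlim : Tendsto d atTop (𝓝 D) := tendsto_atTop_iSup hdmono
  let η : ℕ → ℝ≥0∞ := fun j => ((j : ℝ≥0∞) + 1)⁻¹
  have hη : ∀ j, 0 < η j := fun j => by simp [η]
  have hηtop : ∀ j, η j ≠ ⊤ := fun j => by simp [η]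
  have hηanti : Antitone η := fun i j hij => by simp only [η]; gcongr
  have hη0 : Tendsto η atTop (𝓝 0) := by
    have := (tendsto_add_atTop_iff_nat 1).2 ENNReal.tendsto_inv_nat_nhds_zero
    simpa [η] using this
  have hchoose : ∀ j : ℕ, ∃ n ≥ j, D ≤ d n + η j := by
    intro j
    have h1 : Tendsto (fun n => d n + η j) atTop (𝓝 (D + η j)) := hdlim.add_const _
    have h2 := h1.eventually (lt_mem_nhds (ENNReal.lt_add_right hDtop (hη j).ne'))
    obtain ⟨n, hn1, hn2⟩ := (h2.and (eventually_ge_atTop j)).exists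
    exact ⟨n, hn2, hn1.le⟩
  choose n hnj hDn using hchoose
  have hx : ∀ j, ∃ z ∈ K (n j), Φ z ≤ D + η j := by
    intro j
    have hlt : d (n j) < D + η j :=
      (le_iSup d (n j)).trans_lt (ENNReal.lt_add_right hDtop (hη j).ne')
    simp only [d, iInf_lt_iff] at hlt
    obtain ⟨z, hz, hzlt⟩ := hlt
    exact ⟨z, hz, hzlt.le⟩
  choose z hzK hzΦ using hx
  have hzW : ∀ j, IsWA p A (z j).1 (z j).2 := fun j => hKW _ _ (hzK j)
  have hcauchy : ∀ ε : ℝ, 0 < ε → ∃ J, ∀ j ≥ J, ∀ k ≥ J,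
      energy p A ((z j).1 - (z k).1) ((z j).2 - (z k).2) ≤ ENNReal.ofReal ε := by
    intro ε hε
    -- The convexity error δ(Φ(z j) + Φ(z k)) is at most 2δ(D + 1), so it uses ε/2. The constant `c`
    -- depends on δ, hence `J` is chosen afterwards to make 2cη(J) ≤ ε/2.
    obtain ⟨δ, hδ, hδε⟩ : ∃ δ : ℝ, 0 < δ ∧ δ * (2 * (D.toReal + 1)) ≤ ε / 2 := by
      refine ⟨ε / 2 / (2 * (D.toReal + 1)), by positivity, le_of_eq ?_⟩
      field_simp
    obtain ⟨c, hc, hconv⟩ := energy_uniform_convexity (N := N) hp hAm hδ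
    obtain ⟨J, hJ⟩ : ∃ J, η J ≤ ENNReal.ofReal (ε / (4 * (c + 1))) := by
      have hpos : 0 < ENNReal.ofReal (ε / (4 * (c + 1))) := by
        rw [ENNReal.ofReal_pos]; positivity
      obtain ⟨J, hJ⟩ := (hη0.eventually (gt_mem_nhds hpos)).exists
      exact ⟨J, hJ.le⟩
    refine ⟨J, fun j hj k hk => ?_⟩
    have hjJ := hηanti hj
    have hkJ := hηanti hk
    -- The hulls decrease, so both points lie in the one with the smaller index; its infimum is
    -- already within η(J) of `D`.
    have hmid : D ≤ Φ ((1 / 2 : ℝ) • (z j + z k)) + η J := by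
      have h1 : (1 / 2 : ℝ) • (z j + z k) ∈ K (min (n j) (n k)) := by
        rw [smul_add]
        exact convex_convexHull ℝ _ (hKanti (min_le_left _ _) (hzK j))
          (hKanti (min_le_right _ _) (hzK k)) (by norm_num) (by norm_num) (by norm_num)
      have h2 : d (min (n j) (n k)) ≤ Φ ((1 / 2 : ℝ) • (z j + z k)) := iInf₂_le _ h1
      have h3 : D ≤ d (min (n j) (n k)) + η J := by
        rcases min_choice (n j) (n k) with hm | hm <;> rw [hm]
        · exact (hDn j).trans (by gcongr)
        · exact (hDn k).trans (by gcongr)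
      exact h3.trans (by gcongr)
    have key := hconv _ _ _ _ (hzW j).aesm (hzW j).aesmGrad (hzW k).aesm (hzW k).aesmGrad
    set X := energy p A ((z j).1 - (z k).1) ((z j).2 - (z k).2)
    have hj' : Φ (z j) ≤ D + η J := (hzΦ j).trans (by gcongr)
    have hk' : Φ (z k) ≤ D + η J := (hzΦ k).trans (by gcongr)
    have hη1 : η J ≤ 1 := by simp [η]
    have hhalf : (2⁻¹ : ℝ≥0∞) * (D + η J) + 2⁻¹ * (D + η J) = D + η J := by
      rw [← add_mul, ENNReal.inv_two_add_inv_two, one_mul]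
    have hfin : X + ENNReal.ofReal c * D ≤
        ENNReal.ofReal (ε / 2) + ENNReal.ofReal (ε / 2) + ENNReal.ofReal c * D := by
      calc X + ENNReal.ofReal c * D
          ≤ X + ENNReal.ofReal c * (Φ ((1 / 2 : ℝ) • (z j + z k)) + η J) := by gcongr
        _ = (X + ENNReal.ofReal c * Φ ((1 / 2 : ℝ) • (z j + z k))) + ENNReal.ofReal c * η J := by
            ring
        _ ≤ (ENNReal.ofReal δ * (Φ (z j) + Φ (z k)) +
              ENNReal.ofReal c * (2⁻¹ * Φ (z j) + 2⁻¹ * Φ (z k))) + ENNReal.ofReal c * η J := by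
            exact add_le_add_left key _
        _ ≤ (ENNReal.ofReal δ * ((D + 1) + (D + 1)) +
              ENNReal.ofReal c * (2⁻¹ * (D + η J) + 2⁻¹ * (D + η J))) +
                ENNReal.ofReal c * η J := by
            gcongr
            · exact hj'.trans (by gcongr)
            · exact hk'.trans (by gcongr)
        _ = ENNReal.ofReal δ * (2 * (D + 1)) + 2 * ENNReal.ofReal c * η J +
              ENNReal.ofReal c * D := by
            rw [hhalf]; ring
        _ ≤ _ := by
            gcongr
            · have : D = ENNReal.ofReal D.toReal := (ENNReal.ofReal_toReal hDtop).symm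
              rw [this, show (2 : ℝ≥0∞) = ENNReal.ofReal 2 by simp,
                show (1 : ℝ≥0∞) = ENNReal.ofReal 1 by simp,
                ← ENNReal.ofReal_add ENNReal.toReal_nonneg zero_le_one,
                ← ENNReal.ofReal_mul (by norm_num), ← ENNReal.ofReal_mul hδ.le]
              exact ENNReal.ofReal_le_ofReal hδε
            · refine (mul_le_mul_right hJ _).trans ?_
              rw [show (2 : ℝ≥0∞) = ENNReal.ofReal 2 by simp, ← ENNReal.ofReal_mul (by norm_num),
                ← ENNReal.ofReal_mul (by positivity)]
              refine ENNReal.ofReal_le_ofReal ?_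
              rw [mul_div_assoc', div_le_div_iff₀ (by positivity) (by norm_num)]
              nlinarith
    have := (ENNReal.add_le_add_iff_right (ENNReal.mul_ne_top (by simp) hDtop)).1 hfin
    rwa [← ENNReal.ofReal_add (by positivity) (by positivity), add_halves] at this
  -- Balls are convex: once the tail values at x lie in a ball around u'(x), so do their convex
  -- combinations.
  have hzae : ∀ᵐ x, Tendsto (fun j => (z j).1 x) atTop (𝓝 (u' x)) := by
    filter_upwards [hae] with x hx
    rw [Metric.tendsto_atTop] at hx ⊢
    intro ε hε
    obtain ⟨n₀, hn₀⟩ := hx ε hε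
    refine ⟨n₀, fun j hj => ?_⟩
    have hconv : Convex ℝ {z : (RN N → ℝ) × (RN N → RN N) | z.1 x ∈ Metric.ball (u' x) ε} := by
      have : IsLinearMap ℝ fun z : (RN N → ℝ) × (RN N → RN N) => z.1 x :=
        ⟨fun _ _ => rfl, fun _ _ => rfl⟩
      exact (convex_ball (u' x) ε).is_linear_preimage this
    exact hKsub n₀ _ hconv (fun k hk => hn₀ k hk) (hKanti (hj.trans (hnj j)) (hzK j))
  obtain ⟨V', hV'm, hV'⟩ := exists_limit_of_cauchy (V := fun j => (z j).2) hp.le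
    (fun j => (hzW j).aesmGrad) (fun j => (hzW j).lintegral_grad_lt_top hp.le hA)
    fun ε hε => by
      obtain ⟨J, hJ⟩ := hcauchy ε hε
      exact ⟨J, fun j hj k hk => (lintegral_grad_le_energy _ _).trans (hJ j hj k hk)⟩
  have hu'm : AEStronglyMeasurable u' volume :=
    aestronglyMeasurable_of_tendsto_ae atTop (fun k => (h k).aesm) hae
  -- Fatou's lemma in the second index of the Cauchy estimate identifies the weighted limit with the
  -- given a.e. limit `u'`.
  have hAlim : Tendsto (fun j => ∫⁻ x, ENNReal.ofReal (A x) * ‖((z j).1 - u') x‖ₑ ^ p)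
      atTop (𝓝 0) := by
    rw [ENNReal.tendsto_atTop_zero]
    intro ε hε
    obtain ⟨δ, hδ, hδε⟩ : ∃ δ : ℝ, 0 < δ ∧ ENNReal.ofReal δ < ε := by
      obtain ⟨δ, h1, h2⟩ := ENNReal.lt_iff_exists_nnreal_btwn.1 hε
      exact ⟨δ, by exact_mod_cast h1, by simpa using h2⟩
    obtain ⟨J, hJ⟩ := hcauchy δ hδ
    refine ⟨J, fun j hj => le_trans ?_ hδε.le⟩
    refine lintegral_le_of_tendsto_ae (V := fun k => (z j).1 - (z k).1) hAm.ennreal_ofReal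
      (fun k => (hzW j).aesm.sub (hzW k).aesm) ?_ ?_
    · filter_upwards [hzae] with x hx
      exact tendsto_const_nhds.sub hx
    · filter_upwards [eventually_ge_atTop J] with k hk
      exact (lintegral_weight_le_energy _ _).trans (hJ j hj k hk)
  refine ⟨V', ?_, fun w hw c hcw => ?_⟩
  · refine IsWA.of_tendsto hp.le hAm hzW hu'm hV'm ?_
    have := hV'.add hAlim
    rw [add_zero] at this
    refine this.congr fun j => ?_
    exact (energy_eq_add ((hzW j).aesmGrad.sub hV'm)).symm
  · obtain ⟨ns, hns, hVae⟩ := exists_subseq_ae_tendsto_zero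
      (fun j => ((hzW j).aesmGrad.sub hV'm).enorm.pow_const p) hV'
    refine lintegral_le_of_tendsto_ae (V := fun j => (z (ns j)).2) hw
      (fun j => (hzW _).aesmGrad) ?_ (Eventually.of_forall fun j => ?_)
    · filter_upwards [hVae] with x hx
      rw [tendsto_iff_norm_sub_tendsto_zero, ← enorm_rpow_tendsto_zero_iff hp0]
      exact hx
    · have hS : Convex ℝ {z : (RN N → ℝ) × (RN N → RN N) |
          AEStronglyMeasurable z.2 volume ∧ ∫⁻ x, w x * ‖z.2 x‖ₑ ^ p ≤ c} :=
        fun y hy y' hy' s t hs ht hst => ⟨(hy.1.const_smul s).add (hy'.1.const_smul t),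
          lintegral_convex_combination_le hp.le hw hy.1 hy.2 hy'.2 hs ht hst⟩
      exact (hKsub _ _ hS (fun k _ => ⟨(h k).aesmGrad, hcw k⟩) (hzK (ns j))).2

end NodalNehari

namespace NodalNehari

variable {N : ℕ} {p : ℝ} {A : RN N → ℝ}

/-! ### Local compactness -/

/-- Jensen's inequality for the norm to the power `r`. -/
lemma lintegral_rpow_le_of_isProbabilityMeasure {α : Type*} [MeasurableSpace α] {P : Measure α}
    [IsProbabilityMeasure P] {r : ℝ} (hr : 1 ≤ r) {f : α → ℝ≥0∞} (hf : AEMeasurable f P) :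
    (∫⁻ y, f y ∂P) ^ r ≤ ∫⁻ y, f y ^ r ∂P := by
  have hr0 : 0 < r := by linarith
  rcases eq_or_lt_of_le hr with rfl | h1
  · simp
  have := ENNReal.lintegral_mul_le_Lp_mul_Lq P (Real.HolderConjugate.conjExponent h1) hf
    (aemeasurable_const (b := (1 : ℝ≥0∞)))
  simp only [Pi.mul_apply, mul_one, ENNReal.one_rpow, lintegral_const, measure_univ] at this
  have h2 := ENNReal.rpow_le_rpow this hr0.le
  rwa [← ENNReal.rpow_mul, one_div_mul_cancel hr0.ne', ENNReal.rpow_one] at h2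

lemma enorm_integral_rpow_le {α : Type*} [MeasurableSpace α] {P : Measure α}
    [IsProbabilityMeasure P] {r : ℝ} (hr : 1 ≤ r) {f : α → ℝ} (hf : AEStronglyMeasurable f P) :
    ‖∫ y, f y ∂P‖ₑ ^ r ≤ ∫⁻ y, ‖f y‖ₑ ^ r ∂P :=
  (ENNReal.rpow_le_rpow (enorm_integral_le_lintegral_enorm _) (by linarith)).trans
    (lintegral_rpow_le_of_isProbabilityMeasure hr hf.enorm)

/-- The difference quotient estimate for test functions. -/
lemma TestFun.lintegral_translate_sub_le (hp : 1 ≤ p) {φ : RN N → ℝ} (hφ : TestFun φ) (h : RN N) :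
    ∫⁻ x, ‖φ (x + h) - φ x‖ₑ ^ p ≤ ‖h‖ₑ ^ p * ∫⁻ x, ‖gradient φ x‖ₑ ^ p := by
  have hp0 : 0 ≤ p := by linarith
  have hgc := hφ.continuous_gradient
  have : IsProbabilityMeasure (volume.restrict (Ioc (0 : ℝ) 1)) := ⟨by simp⟩
  -- The fundamental theorem of calculus along the segment from x to x + h, followed by Jensen on
  -- [0,1]. Tonelli and translation invariance then remove the shift t • h.
  have hpt : ∀ x, ‖φ (x + h) - φ x‖ₑ ^ p ≤
      ∫⁻ t in Ioc (0 : ℝ) 1, ‖h‖ₑ ^ p * ‖gradient φ (x + t • h)‖ₑ ^ p := by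
    intro x
    have hd : ∀ t : ℝ, HasDerivAt (fun t : ℝ => φ (x + t • h))
        (inner ℝ (gradient φ (x + t • h)) h) t := by
      intro t
      rw [inner_gradient]
      have h1 : HasDerivAt (fun t : ℝ => x + t • h) h t := by
        simpa using ((hasDerivAt_id t).smul_const h).const_add x
      exact ((hφ.differentiable _).hasFDerivAt.comp_hasDerivAt t h1)
    have hcont : Continuous fun t : ℝ => inner ℝ (gradient φ (x + t • h)) h := by fun_prop
    have hftc : ∫ t in (0 : ℝ)..1, inner ℝ (gradient φ (x + t • h)) h = φ (x + h) - φ x := by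
      rw [intervalIntegral.integral_eq_sub_of_hasDerivAt (fun t _ => hd t)
        (hcont.intervalIntegrable _ _)]
      simp
    rw [← hftc, intervalIntegral.integral_of_le zero_le_one]
    refine (enorm_integral_rpow_le hp hcont.aestronglyMeasurable).trans (lintegral_mono fun t => ?_)
    rw [← ENNReal.mul_rpow_of_nonneg _ _ hp0]
    gcongr
    rw [← ofReal_norm, ← ofReal_norm, ← ofReal_norm, ← ENNReal.ofReal_mul (norm_nonneg _), mul_comm]
    exact ENNReal.ofReal_le_ofReal (norm_inner_le_norm _ _)
  have hmeas : Measurable (Function.uncurry fun (x : RN N) (t : ℝ) =>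
      ‖h‖ₑ ^ p * ‖gradient φ (x + t • h)‖ₑ ^ p) := by
    have : Continuous fun z : RN N × ℝ => gradient φ (z.1 + z.2 • h) := by fun_prop
    exact (this.measurable.enorm.pow_const _).const_mul _
  calc ∫⁻ x, ‖φ (x + h) - φ x‖ₑ ^ p
      ≤ ∫⁻ x, ∫⁻ t in Ioc (0 : ℝ) 1, ‖h‖ₑ ^ p * ‖gradient φ (x + t • h)‖ₑ ^ p :=
        lintegral_mono hpt
    _ = ∫⁻ t in Ioc (0 : ℝ) 1, ∫⁻ x, ‖h‖ₑ ^ p * ‖gradient φ (x + t • h)‖ₑ ^ p :=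
        lintegral_lintegral_swap hmeas.aemeasurable
    _ = ∫⁻ t in Ioc (0 : ℝ) 1, ‖h‖ₑ ^ p * ∫⁻ x, ‖gradient φ x‖ₑ ^ p := by
        refine lintegral_congr fun t => ?_
        rw [lintegral_const_mul' _ _ (ENNReal.rpow_ne_top_of_nonneg hp0 (by simp)),
          lintegral_add_right_eq_self (fun x => ‖gradient φ x‖ₑ ^ p)]
    _ = _ := by simp

/-- The uniform probability measure on the ball of radius `δ`. -/
noncomputable def ballProb (N : ℕ) (δ : ℝ) : Measure (RN N) :=
  ProbabilityTheory.cond volume (Metric.ball (0 : RN N) δ)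

/-- Averages over balls of radius `δ`. -/
noncomputable def ballAvg (δ : ℝ) (φ : RN N → ℝ) (x : RN N) : ℝ :=
  ∫ y, φ (x + y) ∂(ballProb N δ)

lemma isProbabilityMeasure_ballProb {δ : ℝ} (hδ : 0 < δ) :
    IsProbabilityMeasure (ballProb N δ) :=
  ProbabilityTheory.cond_isProbabilityMeasure_of_finite (Metric.measure_ball_pos _ _ hδ).ne'
    measure_ball_lt_top.ne

lemma lintegral_ballProb_le {δ : ℝ} (f : RN N → ℝ≥0∞) :
    ∫⁻ y, f y ∂(ballProb N δ) ≤ (volume (Metric.ball (0 : RN N) δ))⁻¹ * ∫⁻ y, f y := by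
  rw [ballProb, ProbabilityTheory.cond, lintegral_smul_measure, smul_eq_mul]
  gcongr
  exact Measure.restrict_le_self

lemma ae_ballProb {δ : ℝ} : ∀ᵐ y ∂(ballProb N δ), ‖y‖ ≤ δ := by
  rw [ballProb, ProbabilityTheory.cond]
  refine Measure.ae_smul_measure ?_ _
  filter_upwards [ae_restrict_mem Metric.isOpen_ball.measurableSet] with y hy
  exact (mem_ball_zero_iff.1 hy).le

lemma integrable_translate {δ : ℝ} (hδ : 0 < δ) {φ : RN N → ℝ} (hφ : TestFun φ) (x : RN N) :
    Integrable (fun y => φ (x + y)) (ballProb N δ) := by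
  have := isProbabilityMeasure_ballProb (N := N) hδ
  obtain ⟨M, hM⟩ := hφ.2.exists_bound_of_continuous hφ.continuous
  exact Integrable.of_bound (hφ.continuous.comp (by fun_prop)).aestronglyMeasurable M
    (Eventually.of_forall fun y => hM _)

/-- For fixed δ, the averages have a Lipschitz constant controlled by ∫ ‖∇φ‖^p: the difference of
two averages is the average of a translation difference, to which Jensen and the translation
estimate apply. -/
lemma enorm_ballAvg_sub_rpow_le (hp : 1 ≤ p) {δ : ℝ} (hδ : 0 < δ) {φ : RN N → ℝ} (hφ : TestFun φ)
    (x x' : RN N) : ‖ballAvg δ φ x - ballAvg δ φ x'‖ₑ ^ p ≤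
      (volume (Metric.ball (0 : RN N) δ))⁻¹ * (‖x - x'‖ₑ ^ p * ∫⁻ y, ‖gradient φ y‖ₑ ^ p) := by
  have := isProbabilityMeasure_ballProb (N := N) hδ
  unfold ballAvg
  rw [← integral_sub (integrable_translate hδ hφ x) (integrable_translate hδ hφ x')]
  have hc := hφ.continuous
  refine (enorm_integral_rpow_le hp ?_).trans ((lintegral_ballProb_le _).trans ?_)
  · exact Continuous.aestronglyMeasurable (by fun_prop)
  · gcongr
    refine le_trans (le_of_eq ?_) (hφ.lintegral_translate_sub_le hp (x - x'))
    rw [← lintegral_add_right_eq_self (fun y => ‖φ (y + (x - x')) - φ y‖ₑ ^ p) x']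
    refine lintegral_congr fun y => ?_
    rw [show y + x' + (x - x') = x + y by abel, add_comm y x']

/-- Averaging over translations of length at most δ changes φ little in L^p, uniformly over bounded
gradients. With the Lipschitz bound this is the Kolmogorov–Riesz route to Rellich. -/
lemma lintegral_ballAvg_sub_le (hp : 1 ≤ p) {δ : ℝ} (hδ : 0 < δ) {φ : RN N → ℝ} (hφ : TestFun φ) :
    ∫⁻ x, ‖φ x - ballAvg δ φ x‖ₑ ^ p ≤ ENNReal.ofReal δ ^ p * ∫⁻ y, ‖gradient φ y‖ₑ ^ p := by
  have hp0 : 0 ≤ p := by linarith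
  have := isProbabilityMeasure_ballProb (N := N) hδ
  have hc := hφ.continuous
  have hpt : ∀ x, ‖φ x - ballAvg δ φ x‖ₑ ^ p ≤ ∫⁻ y, ‖φ (x + y) - φ x‖ₑ ^ p ∂(ballProb N δ) := by
    intro x
    have h1 : ballAvg δ φ x - φ x = ∫ y, (φ (x + y) - φ x) ∂(ballProb N δ) := by
      rw [integral_sub (integrable_translate hδ hφ x) (integrable_const _)]
      simp [ballAvg]
    rw [enorm_sub_rev, h1]
    exact enorm_integral_rpow_le hp (Continuous.aestronglyMeasurable (by fun_prop))
  have hmeas : Measurable (Function.uncurry fun (x : RN N) (y : RN N) =>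
      ‖φ (x + y) - φ x‖ₑ ^ p) := by
    have : Continuous fun z : RN N × RN N => φ (z.1 + z.2) - φ z.1 := by fun_prop
    exact this.measurable.enorm.pow_const _
  calc ∫⁻ x, ‖φ x - ballAvg δ φ x‖ₑ ^ p
      ≤ ∫⁻ x, ∫⁻ y, ‖φ (x + y) - φ x‖ₑ ^ p ∂(ballProb N δ) := lintegral_mono hpt
    _ = ∫⁻ y, ∫⁻ x, ‖φ (x + y) - φ x‖ₑ ^ p ∂volume ∂(ballProb N δ) :=
        lintegral_lintegral_swap hmeas.aemeasurable
    _ ≤ ∫⁻ _, ENNReal.ofReal δ ^ p * ∫⁻ y, ‖gradient φ y‖ₑ ^ p ∂volume ∂(ballProb N δ) := by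
        refine lintegral_mono_ae (ae_ballProb.mono fun y hy => ?_)
        refine (hφ.lintegral_translate_sub_le hp y).trans ?_
        gcongr
        rw [← ofReal_norm]
        exact ENNReal.ofReal_le_ofReal hy
    _ = _ := by simp

lemma enorm_ballAvg_rpow_le {r : ℝ} (hr : 1 ≤ r) {δ : ℝ} (hδ : 0 < δ) {φ : RN N → ℝ}
    (hφ : TestFun φ) (x : RN N) : ‖ballAvg δ φ x‖ₑ ^ r ≤
      (volume (Metric.ball (0 : RN N) δ))⁻¹ * ∫⁻ y, ‖φ y‖ₑ ^ r := by
  have := isProbabilityMeasure_ballProb (N := N) hδ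
  have hc := hφ.continuous
  refine (enorm_integral_rpow_le hr ?_).trans ((lintegral_ballProb_le _).trans ?_)
  · exact Continuous.aestronglyMeasurable (by fun_prop)
  · refine mul_le_mul_right (le_of_eq ?_) _
    simp only [add_comm x]
    exact lintegral_add_right_eq_self (fun y => ‖φ y‖ₑ ^ r) x

/-- A finite measure with the null sets of Lebesgue measure makes constants integrable on all of
ℝ^N. Local compactness can thus be argued globally, with no exhaustion by balls. -/
lemma exists_finite_measure_equiv (N : ℕ) : ∃ ν : Measure (RN N), IsFiniteMeasure ν ∧
    ν ≤ volume ∧ volume ≪ ν := by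
  obtain ⟨g, hg, hgm, hgl⟩ :=
    exists_pos_lintegral_lt_of_sigmaFinite (volume : Measure (RN N)) one_ne_zero
  let w : RN N → ℝ≥0∞ := fun x => min (g x) 1
  have hwm : Measurable w := hgm.coe_nnreal_ennreal.min measurable_const
  refine ⟨volume.withDensity w, isFiniteMeasure_withDensity ?_, ?_, ?_⟩
  · exact ((lintegral_mono fun x => min_le_left _ _).trans_lt (hgl.trans ENNReal.one_lt_top)).ne
  · conv_rhs => rw [← withDensity_one (μ := (volume : Measure (RN N)))]
    exact withDensity_mono (Eventually.of_forall fun x => min_le_right _ _)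
  · refine withDensity_absolutelyContinuous' hwm.aemeasurable (Eventually.of_forall fun x => ?_)
    have h1 : (0 : ℝ≥0∞) < g x := by exact_mod_cast hg x
    exact (lt_min h1 one_pos).ne'

/-- A bound on `‖·‖ₑ ^ r` in real terms. -/
lemma norm_le_of_enorm_rpow_le {E : Type*} [NormedAddCommGroup E] {r : ℝ} (hr : 0 < r) {a : E}
    {c : ℝ≥0∞} (hc : c ≠ ⊤) (h : ‖a‖ₑ ^ r ≤ c) : ‖a‖ ≤ (c ^ (1 / r)).toReal := by
  have h1 := ENNReal.rpow_le_rpow h (z := 1 / r) (by positivity)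
  rw [← ENNReal.rpow_mul, mul_one_div_cancel hr.ne', ENNReal.rpow_one] at h1
  have := ENNReal.toReal_mono (ENNReal.rpow_ne_top_of_nonneg (by positivity) hc) h1
  simpa using this

/-- Diagonal extraction for countably many bounded, uniformly Lipschitz sequences of functions. -/
lemma exists_subseq_tendsto_of_lipschitz {f : ℕ → ℕ → RN N → ℝ} {M L : ℕ → ℝ}
    (hM : ∀ k n x, ‖f k n x‖ ≤ M k) (hL0 : ∀ k, 0 ≤ L k)
    (hL : ∀ k n x x', ‖f k n x - f k n x'‖ ≤ L k * ‖x - x'‖) :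
    ∃ ns : ℕ → ℕ, StrictMono ns ∧
      ∀ k x, ∃ l, Tendsto (fun n => f k (ns n) x) atTop (𝓝 l) := by
  let d : ℕ → RN N := TopologicalSpace.denseSeq (RN N)
  -- Sequential compactness of a countable product of intervals yields one subsequence for all
  -- indices k and all points of a dense sequence. The Lipschitz bounds extend convergence to every
  -- x.
  obtain ⟨ℓ, -, ns, hns, hℓ⟩ := (isCompact_univ_pi (ι := ℕ × ℕ) (X := fun _ => ℝ)
    (s := fun i => Icc (-M i.1) (M i.1)) fun i => isCompact_Icc).tendsto_subseq
    (x := fun n i => f i.1 n (d i.2))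
    fun n i _ => abs_le.1 (hM i.1 n (d i.2))
  rw [tendsto_pi_nhds] at hℓ
  have hpt : ∀ k x, ∃ l, Tendsto (fun n => f k (ns n) x) atTop (𝓝 l) := by
    intro k x
    refine cauchySeq_tendsto_of_complete (Metric.cauchySeq_iff.2 fun ε hε => ?_)
    obtain ⟨i, hi⟩ : ∃ i, dist x (d i) < ε / (4 * (L k + 1)) :=
      (TopologicalSpace.denseRange_denseSeq (RN N)).exists_dist_lt x
        (div_pos hε (by have := hL0 k; positivity))
    have hLi : L k * ‖x - d i‖ ≤ ε / 4 := by
      rw [dist_eq_norm, lt_div_iff₀ (by have := hL0 k; positivity)] at hi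
      nlinarith [norm_nonneg (x - d i)]
    obtain ⟨n₀, hn₀⟩ := Metric.cauchySeq_iff.1 (hℓ (k, i)).cauchySeq (ε / 2) (by positivity)
    refine ⟨n₀, fun m hm n hn => ?_⟩
    have h1 := hn₀ m hm n hn
    have h2 := (hL k (ns m) x (d i)).trans hLi
    have h3 := (hL k (ns n) x (d i)).trans hLi
    simp only [Function.comp, Real.dist_eq, Real.norm_eq_abs] at h1 h2 h3 ⊢
    rw [abs_lt] at h1 ⊢
    rw [abs_le] at h2 h3
    constructor <;> linarith [h1.1, h1.2, h2.1, h2.2, h3.1, h3.2]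
  exact ⟨ns, hns, hpt⟩

/-- Rellich: test functions with bounded gradients have an a.e. convergent subsequence. -/
theorem exists_subseq_ae_tendsto_testFun (hp : 1 < p) (hpN : p < N) {φ : ℕ → RN N → ℝ}
    (hφ : ∀ n, TestFun (φ n)) {C : ℝ≥0∞} (hC : C ≠ ⊤)
    (hb : ∀ n, ∫⁻ x, ‖gradient (φ n) x‖ₑ ^ p ≤ C) :
    ∃ ns : ℕ → ℕ, StrictMono ns ∧ ∃ u : RN N → ℝ,
      ∀ᵐ x, Tendsto (fun n => φ (ns n) x) atTop (𝓝 (u x)) := by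
  have hp0 : 0 < p := by linarith
  have hs := pStar_pos hp hpN
  have hs1 : 1 ≤ pStar N p := (hp.trans (lt_pStar hp hpN)).le
  obtain ⟨S, hS, hsob⟩ := sobolev_testFun (N := N) hp hpN
  let δ : ℕ → ℝ := fun k => 1 / ((k : ℝ) + 1)
  have hδ : ∀ k, 0 < δ k := fun k => by positivity
  let vol : ℕ → ℝ≥0∞ := fun k => (volume (Metric.ball (0 : RN N) (δ k)))⁻¹
  have hvol : ∀ k, vol k ≠ ⊤ := fun k => by
    simpa [vol] using (Metric.measure_ball_pos volume (0 : RN N) (hδ k)).ne'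
  have hbound : ∀ k, ∃ M : ℝ, ∀ n x, ‖ballAvg (δ k) (φ n) x‖ ≤ M := by
    intro k
    refine ⟨((vol k * (S * C ^ (pStar N p / p))) ^ (1 / pStar N p)).toReal, fun n x => ?_⟩
    refine norm_le_of_enorm_rpow_le hs ?_ ?_
    · exact ENNReal.mul_ne_top (hvol k) (ENNReal.mul_ne_top hS
        (ENNReal.rpow_ne_top_of_nonneg (by positivity) hC))
    · refine (enorm_ballAvg_rpow_le hs1 (hδ k) (hφ n) x).trans ?_
      simp only [vol]
      gcongr
      refine (hsob _ (hφ n)).trans ?_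
      gcongr
      exact hb n
  choose M hM using hbound
  have hlip : ∀ k, ∃ L : ℝ, 0 ≤ L ∧ ∀ n x x',
      ‖ballAvg (δ k) (φ n) x - ballAvg (δ k) (φ n) x'‖ ≤ L * ‖x - x'‖ := by
    intro k
    refine ⟨((vol k * C) ^ (1 / p)).toReal, ENNReal.toReal_nonneg, fun n x x' => ?_⟩
    have h1 : ‖ballAvg (δ k) (φ n) x - ballAvg (δ k) (φ n) x'‖ₑ ^ p ≤
        (vol k * C) * ‖x - x'‖ₑ ^ p := by
      refine (enorm_ballAvg_sub_rpow_le hp.le (hδ k) (hφ n) x x').trans ?_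
      rw [mul_assoc, mul_comm C]
      simp only [vol]
      gcongr
      exact hb n
    have h2 := norm_le_of_enorm_rpow_le hp0 (ENNReal.mul_ne_top (ENNReal.mul_ne_top (hvol k) hC)
      (ENNReal.rpow_ne_top_of_nonneg hp0.le (by simp))) h1
    rw [ENNReal.mul_rpow_of_nonneg _ _ (by positivity), ENNReal.toReal_mul, ← ENNReal.rpow_mul,
      mul_one_div_cancel hp0.ne', ENNReal.rpow_one] at h2
    simpa using h2
  choose L hL0 hL using hlip
  obtain ⟨ns, hns, hpt⟩ := exists_subseq_tendsto_of_lipschitz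
    (f := fun k n => ballAvg (δ k) (φ n)) hM hL0 hL
  choose l hl using hpt
  obtain ⟨ν, hνfin, hνle, hνac⟩ := exists_finite_measure_equiv N
  have havgm : ∀ k n, AEStronglyMeasurable (ballAvg (δ k) (φ n)) ν := fun k n => by
    refine Continuous.aestronglyMeasurable ?_
    exact (LipschitzWith.of_dist_le' (K := L k) fun x x' => by
      simpa [dist_eq_norm] using hL k n x x').continuous
  have hlm : ∀ k, AEStronglyMeasurable (l k) ν := fun k =>
    aestronglyMeasurable_of_tendsto_ae atTop (fun n => havgm k (ns n))
      (Eventually.of_forall (hl k))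
  have hφm : ∀ n, AEStronglyMeasurable (φ n) ν := fun n => (hφ n).continuous.aestronglyMeasurable
  have happrox : ∀ k, Tendsto (fun n => ∫⁻ x, ‖ballAvg (δ k) (φ (ns n)) x - l k x‖ₑ ^ p ∂ν)
      atTop (𝓝 0) := by
    intro k
    have := tendsto_lintegral_of_dominated_convergence' (μ := ν)
      (F := fun n x => ‖ballAvg (δ k) (φ (ns n)) x - l k x‖ₑ ^ p) (f := fun _ => 0)
      (fun _ => ENNReal.ofReal (2 * M k) ^ p)
      (fun n => ((havgm k _).sub (hlm k)).enorm.pow_const _) ?_ ?_ ?_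
    · simpa using this
    · refine fun n => Eventually.of_forall fun x => ?_
      have h1 : ‖l k x‖ ≤ M k := le_of_tendsto (hl k x).norm (Eventually.of_forall fun n => hM k _ x)
      simp only
      gcongr
      rw [← ofReal_norm]
      refine ENNReal.ofReal_le_ofReal ((norm_sub_le _ _).trans ?_)
      linarith [hM k (ns n) x]
    · rw [lintegral_const]
      exact ENNReal.mul_ne_top (ENNReal.rpow_ne_top_of_nonneg hp0.le ENNReal.ofReal_ne_top)
        (measure_lt_top ν _).ne
    · refine Eventually.of_forall fun x => ?_
      rw [enorm_rpow_tendsto_zero_iff hp0, ← tendsto_iff_norm_sub_tendsto_zero]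
      exact hl k x
  have h2top : (2 : ℝ≥0∞) ^ (p - 1) ≠ ⊤ :=
    ENNReal.rpow_ne_top_of_nonneg (by linarith) (by simp)
  -- At a sufficiently small scale the averages are close to φ_n uniformly in n and converge along
  -- the subsequence; their limit is close to all late terms. Hence the subsequence is Cauchy in
  -- L^p(ν).
  have hclose : ∀ ε : ℝ≥0∞, 0 < ε → ∃ f : RN N → ℝ, AEStronglyMeasurable f ν ∧
      ∀ᶠ n in atTop, ∫⁻ x, ‖φ (ns n) x - f x‖ₑ ^ p ∂ν ≤ ε := by
    intro ε hε
    have hδlim : Tendsto (fun k => (2 : ℝ≥0∞) ^ (p - 1) * (ENNReal.ofReal (δ k) ^ p * C))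
        atTop (𝓝 0) := by
      have h1 : Tendsto δ atTop (𝓝 0) := tendsto_one_div_add_atTop_nhds_zero_nat
      have h2 := ((ENNReal.continuous_rpow_const (y := p)).tendsto _).comp
        (ENNReal.tendsto_ofReal h1)
      rw [ENNReal.ofReal_zero, ENNReal.zero_rpow_of_pos hp0] at h2
      have h3 := ENNReal.Tendsto.const_mul (ENNReal.Tendsto.mul_const h2 (Or.inr hC))
        (Or.inr h2top)
      simpa using h3
    have hε2 : 0 < ε / 2 := ENNReal.half_pos hε.ne'
    obtain ⟨k, hk⟩ := (hδlim.eventually (gt_mem_nhds hε2)).exists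
    have h4 := ENNReal.Tendsto.const_mul (happrox k) (Or.inr h2top)
    rw [mul_zero] at h4
    refine ⟨l k, hlm k, (h4.eventually (gt_mem_nhds hε2)).mono fun n hn => ?_⟩
    calc ∫⁻ x, ‖φ (ns n) x - l k x‖ₑ ^ p ∂ν
        ≤ ∫⁻ x, 2 ^ (p - 1) * (‖φ (ns n) x - ballAvg (δ k) (φ (ns n)) x‖ₑ ^ p +
            ‖ballAvg (δ k) (φ (ns n)) x - l k x‖ₑ ^ p) ∂ν := by
          refine lintegral_mono fun x => ?_
          refine le_trans (le_of_eq ?_) (enorm_add_rpow_le hp.le _ _)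
          rw [sub_add_sub_cancel]
      _ = 2 ^ (p - 1) * (∫⁻ x, ‖φ (ns n) x - ballAvg (δ k) (φ (ns n)) x‖ₑ ^ p ∂ν) +
            2 ^ (p - 1) * ∫⁻ x, ‖ballAvg (δ k) (φ (ns n)) x - l k x‖ₑ ^ p ∂ν := by
          rw [lintegral_const_mul' _ _ h2top, lintegral_add_left'
            (((hφm _).fun_sub (havgm k _)).enorm.pow_const _), mul_add]
      _ ≤ ε / 2 + ε / 2 := by
          refine add_le_add (le_trans ?_ hk.le) hn.le
          gcongr
          refine (lintegral_mono' hνle le_rfl).trans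
            ((lintegral_ballAvg_sub_le hp.le (hδ k) (hφ _)).trans ?_)
          gcongr
          exact hb _
      _ = ε := ENNReal.add_halves ε
  have hcau : ∀ ε : ℝ, 0 < ε → ∃ J, ∀ j ≥ J, ∀ k ≥ J,
      ∫⁻ x, ‖φ (ns j) x - φ (ns k) x‖ₑ ^ p ∂ν ≤ ENNReal.ofReal ε := by
    intro ε hε
    have hε' : 0 < (2 ^ (p - 1))⁻¹ * (ENNReal.ofReal ε / 2) :=
      ENNReal.mul_pos (ENNReal.inv_ne_zero.2 h2top)
        (ENNReal.half_pos (by simpa using hε)).ne'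
    obtain ⟨f, hf, hev⟩ := hclose _ hε'
    obtain ⟨J, hJ⟩ := eventually_atTop.1 hev
    refine ⟨J, fun j hj k hk => ?_⟩
    calc ∫⁻ x, ‖φ (ns j) x - φ (ns k) x‖ₑ ^ p ∂ν
        ≤ ∫⁻ x, 2 ^ (p - 1) * (‖φ (ns j) x - f x‖ₑ ^ p + ‖φ (ns k) x - f x‖ₑ ^ p) ∂ν := by
          refine lintegral_mono fun x => ?_
          rw [enorm_sub_rev (φ (ns k) x)]
          refine le_trans (le_of_eq ?_) (enorm_add_rpow_le hp.le _ _)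
          rw [sub_add_sub_cancel]
      _ = 2 ^ (p - 1) * ((∫⁻ x, ‖φ (ns j) x - f x‖ₑ ^ p ∂ν) +
            ∫⁻ x, ‖φ (ns k) x - f x‖ₑ ^ p ∂ν) := by
          rw [lintegral_const_mul' _ _ h2top, lintegral_add_left'
            (((hφm _).fun_sub hf).enorm.pow_const _)]
      _ ≤ 2 ^ (p - 1) * ((2 ^ (p - 1))⁻¹ * (ENNReal.ofReal ε / 2) +
            (2 ^ (p - 1))⁻¹ * (ENNReal.ofReal ε / 2)) := by
          gcongr
          · exact hJ j hj
          · exact hJ k hk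
      _ = ENNReal.ofReal ε := by
          rw [← mul_add, ENNReal.add_halves, ← mul_assoc, ENNReal.mul_inv_cancel
            (ENNReal.rpow_pos (by simp) (by simp)).ne' h2top, one_mul]
  obtain ⟨u, hum, hu⟩ := exists_limit_of_cauchy (V := fun n => φ (ns n)) hp.le
    (fun n => hφm _) (fun n => (lintegral_mono' hνle le_rfl).trans_lt
      (lintegral_enorm_rpow_lt_top_of_hasCompactSupport (hφ _).continuous (hφ _).2 hp0)) hcau
  obtain ⟨ms, hms, hae⟩ := exists_subseq_ae_tendsto_zero
    (fun j => ((hφm (ns j)).sub hum).enorm.pow_const p) hu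
  refine ⟨ns ∘ ms, hns.comp hms, u, hνac.ae_le ?_⟩
  filter_upwards [hae] with x hx
  rw [tendsto_iff_norm_sub_tendsto_zero, ← enorm_rpow_tendsto_zero_iff hp0]
  exact hx

/-- Sequences of bounded energy have an a.e. convergent subsequence with limit in the space. -/
theorem exists_subseq_ae_tendsto (hp : 1 < p) (hpN : p < N) (hA : MemLp A ⊤ volume)
    (hpos : ∀ᵐ x, 0 < A x) {u : ℕ → RN N → ℝ} {V : ℕ → RN N → RN N}
    (h : ∀ n, IsWA p A (u n) (V n)) {C : ℝ≥0∞} (hC : C ≠ ⊤)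
    (hb : ∀ n, energy p A (u n) (V n) ≤ C) :
    ∃ ns : ℕ → ℕ, StrictMono ns ∧ ∃ (u' : RN N → ℝ) (V' : RN N → RN N), IsWA p A u' V' ∧
      ∀ᵐ x, Tendsto (fun n => u (ns n) x) atTop (𝓝 (u' x)) := by
  have hp0 : 0 < p := by linarith
  have hAm := hA.1.aemeasurable
  have hinv : Tendsto (fun n : ℕ => ((n : ℝ≥0∞) + 1)⁻¹) atTop (𝓝 0) := by
    have := (tendsto_add_atTop_iff_nat 1).2 ENNReal.tendsto_inv_nat_nhds_zero
    simpa using this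
  -- Rellich is applied to test functions within 1/(n+1) of `u n` in energy; the differences tend to
  -- zero a.e. along a further subsequence.
  have h1 : ∀ n : ℕ, ∃ φ : RN N → ℝ, TestFun φ ∧
      energy p A (φ - u n) (gradient φ - V n) < ((n : ℝ≥0∞) + 1)⁻¹ := by
    intro n
    obtain ⟨φ, hφ, hl⟩ := (h n).approx
    have hn : (0 : ℝ≥0∞) < ((n : ℝ≥0∞) + 1)⁻¹ := by simp
    obtain ⟨k, hk⟩ := (hl.eventually (gt_mem_nhds hn)).exists
    exact ⟨φ k, hφ k, hk⟩
  choose φ hφ hlt using h1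
  have hdiff : Tendsto (fun n => energy p A (φ n - u n) (gradient (φ n) - V n)) atTop (𝓝 0) :=
    tendsto_of_tendsto_of_tendsto_of_le_of_le tendsto_const_nhds hinv (fun _ => zero_le)
      fun n => (hlt n).le
  have hW : ∀ n, IsWA p A (φ n - u n) (gradient (φ n) - V n) := fun n =>
    ((hφ n).isWA hp0).sub hp.le hAm (h n)
  have hφb : ∀ n, ∫⁻ x, ‖gradient (φ n) x‖ₑ ^ p ≤ 2 ^ (p - 1) * (1 + C) := by
    intro n
    refine (lintegral_grad_le_energy (A := A) (φ n) _).trans ?_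
    have e1 : φ n = (φ n - u n) + u n := by abel
    have e2 : gradient (φ n) = (gradient (φ n) - V n) + V n := by abel
    have h2 := energy_add_le (p := p) (A := A) hp.le (u' := u n) (V' := V n) hAm
      (hW n).aesm (hW n).aesmGrad
    rw [← e1, ← e2] at h2
    refine h2.trans ?_
    gcongr
    · exact (hlt n).le.trans (by simp)
    · exact hb n
  obtain ⟨ns, hns, u', hae⟩ := exists_subseq_ae_tendsto_testFun hp hpN hφ
    (ENNReal.mul_ne_top (ENNReal.rpow_ne_top_of_nonneg (by linarith) (by simp))
      (ENNReal.add_ne_top.2 ⟨by simp, hC⟩)) hφb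
  obtain ⟨ms, hms, hae'⟩ := exists_subseq_ae_of_energy hp0 hAm hpos
    (fun n => (hW (ns n)).aesm) (fun n => (hW (ns n)).aesmGrad) (hdiff.comp hns.tendsto_atTop)
  have hlim : ∀ᵐ x, Tendsto (fun n => u (ns (ms n)) x) atTop (𝓝 (u' x)) := by
    filter_upwards [hae, hae'] with x hx hx'
    have := (hx.comp hms.tendsto_atTop).sub hx'
    simpa using this
  obtain ⟨V', hV', -⟩ := exists_grad_of_tendsto_ae hp hA (fun n => h (ns (ms n))) hC
    (fun n => hb _) hlim
  exact ⟨ns ∘ ms, hns.comp hms, u', V', hV', hlim⟩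

end NodalNehari

/-! ### Subcritical integrals and cutoffs -/

namespace NodalNehari

variable {N : ℕ} {p : ℝ} {A : RN N → ℝ}

/-! ### Convergence of weighted subcritical integrals -/

/-- A form of Young's inequality with a truncation. -/
lemma mul_rpow_le_max {r t : ℝ} (hr : 0 < r) (hrt : r < t) {η : ℝ≥0∞} (hη0 : η ≠ 0)
    (hη : η ≠ ⊤) (w h : ℝ≥0∞) :
    w * h ^ r ≤ (η ^ (r / (t - r)))⁻¹ * w ^ (t / (t - r)) ∨ w * h ^ r ≤ η * h ^ t := by
  have htr : 0 < t - r := by linarith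
  have ha : 0 < r / (t - r) := by positivity
  have hηa0 : η ^ (r / (t - r)) ≠ 0 := (ENNReal.rpow_pos hη0.bot_lt hη).ne'
  have hηa : η ^ (r / (t - r)) ≠ ⊤ := ENNReal.rpow_ne_top_of_nonneg ha.le hη
  -- The comparison is w against η h^(t-r), raised to the power r/(t-r). If w is smaller, the
  -- product is at most η h^t; otherwise h can be eliminated in favour of w.
  rcases le_total (w ^ (r / (t - r))) (η ^ (r / (t - r)) * h ^ r) with hle | hle
  · right
    have h1 := ENNReal.rpow_le_rpow hle (z := (r / (t - r))⁻¹) (by positivity)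
    rw [ENNReal.mul_rpow_of_nonneg _ _ (by positivity), ← ENNReal.rpow_mul, ← ENNReal.rpow_mul,
      ← ENNReal.rpow_mul, mul_inv_cancel₀ ha.ne', ENNReal.rpow_one, ENNReal.rpow_one] at h1
    calc w * h ^ r ≤ η * h ^ (r * (r / (t - r))⁻¹) * h ^ r := by gcongr
      _ = η * h ^ t := by
          rw [mul_assoc, ← ENNReal.rpow_add_of_nonneg _ _ (by positivity) hr.le]
          congr 2
          field_simp
          ring
  · left
    have h1 : h ^ r ≤ (η ^ (r / (t - r)))⁻¹ * w ^ (r / (t - r)) := by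
      rw [← ENNReal.div_eq_inv_mul, ENNReal.le_div_iff_mul_le (Or.inl hηa0) (Or.inl hηa), mul_comm]
      exact hle
    calc w * h ^ r ≤ w * ((η ^ (r / (t - r)))⁻¹ * w ^ (r / (t - r))) := by gcongr
      _ = (η ^ (r / (t - r)))⁻¹ * (w ^ (1 : ℝ) * w ^ (r / (t - r))) := by
          rw [ENNReal.rpow_one]; ring
      _ = _ := by
          rw [← ENNReal.rpow_add_of_nonneg _ _ zero_le_one ha.le]
          congr 2
          field_simp
          ring

lemma lintegral_mul_rpow_lt_top {α : Type*} [MeasurableSpace α] {μ : Measure α} {r t : ℝ}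
    (hr : 0 < r) (hrt : r < t) {w h : α → ℝ≥0∞} (hw : AEMeasurable w μ)
    (hwi : ∫⁻ x, w x ^ (t / (t - r)) ∂μ < ⊤) (hh : ∫⁻ x, h x ^ t ∂μ < ⊤) :
    ∫⁻ x, w x * h x ^ r ∂μ < ⊤ := by
  calc ∫⁻ x, w x * h x ^ r ∂μ ≤ ∫⁻ x, (w x ^ (t / (t - r)) + h x ^ t) ∂μ := by
        refine lintegral_mono fun x => ?_
        rcases mul_rpow_le_max hr hrt one_ne_zero ENNReal.one_ne_top (w x) (h x) with h1 | h1
        · exact (by simpa using h1 : _ ≤ w x ^ (t / (t - r))).trans le_self_add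
        · exact (by simpa using h1 : _ ≤ h x ^ t).trans le_add_self
    _ < ⊤ := by
        rw [lintegral_add_left' (hw.pow_const _)]
        exact ENNReal.add_lt_top.2 ⟨hwi, hh⟩

/-- If `g n ≤ w * (h n) ^ r` with `w ∈ L^{t/(t-r)}` and `h n` bounded in `L^t`, and `g n → 0` a.e.,
then `∫ g n → 0`. -/
lemma tendsto_lintegral_zero_of_le {α : Type*} [MeasurableSpace α] {μ : Measure α} {r t : ℝ}
    (hr : 0 < r) (hrt : r < t) {w : α → ℝ≥0∞} {g h : ℕ → α → ℝ≥0∞} (hw : AEMeasurable w μ)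
    (hg : ∀ n, AEMeasurable (g n) μ)
    (hwi : ∫⁻ x, w x ^ (t / (t - r)) ∂μ < ⊤) {M : ℝ≥0∞} (hM : M ≠ ⊤)
    (hh : ∀ n, ∫⁻ x, h n x ^ t ∂μ ≤ M) (hle : ∀ n, ∀ᵐ x ∂μ, g n x ≤ w x * h n x ^ r)
    (hlim : ∀ᵐ x ∂μ, Tendsto (fun n => g n x) atTop (𝓝 0)) :
    Tendsto (fun n => ∫⁻ x, g n x ∂μ) atTop (𝓝 0) := by
  rw [ENNReal.tendsto_nhds_zero]
  intro ε hε
  rcases eq_or_ne ε ⊤ with rfl | hεt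
  · simp
  set η : ℝ≥0∞ := ε / 2 / (M + 1) with hηdef
  have hM1 : M + 1 ≠ ⊤ := ENNReal.add_ne_top.2 ⟨hM, by simp⟩
  have hη0 : η ≠ 0 := (ENNReal.div_pos (ENNReal.half_pos hε.ne').ne' hM1).ne'
  have hη : η ≠ ⊤ := ENNReal.div_ne_top (ENNReal.div_ne_top hεt (by simp)) (by simp)
  have hηM : η * M ≤ ε / 2 := by
    calc η * M ≤ η * (M + 1) := by gcongr; exact le_self_add
      _ = ε / 2 := ENNReal.div_mul_cancel (by simp) hM1
  -- Where `g n` exceeds the integrable function `b`, it is at most η h^t, whose integral is at most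
  -- ε/2 by the choice of η. The truncation min(g_n, b) is treated by dominated convergence.
  let b : α → ℝ≥0∞ := fun x => (η ^ (r / (t - r)))⁻¹ * w x ^ (t / (t - r))
  have hb : AEMeasurable b μ := (hw.pow_const _).const_mul _
  have hbi : ∫⁻ x, b x ∂μ ≠ ⊤ := by
    have : (η ^ (r / (t - r)))⁻¹ ≠ ⊤ := by
      rw [Ne, ENNReal.inv_eq_top]
      exact (ENNReal.rpow_pos hη0.bot_lt hη).ne'
    simp only [b]
    rw [lintegral_const_mul' _ _ this]
    exact ENNReal.mul_ne_top this hwi.ne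
  have h1 : Tendsto (fun n => ∫⁻ x, min (g n x) (b x) ∂μ) atTop (𝓝 0) := by
    have := tendsto_lintegral_of_dominated_convergence' (μ := μ)
      (F := fun n x => min (g n x) (b x)) (f := fun _ => 0) b
      (fun n => (hg n).min hb) (fun n => Eventually.of_forall fun x => min_le_right _ _) hbi
      (hlim.mono fun x hx => by simpa using hx.min (tendsto_const_nhds (x := b x)))
    simpa using this
  filter_upwards [h1.eventually (gt_mem_nhds (ENNReal.half_pos hε.ne'))] with n hn
  calc ∫⁻ x, g n x ∂μ ≤ ∫⁻ x, (min (g n x) (b x) + η * h n x ^ t) ∂μ := by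
        refine lintegral_mono_ae ((hle n).mono fun x hx => ?_)
        rcases mul_rpow_le_max hr hrt hη0 hη (w x) (h n x) with h2 | h2
        · rw [min_eq_left (hx.trans h2)]; exact le_self_add
        · exact (hx.trans h2).trans le_add_self
    _ = ∫⁻ x, min (g n x) (b x) ∂μ + η * ∫⁻ x, h n x ^ t ∂μ := by
        rw [lintegral_add_left' ((hg n).min hb), lintegral_const_mul' _ _ hη]
    _ ≤ ε / 2 + ε / 2 := by
        refine add_le_add hn.le (le_trans ?_ hηM)
        gcongr
        exact hh n
    _ = ε := ENNReal.add_halves ε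

/-- A weight `B` in `L^{t/(t-r)}` together with a nonlinearity `F` with `|F(x,s)| ≤ B(x) |s|^r`. -/
structure IsSubcritical {N : ℕ} (r t : ℝ) (F : RN N → ℝ → ℝ) (B : RN N → ℝ) : Prop where
  pos : 0 < r
  lt : r < t
  aem : AEMeasurable B volume
  int : ∫⁻ x, ENNReal.ofReal (B x) ^ (t / (t - r)) < ⊤
  cont : ∀ᵐ x, Continuous (F x)
  bound : ∀ᵐ x, ∀ s, |F x s| ≤ B x * |s| ^ r
  meas : ∀ v : RN N → ℝ, AEStronglyMeasurable v volume →
    AEStronglyMeasurable (fun x => F x (v x)) volume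

variable {r t : ℝ} {F : RN N → ℝ → ℝ} {B : RN N → ℝ}

lemma IsSubcritical.enorm_le (h : IsSubcritical r t F B) :
    ∀ᵐ x, ∀ s, ‖F x s‖ₑ ≤ ENNReal.ofReal (B x) * ‖s‖ₑ ^ r := by
  filter_upwards [h.bound] with x hx s
  have hB : 0 ≤ B x := by simpa using (abs_nonneg _).trans (hx 1)
  rw [← ofReal_norm, ← ofReal_norm, ENNReal.ofReal_rpow_of_nonneg (norm_nonneg _) h.pos.le,
    ← ENNReal.ofReal_mul hB]
  exact ENNReal.ofReal_le_ofReal (hx s)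

lemma IsSubcritical.integrable (h : IsSubcritical r t F B) {v : RN N → ℝ}
    (hv : AEStronglyMeasurable v volume) (hvt : ∫⁻ x, ‖v x‖ₑ ^ t < ⊤) :
    Integrable (fun x => F x (v x)) := by
  refine ⟨h.meas v hv, ?_⟩
  refine lt_of_le_of_lt (lintegral_mono_ae ?_)
    (lintegral_mul_rpow_lt_top h.pos h.lt h.aem.ennreal_ofReal h.int hvt)
  filter_upwards [h.enorm_le] with x hx using hx _

/-- This takes the place of a compact embedding. The difference |F(u_n) - F(v)| is at most 2B
max(|u_n|, |v|)^r, so a.e. convergence and a bound in L^t suffice, with no compactness of the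
domain. -/
lemma IsSubcritical.tendsto_integral (h : IsSubcritical r t F B) {u : ℕ → RN N → ℝ} {v : RN N → ℝ}
    (hu : ∀ n, AEStronglyMeasurable (u n) volume) {M : ℝ≥0∞} (hM : M ≠ ⊤)
    (hb : ∀ n, ∫⁻ x, ‖u n x‖ₑ ^ t ≤ M)
    (hlim : ∀ᵐ x, Tendsto (fun n => u n x) atTop (𝓝 (v x))) :
    Tendsto (fun n => ∫ x, F x (u n x)) atTop (𝓝 (∫ x, F x (v x))) := by
  have ht : 0 < t := h.pos.trans h.lt
  have hv : AEStronglyMeasurable v volume := aestronglyMeasurable_of_tendsto_ae atTop hu hlim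
  have hvb : ∫⁻ x, ‖v x‖ₑ ^ t ≤ M := by
    have := lintegral_le_of_tendsto_ae (p := t) (w := fun _ => (1 : ℝ≥0∞)) aemeasurable_const hu
      hlim (c := M) (Eventually.of_forall fun n => by simpa using hb n)
    simpa using this
  refine tendsto_integral_of_L1' _ (h.meas v hv)
    (Eventually.of_forall fun n => h.integrable (hu n) ((hb n).trans_lt hM.lt_top)) ?_
  simp only [eLpNorm_one_eq_lintegral_enorm]
  refine tendsto_lintegral_zero_of_le h.pos h.lt (w := fun x => 2 * ENNReal.ofReal (B x))
    (h := fun n x => max ‖u n x‖ₑ ‖v x‖ₑ) (h.aem.ennreal_ofReal.const_mul _)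
    (fun n => ((h.meas _ (hu n)).sub (h.meas v hv)).enorm) ?_ (M := M + M)
    (ENNReal.add_ne_top.2 ⟨hM, hM⟩) (fun n => ?_) (fun n => ?_) ?_
  · have he : 0 ≤ t / (t - r) := div_nonneg ht.le (by linarith [h.lt])
    simp only [ENNReal.mul_rpow_of_nonneg _ _ he]
    rw [lintegral_const_mul' _ _ (ENNReal.rpow_ne_top_of_nonneg he (by simp))]
    exact ENNReal.mul_lt_top (ENNReal.rpow_lt_top_of_nonneg he (by simp)) h.int
  · calc ∫⁻ x, (max ‖u n x‖ₑ ‖v x‖ₑ) ^ t ≤ ∫⁻ x, (‖u n x‖ₑ ^ t + ‖v x‖ₑ ^ t) := by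
          refine lintegral_mono fun x => ?_
          rcases max_choice ‖u n x‖ₑ ‖v x‖ₑ with h1 | h1 <;> simp only [h1]
          · exact le_self_add
          · exact le_add_self
      _ = (∫⁻ x, ‖u n x‖ₑ ^ t) + ∫⁻ x, ‖v x‖ₑ ^ t :=
          lintegral_add_left' ((hu n).enorm.pow_const _) _
      _ ≤ M + M := add_le_add (hb n) hvb
  · filter_upwards [h.enorm_le] with x hx
    simp only [Pi.sub_apply]
    calc ‖F x (u n x) - F x (v x)‖ₑ ≤ ‖F x (u n x)‖ₑ + ‖F x (v x)‖ₑ := enorm_sub_le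
      _ ≤ ENNReal.ofReal (B x) * (max ‖u n x‖ₑ ‖v x‖ₑ) ^ r +
            ENNReal.ofReal (B x) * (max ‖u n x‖ₑ ‖v x‖ₑ) ^ r := by
          have hr := h.pos.le
          refine add_le_add ((hx _).trans ?_) ((hx _).trans ?_)
          · gcongr; exact le_max_left _ _
          · gcongr; exact le_max_right _ _
      _ = _ := by ring
  · filter_upwards [hlim, h.cont] with x hx hc
    have h1 := ((hc.tendsto _).comp hx).sub_const (F x (v x))
    rw [sub_self] at h1
    simpa [Function.comp_def] using (continuous_enorm.tendsto _).comp h1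

/-! ### Cutoff functions -/

lemma lintegral_rpow_rpow_lt_top {E : Type*} [NormedAddCommGroup E] {f : RN N → E}
    (hf : Continuous f) (hc : HasCompactSupport f) (hr : 0 < r) (ht : 0 < t) :
    ∫⁻ x, (‖f x‖ₑ ^ r) ^ t < ⊤ := by
  simp only [← ENNReal.rpow_mul]
  exact lintegral_enorm_rpow_lt_top_of_hasCompactSupport hf hc (by positivity)

/-- Multiplication by a test function preserves the space. -/
lemma IsWA.mul_testFun (hp : 1 < p) (hpN : p < N) (hA : MemLp A ⊤ volume)
    (hpos : ∀ᵐ x, 0 < A x) {u : RN N → ℝ} {V : RN N → RN N} (h : IsWA p A u V)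
    {η : RN N → ℝ} (hη : TestFun η) :
    IsWA p A (fun x => η x * u x) (fun x => η x • V x + u x • gradient η x) := by
  have hp0 : 0 < p := by linarith
  have hAm := hA.1.aemeasurable
  obtain ⟨φ, hφ, hen, h1, h2, hae⟩ := h.exists_approx hp hpN hA hpos
  obtain ⟨M, hM⟩ := hη.2.exists_bound_of_continuous hη.continuous
  have hMe : ∀ x, ‖η x‖ₑ ≤ ENNReal.ofReal M := fun x => by
    rw [← ofReal_norm]; exact ENNReal.ofReal_le_ofReal (hM x)
  have hMp : ENNReal.ofReal M ^ p ≠ ⊤ := ENNReal.rpow_ne_top_of_nonneg hp0.le ENNReal.ofReal_ne_top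
  have h2t : (2 : ℝ≥0∞) ^ (p - 1) ≠ ⊤ := ENNReal.rpow_ne_top_of_nonneg (by linarith) (by simp)
  refine ⟨hη.continuous.aestronglyMeasurable.mul h.aesm,
    (hη.continuous.aestronglyMeasurable.smul h.aesmGrad).add
      (h.aesm.smul hη.continuous_gradient.aestronglyMeasurable),
    fun n => η * φ n, fun n => hη.mul (hφ n), ?_⟩
  -- The product rule creates the error (φ_n - u)∇η, which the energy does not control directly. It
  -- is subcritical with compactly supported weight ‖∇η‖^p, so a bound in L^{p^*} and a.e.
  -- convergence are enough.
  have hmid : Tendsto (fun n => ∫⁻ x, ‖gradient η x‖ₑ ^ p * ‖φ n x - u x‖ₑ ^ p) atTop (𝓝 0) := by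
    have hdm : ∀ n, AEStronglyMeasurable (fun x => φ n x - u x) volume := fun n =>
      (hφ n).continuous.aestronglyMeasurable.sub h.aesm
    obtain ⟨n₀, hn₀⟩ := eventually_atTop.1 (h1.eventually (gt_mem_nhds one_pos))
    -- Dropping finitely many terms provides the uniform bound 1 in L^{p^*}.
    rw [← tendsto_add_atTop_iff_nat n₀]
    refine tendsto_lintegral_zero_of_le hp0 (lt_pStar hp hpN) (M := 1)
      (w := fun x => ‖gradient η x‖ₑ ^ p) (h := fun n x => ‖φ (n + n₀) x - u x‖ₑ)
      (hη.continuous_gradient.aestronglyMeasurable.enorm.pow_const _)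
      (fun n => (hη.continuous_gradient.aestronglyMeasurable.enorm.pow_const _).mul
        ((hdm _).enorm.pow_const _)) ?_ ENNReal.one_ne_top
      (fun n => (hn₀ _ (Nat.le_add_left _ _)).le)
      (fun n => Eventually.of_forall fun x => le_rfl) ?_
    · exact lintegral_rpow_rpow_lt_top hη.continuous_gradient hη.hasCompactSupport_gradient
        hp0 (div_pos (pStar_pos hp hpN) (by linarith [lt_pStar hp hpN]))
    · filter_upwards [hae] with x hx
      have h3 : Tendsto (fun n => ‖φ n x - u x‖ₑ ^ p) atTop (𝓝 0) := by
        rw [enorm_rpow_tendsto_zero_iff hp0, ← tendsto_iff_norm_sub_tendsto_zero]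
        exact hx
      have := ENNReal.Tendsto.const_mul (a := ‖gradient η x‖ₑ ^ p)
        (h3.comp (tendsto_add_atTop_nat n₀))
        (Or.inr (ENNReal.rpow_ne_top_of_nonneg hp0.le (by simp)))
      simpa using this
  have hz := (ENNReal.Tendsto.const_mul ((ENNReal.Tendsto.const_mul hen (Or.inr hMp)).add hmid)
    (Or.inr h2t))
  simp only [mul_zero, add_zero] at hz
  refine tendsto_of_tendsto_of_tendsto_of_le_of_le tendsto_const_nhds hz (fun _ => zero_le) ?_
  intro n
  have hm : AEMeasurable (fun x => ‖gradient (φ n) x - V x‖ₑ ^ p +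
      ENNReal.ofReal (A x) * ‖φ n x - u x‖ₑ ^ p) volume :=
    (((hφ n).continuous_gradient.aestronglyMeasurable.sub h.aesmGrad).enorm.pow_const _).add
      (hA.1.aemeasurable.ennreal_ofReal.mul
        (((hφ n).continuous.aestronglyMeasurable.sub h.aesm).enorm.pow_const _))
  simp only [energy, gradient_mul' hη.differentiable (hφ n).differentiable]
  simp only [Pi.sub_apply, Pi.mul_apply]
  rw [← lintegral_const_mul' _ _ hMp, ← lintegral_add_left' (hm.const_mul _),
    ← lintegral_const_mul' _ _ h2t]
  refine lintegral_mono fun x => ?_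
  have e1 : η x • gradient (φ n) x + φ n x • gradient η x - (η x • V x + u x • gradient η x) =
      η x • (gradient (φ n) x - V x) + (φ n x - u x) • gradient η x := by
    rw [smul_sub, sub_smul]; abel
  have e2 : η x * φ n x - η x * u x = η x * (φ n x - u x) := by ring
  have h21 : (1 : ℝ≥0∞) ≤ 2 ^ (p - 1) := ENNReal.one_le_rpow (by norm_num) (by linarith)
  rw [e1, e2, enorm_mul, ENNReal.mul_rpow_of_nonneg _ _ hp0.le]
  calc _ ≤ 2 ^ (p - 1) * (‖η x • (gradient (φ n) x - V x)‖ₑ ^ p +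
        ‖(φ n x - u x) • gradient η x‖ₑ ^ p) +
        2 ^ (p - 1) * (ENNReal.ofReal (A x) * (‖η x‖ₑ ^ p * ‖φ n x - u x‖ₑ ^ p)) := by
        refine add_le_add (enorm_add_rpow_le hp.le _ _) ?_
        exact le_mul_of_one_le_left zero_le h21
    _ = 2 ^ (p - 1) * (‖η x‖ₑ ^ p * (‖gradient (φ n) x - V x‖ₑ ^ p +
          ENNReal.ofReal (A x) * ‖φ n x - u x‖ₑ ^ p) +
          ‖gradient η x‖ₑ ^ p * ‖φ n x - u x‖ₑ ^ p) := by
        rw [enorm_smul, enorm_smul, ENNReal.mul_rpow_of_nonneg _ _ hp0.le,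
          ENNReal.mul_rpow_of_nonneg _ _ hp0.le]
        ring
    _ ≤ _ := by
        gcongr
        exact hMe x

/-- Cutoff functions at infinity: their gradients are negligible against functions in `L^{p^*}`. -/
lemma exists_cutoff (hp : 1 < p) (hpN : p < N) : ∃ η : ℕ → RN N → ℝ, (∀ k, TestFun (η k)) ∧
    (∀ k x, 0 ≤ η k x) ∧ (∀ k x, η k x ≤ 1) ∧ (∀ x, Tendsto (fun k => η k x) atTop (𝓝 1)) ∧
    ∀ u : RN N → ℝ, AEStronglyMeasurable u volume → ∫⁻ x, ‖u x‖ₑ ^ pStar N p < ⊤ →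
      Tendsto (fun k => ∫⁻ x, ‖gradient (η k) x‖ₑ ^ p * ‖u x‖ₑ ^ p) atTop (𝓝 0) := by
  have hp0 : 0 < p := by linarith
  have hN0 : (0 : ℝ) < N := by linarith
  let ψ : ContDiffBump (0 : RN N) := ⟨1, 2, one_pos, by norm_num⟩
  have hψ : TestFun (ψ : RN N → ℝ) := ⟨ψ.contDiff, ψ.hasCompactSupport⟩
  let c : ℕ → ℝ := fun k => ((k : ℝ) + 1)⁻¹
  have hc : ∀ k, 0 < c k := fun k => by positivity
  have hc0 : Tendsto c atTop (𝓝 0) := by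
    simpa [c] using tendsto_one_div_add_atTop_nhds_zero_nat (𝕜 := ℝ)
  let η : ℕ → RN N → ℝ := fun k x => ψ (c k • x)
  have hη : ∀ k, TestFun (η k) := fun k => by
    refine ⟨hψ.1.comp (contDiff_const_smul _), ?_⟩
    exact hψ.2.comp_smul (hc k).ne'
  have hgrad : ∀ k x, gradient (η k) x = c k • gradient ψ (c k • x) := by
    intro k x
    have hd : HasFDerivAt (η k) ((fderiv ℝ ψ (c k • x)).comp
        (c k • ContinuousLinearMap.id ℝ (RN N))) x :=
      (hψ.differentiable _).hasFDerivAt.comp x ((hasFDerivAt_id x).const_smul (c k))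
    refine ext_inner_right ℝ fun v => ?_
    rw [inner_gradient, hd.fderiv, real_inner_smul_left, inner_gradient]
    simp
  obtain ⟨L, hL⟩ := hψ.hasCompactSupport_gradient.exists_bound_of_continuous
    hψ.continuous_gradient
  refine ⟨η, hη, fun k x => ψ.nonneg, fun k x => ψ.le_one, fun x => ?_, fun u hu hut => ?_⟩
  · have h1 : Tendsto (fun k => c k • x) atTop (𝓝 0) := by simpa using hc0.smul_const x
    have h2 := (hψ.continuous.tendsto 0).comp h1
    rwa [ψ.one_of_mem_closedBall (by simp [ψ])] at h2
  -- The L^N norm of the gradient is invariant under dilation: the factor c^N from the chain rule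
  -- cancels the Jacobian.
  · have hM : ∀ k, ∫⁻ x, ‖gradient (η k) x‖ₑ ^ (N : ℝ) = ∫⁻ x, ‖gradient ψ x‖ₑ ^ (N : ℝ) := by
      intro k
      have h1 : ∫⁻ x, ‖gradient ψ x‖ₑ ^ (N : ℝ) ∂(Measure.map (fun x : RN N => c k • x) volume) =
          ∫⁻ x, ‖gradient ψ (c k • x)‖ₑ ^ (N : ℝ) :=
        lintegral_map (hψ.continuous_gradient.measurable.enorm.pow_const _)
          (measurable_const_smul _)
      have h2 := Measure.map_addHaar_smul (volume : Measure (RN N)) (hc k).ne'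
      simp only [finrank_euclideanSpace, Fintype.card_fin] at h2
      have h3 : Measure.map (fun x : RN N => c k • x) volume =
          Measure.map (c k • ·) (volume : Measure (RN N)) := rfl
      rw [h3, h2, lintegral_smul_measure] at h1
      have hcN : ‖c k‖ₑ ^ (N : ℝ) = ENNReal.ofReal (c k ^ N) := by
        rw [Real.enorm_of_nonneg (hc k).le, ENNReal.rpow_natCast, ENNReal.ofReal_pow (hc k).le]
      simp only [hgrad, enorm_smul, ENNReal.mul_rpow_of_nonneg _ _ hN0.le]
      rw [lintegral_const_mul' _ _ (ENNReal.rpow_ne_top_of_nonneg hN0.le (by simp)), ← h1, hcN,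
        smul_eq_mul, ← mul_assoc, ← ENNReal.ofReal_mul (by have := hc k; positivity),
        abs_of_pos (by have := hc k; positivity),
        mul_inv_cancel₀ (by have := hc k; positivity), ENNReal.ofReal_one, one_mul]
    have hMtop : ∫⁻ x, ‖gradient ψ x‖ₑ ^ (N : ℝ) ≠ ⊤ :=
      (lintegral_enorm_rpow_lt_top_of_hasCompactSupport hψ.continuous_gradient
        hψ.hasCompactSupport_gradient hN0).ne
    -- Here ‖∇η_k‖ is bounded in L^N and the weight is |u|^p. The weight needs exponent N/(N-p), and
    -- p · N/(N-p) = p^*.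
    refine tendsto_lintegral_zero_of_le hp0 hpN (w := fun x => ‖u x‖ₑ ^ p)
      (h := fun k x => ‖gradient (η k) x‖ₑ) (hu.enorm.pow_const _)
      (fun k => ((hη k).continuous_gradient.aestronglyMeasurable.enorm.pow_const _).mul
        (hu.enorm.pow_const _)) ?_ hMtop (fun k => (hM k).le)
      (fun k => Eventually.of_forall fun x => (mul_comm _ _).le) ?_
    · have e : p * (N / (N - p)) = pStar N p := by unfold pStar; ring
      simpa only [← ENNReal.rpow_mul, e] using hut
    · filter_upwards with x
      have h1 : Tendsto (fun k => ‖gradient (η k) x‖ₑ ^ p) atTop (𝓝 0) := by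
        rw [enorm_rpow_tendsto_zero_iff hp0]
        have h2 : Tendsto (fun k => c k * L) atTop (𝓝 0) := by simpa using hc0.mul_const L
        refine squeeze_zero (fun k => norm_nonneg _) (fun k => ?_) h2
        rw [hgrad, norm_smul, Real.norm_of_nonneg (hc k).le]
        exact mul_le_mul_of_nonneg_left (hL _) (hc k).le
      have := ENNReal.Tendsto.mul_const (b := ‖u x‖ₑ ^ p) h1
        (Or.inr (ENNReal.rpow_ne_top_of_nonneg hp0.le (by simp)))
      simpa using this

end NodalNehari

/-! ### The form: coercivity, behaviour at infinity, weak lower semicontinuity -/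

namespace NodalNehari

variable {N : ℕ} {p lam : ℝ} {A : RN N → ℝ}

/-! ### The form `∫ |∇u|^p - λ A |u|^p` -/

/-- The form `∫ ‖V‖^p - λ A |u|^p`. -/
noncomputable def lamForm (p lam : ℝ) (A : RN N → ℝ) (u : RN N → ℝ) (V : RN N → RN N) : ℝ :=
  ∫ x, (‖V x‖ ^ p - lam * A x * |u x| ^ p)

lemma integrable_weight_rpow {E : Type*} [NormedAddCommGroup E] (hp : 0 ≤ p) {w : RN N → ℝ}
    (hw : AEMeasurable w volume) (hw0 : ∀ᵐ x, 0 ≤ w x) {f : RN N → E}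
    (hf : AEStronglyMeasurable f volume)
    (hfin : ∫⁻ x, ENNReal.ofReal (w x) * ‖f x‖ₑ ^ p < ⊤) :
    Integrable (fun x => w x * ‖f x‖ ^ p) ∧
      ∫ x, w x * ‖f x‖ ^ p = (∫⁻ x, ENNReal.ofReal (w x) * ‖f x‖ₑ ^ p).toReal := by
  have hm : AEStronglyMeasurable (fun x => w x * ‖f x‖ ^ p) volume :=
    (hw.mul (hf.norm.aemeasurable.pow_const _)).aestronglyMeasurable
  have he : ∀ᵐ x, ENNReal.ofReal (w x * ‖f x‖ ^ p) = ENNReal.ofReal (w x) * ‖f x‖ₑ ^ p := by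
    filter_upwards [hw0] with x hx
    rw [ENNReal.ofReal_mul hx, ← ofReal_norm, ENNReal.ofReal_rpow_of_nonneg (norm_nonneg _) hp]
  have h0 : 0 ≤ᵐ[volume] fun x => w x * ‖f x‖ ^ p := by
    filter_upwards [hw0] with x hx
    positivity
  constructor
  · refine ⟨hm, ?_⟩
    rw [hasFiniteIntegral_iff_ofReal h0, lintegral_congr_ae he]
    exact hfin
  · rw [integral_eq_lintegral_of_nonneg_ae h0 hm, lintegral_congr_ae he]

lemma IsWA.integrable_weight_grad (hp : 1 ≤ p) (hA : MemLp A ⊤ volume) {u : RN N → ℝ}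
    {V : RN N → RN N} (h : IsWA p A u V) {w : RN N → ℝ} (hw : AEMeasurable w volume)
    (hw0 : ∀ x, 0 ≤ w x) (hw1 : ∀ x, w x ≤ 1) :
    Integrable (fun x => w x * ‖V x‖ ^ p) ∧
      ∫ x, w x * ‖V x‖ ^ p = (∫⁻ x, ENNReal.ofReal (w x) * ‖V x‖ₑ ^ p).toReal ∧
      ∫⁻ x, ENNReal.ofReal (w x) * ‖V x‖ₑ ^ p < ⊤ := by
  have hfin : ∫⁻ x, ENNReal.ofReal (w x) * ‖V x‖ₑ ^ p < ⊤ := by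
    refine lt_of_le_of_lt (lintegral_mono fun x => ?_) (h.lintegral_grad_lt_top hp hA)
    exact mul_le_of_le_one_left zero_le (ENNReal.ofReal_le_one.2 (hw1 x))
  obtain ⟨h1, h2⟩ := integrable_weight_rpow (p := p) (by linarith) hw
    (Eventually.of_forall hw0) h.aesmGrad hfin
  exact ⟨h1, h2, hfin⟩

lemma IsWA.integrable_grad (hp : 1 ≤ p) (hA : MemLp A ⊤ volume) {u : RN N → ℝ}
    {V : RN N → RN N} (h : IsWA p A u V) : Integrable (fun x => ‖V x‖ ^ p) := by
  simpa using (h.integrable_weight_grad hp hA (w := fun _ => 1) aemeasurable_const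
    (fun _ => zero_le_one) (fun _ => le_rfl)).1

lemma IsWA.integral_grad (hp : 1 ≤ p) (hA : MemLp A ⊤ volume) {u : RN N → ℝ}
    {V : RN N → RN N} (h : IsWA p A u V) :
    ∫ x, ‖V x‖ ^ p = (∫⁻ x, ‖V x‖ₑ ^ p).toReal := by
  simpa using (h.integrable_weight_grad hp hA (w := fun _ => 1) aemeasurable_const
    (fun _ => zero_le_one) (fun _ => le_rfl)).2.1

lemma IsWA.integrable_weight (hp : 1 ≤ p) (hA : MemLp A ⊤ volume) (hpos : ∀ᵐ x, 0 < A x)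
    {u : RN N → ℝ} {V : RN N → RN N} (h : IsWA p A u V) :
    Integrable (fun x => A x * |u x| ^ p) ∧
      ∫ x, A x * |u x| ^ p = (∫⁻ x, ENNReal.ofReal (A x) * ‖u x‖ₑ ^ p).toReal := by
  simpa only [Real.norm_eq_abs] using integrable_weight_rpow (p := p) (by linarith)
    hA.1.aemeasurable (hpos.mono fun _ => le_of_lt) h.aesm
    ((lintegral_weight_le_energy _ _).trans_lt (h.energy_lt_top hp hA))

lemma IsWA.lamForm_eq (hp : 1 ≤ p) (hA : MemLp A ⊤ volume) (hpos : ∀ᵐ x, 0 < A x)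
    {u : RN N → ℝ} {V : RN N → RN N} (h : IsWA p A u V) :
    lamForm p lam A u V = (∫ x, ‖V x‖ ^ p) - lam * ∫ x, A x * |u x| ^ p := by
  unfold lamForm
  simp only [mul_assoc]
  rw [integral_sub (h.integrable_grad hp hA) ((h.integrable_weight hp hA hpos).1.const_mul lam),
    integral_const_mul]

lemma IsWA.toReal_energy (hp : 1 ≤ p) (hA : MemLp A ⊤ volume) (hpos : ∀ᵐ x, 0 < A x)
    {u : RN N → ℝ} {V : RN N → RN N} (h : IsWA p A u V) :
    (energy p A u V).toReal = (∫ x, ‖V x‖ ^ p) + ∫ x, A x * |u x| ^ p := by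
  rw [energy_eq_add h.aesmGrad, ENNReal.toReal_add (h.lintegral_grad_lt_top hp hA).ne
    ((lintegral_weight_le_energy _ _).trans_lt (h.energy_lt_top hp hA)).ne,
    h.integral_grad hp hA, (h.integrable_weight hp hA hpos).2]

lemma lamForm_congr {u u' : RN N → ℝ} {V V' : RN N → RN N} (h : u =ᵐ[volume] u')
    (h' : V =ᵐ[volume] V') : lamForm p lam A u V = lamForm p lam A u' V' :=
  integral_congr_ae (by filter_upwards [h, h'] with x hx hx'; rw [hx, hx'])

lemma lamForm_smul (c : ℝ) (u : RN N → ℝ) (V : RN N → RN N) :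
    lamForm p lam A (c • u) (c • V) = |c| ^ p * lamForm p lam A u V := by
  unfold lamForm
  rw [← integral_const_mul]
  congr 1
  ext x
  simp only [Pi.smul_apply, smul_eq_mul, norm_smul, abs_mul, Real.norm_eq_abs,
    Real.mul_rpow (abs_nonneg _) (abs_nonneg _), Real.mul_rpow (abs_nonneg c) (norm_nonneg _)]
  ring

lemma IsWA.lamA_mul_le (hp : 1 < p) (hpN : p < N) (hA : MemLp A ⊤ volume)
    (hpos : ∀ᵐ x, 0 < A x) {u : RN N → ℝ} {V : RN N → RN N} (h : IsWA p A u V) :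
    lamA p A * ∫ x, A x * |u x| ^ p ≤ ∫ x, ‖V x‖ ^ p := by
  have hp0 : 0 < p := by linarith
  have hQ0 : 0 ≤ᵐ[volume] fun x => A x * |u x| ^ p := by
    filter_upwards [hpos] with x hx
    positivity
  have hP : 0 ≤ ∫ x, ‖V x‖ ^ p := integral_nonneg fun x => by positivity
  rcases eq_or_lt_of_le (integral_nonneg_of_ae hQ0) with h0 | h0
  · rw [← h0, mul_zero]; exact hP
  · rw [← le_div_iff₀ h0]
    let v : RN N →ₘ[volume] ℝ := AEEqFun.mk u h.aesm
    have hv : v =ᵐ[volume] u := AEEqFun.coeFn_mk u h.aesm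
    have hW : IsWA p A v V := h.congr hv.symm EventuallyEq.rfl
    refine csInf_le ⟨0, ?_⟩ ⟨v, ⟨mem_WA_of_isWA hp hpN hA hpos h hv, fun hv0 => ?_⟩, ?_⟩
    · rintro _ ⟨u, -, rfl⟩
      refine div_nonneg (integral_nonneg fun x => by positivity) (integral_nonneg_of_ae ?_)
      filter_upwards [hpos] with x hx
      positivity
    · refine h0.ne' (integral_eq_zero_of_ae ?_)
      have h1 : (v : RN N → ℝ) =ᵐ[volume] 0 := by rw [hv0]; exact AEEqFun.coeFn_zero
      filter_upwards [hv, h1] with x hx hx1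
      have : u x = 0 := by rw [← hx, hx1]; rfl
      simp [this, hp0.ne']
    · simp only
      congr 1
      · refine integral_congr_ae ?_
        filter_upwards [hW.weakGrad_ae_eq hp hpN hA hpos] with x hx
        rw [hx]
      · refine integral_congr_ae ?_
        filter_upwards [hv] with x hx
        rw [hx]

/-- Coercivity of the form. -/
lemma exists_coercive (hp : 1 < p) (hpN : p < N) (hA : MemLp A ⊤ volume)
    (hpos : ∀ᵐ x, 0 < A x) (hlam : lam < lamA p A) : ∃ c : ℝ, 0 < c ∧
    ∀ (u : RN N → ℝ) (V : RN N → RN N), IsWA p A u V →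
      c * (energy p A u V).toReal ≤ lamForm p lam A u V := by
  have hQ0 : ∀ u : RN N → ℝ, 0 ≤ ∫ x, A x * |u x| ^ p := fun u => by
    refine integral_nonneg_of_ae ?_
    filter_upwards [hpos] with x hx
    positivity
  have hP0 : ∀ V : RN N → RN N, 0 ≤ ∫ x, ‖V x‖ ^ p := fun V =>
    integral_nonneg fun x => by positivity
  rcases lt_or_ge lam 0 with hneg | hnn
  · refine ⟨min 1 (-lam), lt_min one_pos (by linarith), fun u V h => ?_⟩
    rw [h.toReal_energy hp.le hA hpos, h.lamForm_eq hp.le hA hpos]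
    nlinarith [mul_le_mul_of_nonneg_right (min_le_left 1 (-lam)) (hP0 V),
      mul_le_mul_of_nonneg_right (min_le_right 1 (-lam)) (hQ0 u)]
  · have hΛ : 0 < lamA p A := by linarith
    set Λ := lamA p A
    -- Write P and Q for the gradient and weight integrals. From ΛQ ≤ P, the form is at least (1 -
    -- λ/Λ)P, and P ≥ P/2 + ΛQ/2 recovers the full energy.
    refine ⟨(1 - lam / Λ) * min (1 / 2) (Λ / 2), ?_, fun u V h => ?_⟩
    · have : lam / Λ < 1 := by rw [div_lt_one hΛ]; exact hlam
      have : 0 < min (1 / 2) (Λ / 2) := lt_min (by norm_num) (by linarith)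
      nlinarith
    · rw [h.toReal_energy hp.le hA hpos, h.lamForm_eq hp.le hA hpos]
      have h1 := h.lamA_mul_le hp hpN hA hpos
      set P := ∫ x, ‖V x‖ ^ p
      set Q := ∫ x, A x * |u x| ^ p
      have hP : 0 ≤ P := hP0 V
      have hQ : 0 ≤ Q := hQ0 u
      have h2 : min (1 / 2) (Λ / 2) * (P + Q) ≤ P := by
        have a1 := mul_le_mul_of_nonneg_right (min_le_left (1 / 2) (Λ / 2)) hP
        have a2 := mul_le_mul_of_nonneg_right (min_le_right (1 / 2) (Λ / 2)) hQ
        nlinarith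
      have h3 : 0 ≤ 1 - lam / Λ := by
        rw [sub_nonneg, div_le_one hΛ]; exact hlam.le
      have h4 : lam * Q ≤ lam / Λ * P := by
        rw [div_mul_eq_mul_div, le_div_iff₀ hΛ]
        nlinarith
      have h5 := mul_le_mul_of_nonneg_left h2 h3
      calc _ = (1 - lam / Λ) * (min (1 / 2) (Λ / 2) * (P + Q)) := by ring
        _ ≤ (1 - lam / Λ) * P := h5
        _ ≤ _ := by linarith

/-! ### Lower semicontinuity -/

/-- Weighted gradient integrals are lower semicontinuous. -/
lemma eventually_lintegral_grad_le (hp : 1 < p) (hpN : p < N) (hA : MemLp A ⊤ volume)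
    (hpos : ∀ᵐ x, 0 < A x) {u : ℕ → RN N → ℝ} {V : ℕ → RN N → RN N}
    (h : ∀ n, IsWA p A (u n) (V n)) {C : ℝ≥0∞} (hC : C ≠ ⊤)
    (hb : ∀ n, energy p A (u n) (V n) ≤ C) {u' : RN N → ℝ} {V' : RN N → RN N}
    (hae : ∀ᵐ x, Tendsto (fun n => u n x) atTop (𝓝 (u' x))) (h' : IsWA p A u' V')
    {w : RN N → ℝ≥0∞} (hw : AEMeasurable w volume) (hfin : ∫⁻ x, w x * ‖V' x‖ₑ ^ p ≠ ⊤)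
    {ε : ℝ≥0∞} (hε : ε ≠ 0) :
    ∀ᶠ n in atTop, ∫⁻ x, w x * ‖V' x‖ₑ ^ p ≤ (∫⁻ x, w x * ‖V n x‖ₑ ^ p) + ε := by
  -- Otherwise a subsequence has weighted integrals at most I - ε. Its a.e. limit has a gradient
  -- satisfying the same bound, which equals V' by uniqueness; this contradicts I - ε < I.
  by_contra hcon
  rw [not_eventually] at hcon
  obtain ⟨ns, hns, hlt⟩ := extraction_of_frequently_atTop hcon
  obtain ⟨V'', hV'', hle⟩ := exists_grad_of_tendsto_ae hp hA (fun n => h (ns n)) hC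
    (fun n => hb _) (hae.mono fun x hx => hx.comp hns.tendsto_atTop)
  have heq := h'.ae_unique hp hpN hA hpos hV'' EventuallyEq.rfl
  set I := ∫⁻ x, w x * ‖V' x‖ₑ ^ p with hI
  have hI2 : ∫⁻ x, w x * ‖V'' x‖ₑ ^ p = I :=
    lintegral_congr_ae (heq.mono fun x hx => by simp only [hx])
  have hεI : ε < I := by
    have := hlt 0
    rw [not_le] at this
    exact le_add_self.trans_lt this
  have hεt : ε ≠ ⊤ := (hεI.trans hfin.lt_top).ne
  have h1 := hle w hw (I - ε) fun n => by
    have := hlt n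
    rw [not_le] at this
    exact ENNReal.le_sub_of_add_le_right hεt this.le
  rw [hI2] at h1
  exact absurd h1 (not_le.2 (ENNReal.sub_lt_self hfin (hεI.ne_bot) hε))

lemma isSubcritical_weight {r t : ℝ} (hr : 0 < r) (hrt : r < t) {B : RN N → ℝ}
    (hB : AEMeasurable B volume) (hB0 : ∀ᵐ x, 0 ≤ B x)
    (hint : ∫⁻ x, ENNReal.ofReal (B x) ^ (t / (t - r)) < ⊤) :
    IsSubcritical r t (fun x s => B x * |s| ^ r) B where
  pos := hr
  lt := hrt
  aem := hB
  int := hint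
  cont := Eventually.of_forall fun x =>
    continuous_const.mul ((Real.continuous_rpow_const hr.le).comp continuous_abs)
  bound := hB0.mono fun x hx s => by
    rw [abs_of_nonneg (by positivity)]
  meas := fun v hv => by
    exact (hB.mul (hv.norm.aemeasurable.pow_const _)).aestronglyMeasurable

lemma exists_lpStar_bound (hp : 1 < p) (hpN : p < N) (hA : MemLp A ⊤ volume)
    (hpos : ∀ᵐ x, 0 < A x) {C : ℝ≥0∞} (hC : C ≠ ⊤) : ∃ M : ℝ≥0∞, M ≠ ⊤ ∧
    ∀ (u : RN N → ℝ) (V : RN N → RN N), IsWA p A u V → energy p A u V ≤ C →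
      ∫⁻ x, ‖u x‖ₑ ^ pStar N p ≤ M := by
  obtain ⟨S, hS, hsob⟩ := exists_sobolev hp hpN hA.1.aemeasurable hpos
  have hr : 0 ≤ pStar N p / p := div_nonneg (pStar_pos hp hpN).le (by linarith)
  refine ⟨S * C ^ (pStar N p / p), ENNReal.mul_ne_top hS (ENNReal.rpow_ne_top_of_nonneg hr hC),
    fun u V h hle => (hsob u V h).trans ?_⟩
  gcongr
  exact (lintegral_grad_le_energy _ _).trans hle

/-- The form is bounded from below near infinity. -/
lemma exists_tail_bound (hp : 1 < p) (hpN : p < N) (hA : MemLp A ⊤ volume)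
    (hpos : ∀ᵐ x, 0 < A x) (hlam : lam < lamA p A) : ∃ c : ℝ, 0 ≤ c ∧
    ∀ (u : RN N → ℝ) (V : RN N → RN N), IsWA p A u V → ∀ η : RN N → ℝ, TestFun η →
      (∀ x, 0 ≤ η x) → (∀ x, η x ≤ 1) →
      Integrable (fun x => ‖gradient η x‖ ^ p * |u x| ^ p) →
      lam * ∫ x, (1 - η x) ^ p * (A x * |u x| ^ p) ≤
        (∫ x, (1 - η x) ^ p * ‖V x‖ ^ p) + c * ∫ x, ‖gradient η x‖ ^ p * |u x| ^ p := by
  have hp0 : 0 < p := by linarith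
  rcases le_or_gt lam 0 with hneg | hlpos
  · refine ⟨0, le_rfl, fun u V h η hη h0 h1 _ => ?_⟩
    have a1 : 0 ≤ ∫ x, (1 - η x) ^ p * (A x * |u x| ^ p) := by
      refine integral_nonneg_of_ae ?_
      filter_upwards [hpos] with x hx
      have := h1 x
      have : 0 ≤ 1 - η x := by linarith
      positivity
    have a2 : 0 ≤ ∫ x, (1 - η x) ^ p * ‖V x‖ ^ p := integral_nonneg fun x => by
      have := h1 x
      have : 0 ≤ 1 - η x := by linarith
      positivity
    nlinarith
  · set Λ := lamA p A
    -- The inequality for `lamA` will be applied to (1 - η)u. The gap λ < Λ allows s slightly below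
    -- 1 with λ ≤ Λ s^(p-1), which pays for separating (1 - η)V from u∇η.
    obtain ⟨s, hs0, hs1, hsΛ⟩ : ∃ s : ℝ, 0 < s ∧ s < 1 ∧ lam ≤ Λ * s ^ (p - 1) := by
      have hc : Tendsto (fun s : ℝ => Λ * s ^ (p - 1)) (𝓝[<] 1) (𝓝 (Λ * 1 ^ (p - 1))) :=
        (((Real.continuous_rpow_const (by linarith)).tendsto 1).const_mul Λ).mono_left
          nhdsWithin_le_nhds
      rw [Real.one_rpow, mul_one] at hc
      have h1 := hc.eventually (lt_mem_nhds hlam)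
      have h2 : ∀ᶠ s : ℝ in 𝓝[<] 1, s ∈ Ioo 0 1 := Ioo_mem_nhdsLT one_pos
      obtain ⟨s, hs, hs'⟩ := (h1.and h2).exists
      exact ⟨s, hs'.1, hs'.2, hs.le⟩
    have h1s : 0 < 1 - s := by linarith
    refine ⟨s ^ (p - 1) * (1 - s) ^ (1 - p), by positivity, fun u V h η hη h0 h1 hint => ?_⟩
    have hW := h.sub hp.le hA.1.aemeasurable (h.mul_testFun hp hpN hA hpos hη)
    have key := hW.lamA_mul_le hp hpN hA hpos
    have hχ : ∀ x, 0 ≤ 1 - η x := fun x => by linarith [h1 x]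
    have hχm : AEMeasurable (fun x => (1 - η x) ^ p) volume :=
      ((continuous_const.sub hη.continuous).measurable.pow_const _).aemeasurable
    obtain ⟨hgi, -, -⟩ := h.integrable_weight_grad hp.le hA (w := fun x => (1 - η x) ^ p) hχm
      (fun x => by have := hχ x; positivity)
      (fun x => Real.rpow_le_one (hχ x) (by linarith [h0 x]) hp0.le)
    have e1 : ∀ x, A x * |(u - fun x => η x * u x) x| ^ p = (1 - η x) ^ p * (A x * |u x| ^ p) := by
      intro x
      have : (u - fun x => η x * u x) x = (1 - η x) * u x := by simp only [Pi.sub_apply]; ring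
      rw [this, abs_mul, abs_of_nonneg (hχ x), Real.mul_rpow (hχ x) (abs_nonneg _)]
      ring
    simp only [e1] at key
    -- Convexity of the p-th power at a + b = s(a/s) + (1 - s)(b/(1 - s)). Multiplication by s^(p-1)
    -- later normalises the first coefficient to 1.
    have hyoung : ∀ a b : ℝ, 0 ≤ a → 0 ≤ b →
        (a + b) ^ p ≤ s ^ (1 - p) * a ^ p + (1 - s) ^ (1 - p) * b ^ p := by
      intro a b ha hb
      have := (convexOn_rpow hp.le).2 (x := a / s) (y := b / (1 - s))
        (mem_Ici.2 (by positivity)) (mem_Ici.2 (by positivity)) hs0.le h1s.le (by ring)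
      simp only [smul_eq_mul] at this
      rw [mul_div_cancel₀ _ hs0.ne', mul_div_cancel₀ _ h1s.ne', Real.div_rpow ha hs0.le,
        Real.div_rpow hb h1s.le] at this
      refine this.trans (le_of_eq ?_)
      rw [Real.rpow_sub hs0, Real.rpow_sub h1s, Real.rpow_one, Real.rpow_one]
      ring
    have hpt : ∀ x, ‖(V - fun x => η x • V x + u x • gradient η x) x‖ ^ p ≤
        s ^ (1 - p) * ((1 - η x) ^ p * ‖V x‖ ^ p) +
          (1 - s) ^ (1 - p) * (‖gradient η x‖ ^ p * |u x| ^ p) := by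
      intro x
      have e2 : (V - fun x => η x • V x + u x • gradient η x) x =
          (1 - η x) • V x - u x • gradient η x := by
        simp only [Pi.sub_apply, sub_smul, one_smul]; abel
      rw [e2]
      refine (Real.rpow_le_rpow (norm_nonneg _) (norm_sub_le _ _) hp0.le).trans ?_
      refine (hyoung _ _ (norm_nonneg _) (norm_nonneg _)).trans (le_of_eq ?_)
      rw [norm_smul, norm_smul, Real.norm_of_nonneg (hχ x), Real.norm_eq_abs,
        Real.mul_rpow (hχ x) (norm_nonneg _), Real.mul_rpow (abs_nonneg _) (norm_nonneg _)]
      ring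
    have hle := integral_mono (hW.integrable_grad hp.le hA)
      ((hgi.const_mul (s ^ (1 - p))).add (hint.const_mul ((1 - s) ^ (1 - p)))) hpt
    simp only [Pi.add_apply] at hle
    rw [integral_add (hgi.const_mul _) (hint.const_mul _), integral_const_mul,
      integral_const_mul] at hle
    have hQ : 0 ≤ ∫ x, (1 - η x) ^ p * (A x * |u x| ^ p) := by
      refine integral_nonneg_of_ae ?_
      filter_upwards [hpos] with x hx
      have := hχ x
      positivity
    have hsp : s ^ (p - 1) * s ^ (1 - p) = 1 := by
      rw [← Real.rpow_add hs0]; simp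
    have hfin := mul_le_mul_of_nonneg_left (key.trans hle) (by positivity : 0 ≤ s ^ (p - 1))
    calc lam * ∫ x, (1 - η x) ^ p * (A x * |u x| ^ p)
        ≤ Λ * s ^ (p - 1) * ∫ x, (1 - η x) ^ p * (A x * |u x| ^ p) := by gcongr
      _ = s ^ (p - 1) * (Λ * ∫ x, (1 - η x) ^ p * (A x * |u x| ^ p)) := by ring
      _ ≤ _ := hfin
      _ = (s ^ (p - 1) * s ^ (1 - p)) * (∫ x, (1 - η x) ^ p * ‖V x‖ ^ p) +
          s ^ (p - 1) * (1 - s) ^ (1 - p) * ∫ x, ‖gradient η x‖ ^ p * |u x| ^ p := by ring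
      _ = _ := by rw [hsp, one_mul]

end NodalNehari

namespace NodalNehari

variable {N : ℕ} {p lam : ℝ} {A : RN N → ℝ}

/-- The form is sequentially weakly lower semicontinuous. -/
theorem eventually_lamForm_le (hp : 1 < p) (hpN : p < N) (hA : MemLp A ⊤ volume)
    (hpos : ∀ᵐ x, 0 < A x) (hlam : lam < lamA p A) {u : ℕ → RN N → ℝ} {V : ℕ → RN N → RN N}
    (h : ∀ n, IsWA p A (u n) (V n)) {C : ℝ≥0∞} (hC : C ≠ ⊤)
    (hb : ∀ n, energy p A (u n) (V n) ≤ C) {u' : RN N → ℝ} {V' : RN N → RN N}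
    (hae : ∀ᵐ x, Tendsto (fun n => u n x) atTop (𝓝 (u' x))) (h' : IsWA p A u' V')
    {ε : ℝ} (hε : 0 < ε) :
    ∀ᶠ n in atTop, lamForm p lam A u' V' ≤ lamForm p lam A (u n) (V n) + ε := by
  have hp0 : 0 < p := by linarith
  have hs := pStar_pos hp hpN
  have hps := lt_pStar hp hpN
  have hAm := hA.1.aemeasurable
  obtain ⟨M, hM, hMb⟩ := exists_lpStar_bound hp hpN hA hpos hC
  obtain ⟨c, hc0, htail⟩ := exists_tail_bound hp hpN hA hpos hlam
  obtain ⟨η, hη, hη0, hη1, hηlim, hηgrad⟩ := exists_cutoff (N := N) hp hpN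
  have hχ : ∀ k x, 0 ≤ 1 - η k x := fun k x => by linarith [hη1 k x]
  -- The complementary weight is the p-th power (1 - η)^p, exactly the one in `exists_tail_bound`.
  -- As ζ has compact support, the weighted term ζA|u|^p is subcritical and passes to the limit,
  -- even though A|u|^p on the whole space may not.
  let ζ : ℕ → RN N → ℝ := fun k x => 1 - (1 - η k x) ^ p
  have hζ0 : ∀ k x, 0 ≤ ζ k x := fun k x =>
    sub_nonneg.2 (Real.rpow_le_one (hχ k x) (by linarith [hη0 k x]) hp0.le)
  have hζ1 : ∀ k x, ζ k x ≤ 1 := fun k x => by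
    have := Real.rpow_nonneg (hχ k x) p
    simp only [ζ]; linarith
  have hχm : ∀ k, AEMeasurable (fun x => (1 - η k x) ^ p) volume := fun k =>
    ((continuous_const.sub (hη k).continuous).measurable.pow_const _).aemeasurable
  have hζm : ∀ k, AEMeasurable (ζ k) volume := fun k => aemeasurable_const.sub (hχm k)
  have hζlim : ∀ x, Tendsto (fun k => ζ k x) atTop (𝓝 1) := fun x => by
    have h1 : Tendsto (fun k => 1 - η k x) atTop (𝓝 0) := by
      simpa using (hηlim x).const_sub 1
    have h2 := ((Real.continuous_rpow_const hp0.le).tendsto 0).comp h1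
    rw [Real.zero_rpow hp0.ne'] at h2
    simpa using h2.const_sub 1
  -- the two weights giving compact terms
  have he : 0 < pStar N p / (pStar N p - p) := div_pos hs (by linarith)
  have hsubζ : ∀ k, IsSubcritical p (pStar N p) (fun x s => (ζ k x * A x) * |s| ^ p)
      (fun x => ζ k x * A x) := fun k => by
    refine isSubcritical_weight hp0 hps ((hζm k).mul hAm)
      (hpos.mono fun x hx => mul_nonneg (hζ0 k x) hx.le) ?_
    calc ∫⁻ x, ENNReal.ofReal (ζ k x * A x) ^ (pStar N p / (pStar N p - p))
        ≤ ∫⁻ x, (tsupport (η k)).indicator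
            (fun _ => eLpNorm A ⊤ volume ^ (pStar N p / (pStar N p - p))) x := by
          refine lintegral_mono_ae ?_
          filter_upwards [ae_le_eLpNormEssSup (f := A) (μ := volume), hpos] with x hx hx0
          by_cases hxt : x ∈ tsupport (η k)
          · rw [indicator_of_mem hxt, eLpNorm_exponent_top]
            gcongr
            refine le_trans ?_ hx
            rw [← ofReal_norm]
            refine ENNReal.ofReal_le_ofReal (le_trans ?_ (Real.le_norm_self _))
            exact mul_le_of_le_one_left hx0.le (hζ1 k x)
          · have : ζ k x = 0 := by simp [ζ, image_eq_zero_of_notMem_tsupport hxt]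
            simp [this, he]
      _ = eLpNorm A ⊤ volume ^ (pStar N p / (pStar N p - p)) * volume (tsupport (η k)) := by
          rw [lintegral_indicator (isClosed_tsupport _).measurableSet, setLIntegral_const]
      _ < ⊤ := ENNReal.mul_lt_top (ENNReal.rpow_lt_top_of_nonneg he.le hA.2.ne)
          (hη k).2.measure_lt_top
  have hsubg : ∀ k, IsSubcritical p (pStar N p) (fun x s => ‖gradient (η k) x‖ ^ p * |s| ^ p)
      (fun x => ‖gradient (η k) x‖ ^ p) := fun k => by
    refine isSubcritical_weight hp0 hps
      ((hη k).continuous_gradient.measurable.norm.pow_const _).aemeasurable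
      (Eventually.of_forall fun x => by positivity) ?_
    have := lintegral_rpow_rpow_lt_top (hη k).continuous_gradient
      (hη k).hasCompactSupport_gradient hp0 he
    refine lt_of_le_of_lt (le_of_eq (lintegral_congr fun x => ?_)) this
    rw [← ENNReal.ofReal_rpow_of_nonneg (norm_nonneg _) hp0.le, ofReal_norm]
  have hbd : ∀ n, ∫⁻ x, ‖u n x‖ₑ ^ pStar N p ≤ M := fun n => hMb _ _ (h n) (hb n)
  have hu'b := h'.lintegral_pStar_lt_top hp hpN hA hpos
  -- splitting the form
  have hsplit : ∀ k (u : RN N → ℝ) (V : RN N → RN N), IsWA p A u V →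
      lamForm p lam A u V = ((∫ x, ζ k x * ‖V x‖ ^ p) - lam * ∫ x, (ζ k x * A x) * |u x| ^ p) +
        ((∫ x, (1 - η k x) ^ p * ‖V x‖ ^ p) -
          lam * ∫ x, (1 - η k x) ^ p * (A x * |u x| ^ p)) := by
    intro k u V hW
    obtain ⟨i1, -, -⟩ := hW.integrable_weight_grad hp.le hA (hζm k) (hζ0 k) (hζ1 k)
    obtain ⟨i2, -, -⟩ := hW.integrable_weight_grad hp.le hA (hχm k)
      (fun x => Real.rpow_nonneg (hχ k x) p)
      (fun x => Real.rpow_le_one (hχ k x) (by linarith [hη0 k x]) hp0.le)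
    have i3 : Integrable (fun x => (ζ k x * A x) * |u x| ^ p) :=
      (hsubζ k).integrable hW.aesm (hW.lintegral_pStar_lt_top hp hpN hA hpos)
    have i5 := (hW.integrable_weight hp.le hA hpos).1
    have i4 : Integrable (fun x => (1 - η k x) ^ p * (A x * |u x| ^ p)) := by
      refine (i5.sub i3).congr (Eventually.of_forall fun x => ?_)
      simp only [Pi.sub_apply, ζ]; ring
    rw [hW.lamForm_eq hp.le hA hpos]
    have e1 : (∫ x, ζ k x * ‖V x‖ ^ p) + ∫ x, (1 - η k x) ^ p * ‖V x‖ ^ p = ∫ x, ‖V x‖ ^ p := by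
      rw [← integral_add i1 i2]
      refine integral_congr_ae (Eventually.of_forall fun x => ?_)
      simp only [ζ]; ring
    have e2 : (∫ x, (ζ k x * A x) * |u x| ^ p) + ∫ x, (1 - η k x) ^ p * (A x * |u x| ^ p) =
        ∫ x, A x * |u x| ^ p := by
      rw [← integral_add i3 i4]
      refine integral_congr_ae (Eventually.of_forall fun x => ?_)
      simp only [ζ]; ring
    rw [← e1, ← e2]; ring
  -- choice of the cutoff
  have hk1 : Tendsto (fun k => ∫ x, ζ k x * ‖V' x‖ ^ p) atTop (𝓝 (∫ x, ‖V' x‖ ^ p)) := by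
    refine tendsto_integral_of_dominated_convergence (fun x => ‖V' x‖ ^ p) (fun k => ?_)
      (h'.integrable_grad hp.le hA) (fun k => Eventually.of_forall fun x => ?_)
      (Eventually.of_forall fun x => ?_)
    · exact (h'.integrable_weight_grad hp.le hA (hζm k) (hζ0 k) (hζ1 k)).1.aestronglyMeasurable
    · rw [norm_mul, Real.norm_of_nonneg (hζ0 k x), Real.norm_of_nonneg (by positivity)]
      exact mul_le_of_le_one_left (by positivity) (hζ1 k x)
    · simpa using (hζlim x).mul_const (‖V' x‖ ^ p)
  have hk2 : Tendsto (fun k => ∫ x, (ζ k x * A x) * |u' x| ^ p) atTop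
      (𝓝 (∫ x, A x * |u' x| ^ p)) := by
    refine tendsto_integral_of_dominated_convergence (fun x => A x * |u' x| ^ p) (fun k => ?_)
      (h'.integrable_weight hp.le hA hpos).1 (fun k => ?_)
      (Eventually.of_forall fun x => ?_)
    · exact ((hsubζ k).integrable h'.aesm hu'b).aestronglyMeasurable
    · filter_upwards [hpos] with x hx
      rw [mul_assoc, norm_mul, Real.norm_of_nonneg (hζ0 k x), Real.norm_of_nonneg (by positivity)]
      exact mul_le_of_le_one_left (by positivity) (hζ1 k x)
    · simpa [mul_assoc] using (hζlim x).mul_const (A x * |u' x| ^ p)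
  have hk3 : Tendsto (fun k => ∫ x, ‖gradient (η k) x‖ ^ p * |u' x| ^ p) atTop (𝓝 0) := by
    have e : ∀ k, ∫ x, ‖gradient (η k) x‖ ^ p * |u' x| ^ p =
        (∫⁻ x, ‖gradient (η k) x‖ₑ ^ p * ‖u' x‖ₑ ^ p).toReal := fun k => by
      rw [integral_eq_lintegral_of_nonneg_ae (Eventually.of_forall fun x => by positivity)
        ((hsubg k).integrable h'.aesm hu'b).aestronglyMeasurable]
      congr 1
      refine lintegral_congr fun x => ?_
      rw [ENNReal.ofReal_mul (by positivity), ← ENNReal.ofReal_rpow_of_nonneg (norm_nonneg _) hp0.le,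
        ← ENNReal.ofReal_rpow_of_nonneg (abs_nonneg _) hp0.le, ofReal_norm, ← Real.norm_eq_abs,
        ofReal_norm]
    simp only [e]
    exact (ENNReal.tendsto_toReal ENNReal.zero_ne_top).comp (hηgrad u' h'.aesm hu'b)
  have hk : Tendsto (fun k => (∫ x, ζ k x * ‖V' x‖ ^ p) - lam * (∫ x, (ζ k x * A x) * |u' x| ^ p) -
      c * ∫ x, ‖gradient (η k) x‖ ^ p * |u' x| ^ p) atTop (𝓝 (lamForm p lam A u' V')) := by
    rw [h'.lamForm_eq hp.le hA hpos]
    simpa using (hk1.sub (hk2.const_mul lam)).sub (hk3.const_mul c)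
  -- The cutoff is fixed from the limit function alone and costs ε/2. The inner gradient term and
  -- the two compact terms then cost ε/4 each as n grows; the outer part of u_n is bounded below by
  -- the tail estimate.
  obtain ⟨k, hkε⟩ := (hk.eventually (lt_mem_nhds (sub_lt_self _ (half_pos hε)))).exists
  -- passing to the limit with a fixed cutoff
  have l1 : ∀ᶠ n in atTop, ∫ x, ζ k x * ‖V' x‖ ^ p ≤ (∫ x, ζ k x * ‖V n x‖ ^ p) + ε / 4 := by
    obtain ⟨-, e1, f1⟩ := h'.integrable_weight_grad hp.le hA (hζm k) (hζ0 k) (hζ1 k)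
    have hε4 : ENNReal.ofReal (ε / 4) ≠ 0 := by
      rw [Ne, ENNReal.ofReal_eq_zero, not_le]; positivity
    filter_upwards [eventually_lintegral_grad_le hp hpN hA hpos h hC hb hae h'
      (hζm k).ennreal_ofReal f1.ne hε4] with n hn
    obtain ⟨-, e2, f2⟩ := (h n).integrable_weight_grad hp.le hA (hζm k) (hζ0 k) (hζ1 k)
    rw [e1, e2]
    have := ENNReal.toReal_mono (ENNReal.add_ne_top.2 ⟨f2.ne, ENNReal.ofReal_ne_top⟩) hn
    rwa [ENNReal.toReal_add f2.ne ENNReal.ofReal_ne_top,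
      ENNReal.toReal_ofReal (by positivity)] at this
  have l2 := ((hsubζ k).tendsto_integral (fun n => (h n).aesm) hM hbd hae).const_mul lam
  have l3 := ((hsubg k).tendsto_integral (fun n => (h n).aesm) hM hbd hae).const_mul c
  have l4 := (l2.add l3).eventually (gt_mem_nhds (lt_add_of_pos_right _ (by positivity : 0 < ε / 4)))
  filter_upwards [l1, l4] with n hn1 hn4
  have hi : Integrable (fun x => ‖gradient (η k) x‖ ^ p * |u n x| ^ p) :=
    (hsubg k).integrable (h n).aesm ((hbd n).trans_lt hM.lt_top)
  have ht := htail _ _ (h n) (η k) (hη k) (hη0 k) (hη1 k) hi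
  rw [hsplit k _ _ (h n)]
  linarith

end NodalNehari

/-! ### The nonlinearity at a fixed point -/

namespace NodalNehari

/-! ### Pointwise properties of the nonlinearity -/

/-- The assumptions on `s ↦ g(x,s)` at a fixed point `x`. -/
structure NehariNonlinearity (p q b θ R : ℝ) (h : ℝ → ℝ) : Prop where
  one_lt : 1 < p
  lt : p < q
  bpos : 0 < b
  pθ : p < θ
  Rpos : 0 < R
  smooth : ContDiff ℝ 1 h
  deriv_le : ∀ s, s ≠ 0 → |deriv h s| ≤ b * |s| ^ (q - 2)
  superlinear : ∀ s, R ≤ |s| →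
    θ * (∫ t in (0 : ℝ)..s, h t) ≤ h s * s ∧ 0 < ∫ t in (0 : ℝ)..s, h t
  strictMono : StrictMonoOn (fun s : ℝ => h s / |s| ^ (p - 1)) {0}ᶜ

variable {p q b θ R : ℝ} {h : ℝ → ℝ}

namespace NehariNonlinearity

lemma lt_of_lt (H : NehariNonlinearity p q b θ R h) {s t : ℝ} (hs : s ≠ 0) (ht : t ≠ 0)
    (hst : s < t) : h s / |s| ^ (p - 1) < h t / |t| ^ (p - 1) :=
  H.strictMono hs ht hst

lemma continuous (H : NehariNonlinearity p q b θ R h) : Continuous h := H.smooth.continuous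

/-- The assumptions are invariant under `h ↦ -h(-·)`. -/
lemma reflect (H : NehariNonlinearity p q b θ R h) :
    NehariNonlinearity p q b θ R (fun s => -h (-s)) where
  one_lt := H.one_lt
  lt := H.lt
  bpos := H.bpos
  pθ := H.pθ
  Rpos := H.Rpos
  smooth := (H.smooth.comp contDiff_neg).neg
  deriv_le := fun s hs => by
    have : deriv (fun s => -h (-s)) s = deriv h (-s) := by
      rw [deriv.fun_neg, deriv_comp_neg, neg_neg]
    rw [this]
    simpa using H.deriv_le (-s) (neg_ne_zero.2 hs)
  superlinear := fun s hs => by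
    have e : ∫ t in (0 : ℝ)..s, -h (-t) = ∫ t in (0 : ℝ)..(-s), h t := by
      rw [intervalIntegral.integral_neg, intervalIntegral.integral_comp_neg, neg_zero,
        intervalIntegral.integral_symm, neg_neg]
    rw [e]
    have := H.superlinear (-s) (by simpa using hs)
    simpa using this
  strictMono := fun s hs t ht hst => by
    have := H.lt_of_lt (neg_ne_zero.2 ht) (neg_ne_zero.2 hs) (neg_lt_neg hst)
    simp only [abs_neg, neg_div] at this ⊢
    linarith

/-- Monotonicity of the quotient gives h(s) ≤ h(1) s^(p-1) on (0,1), and p > 1 makes the right side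
vanish at 0. Reflection supplies the other sign, so h(0) = 0. -/
lemma apply_zero_le (H : NehariNonlinearity p q b θ R h) : h 0 ≤ 0 := by
  have hp : 0 < p - 1 := by linarith [H.one_lt]
  have h1 : ∀ᶠ s in 𝓝[>] (0 : ℝ), h s ≤ h 1 * s ^ (p - 1) := by
    filter_upwards [Ioo_mem_nhdsGT one_pos] with s hs
    have := H.lt_of_lt hs.1.ne' one_ne_zero hs.2
    simp only [abs_of_pos hs.1, abs_one, Real.one_rpow, div_one] at this
    rw [div_lt_iff₀ (Real.rpow_pos_of_pos hs.1 _)] at this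
    exact this.le
  have l1 : Tendsto h (𝓝[>] 0) (𝓝 (h 0)) := (H.continuous.tendsto 0).mono_left nhdsWithin_le_nhds
  have l2 : Tendsto (fun s : ℝ => h 1 * s ^ (p - 1)) (𝓝[>] 0) (𝓝 0) := by
    have := ((Real.continuous_rpow_const hp.le).tendsto 0).const_mul (h 1)
    rw [Real.zero_rpow hp.ne', mul_zero] at this
    exact this.mono_left nhdsWithin_le_nhds
  exact le_of_tendsto_of_tendsto l1 l2 h1

lemma apply_zero (H : NehariNonlinearity p q b θ R h) : h 0 = 0 := by
  refine le_antisymm H.apply_zero_le ?_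
  simpa using H.reflect.apply_zero_le

/-- Subtracting the primitive of b s^(q-2) leaves a function with nonpositive derivative on (0,∞).
Only interior derivatives are used, so the singular bound for q < 2 is harmless. -/
lemma le_rpow_of_deriv_le {f : ℝ → ℝ} (hq : 1 < q) (hf : ContDiff ℝ 1 f)
    (h0 : f 0 = 0) (hd : ∀ s, 0 < s → deriv f s ≤ b * s ^ (q - 2)) {s : ℝ} (hs : 0 ≤ s) :
    f s ≤ b / (q - 1) * s ^ (q - 1) := by
  have hq1 : 0 < q - 1 := by linarith
  have hder : ∀ s, 0 < s → HasDerivAt (fun s => f s - b / (q - 1) * s ^ (q - 1))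
      (deriv f s - b * s ^ (q - 2)) s := fun s hs => by
    have h1 := (Real.hasDerivAt_rpow_const (x := s) (p := q - 1) (Or.inl hs.ne')).const_mul
      (b / (q - 1))
    refine ((hf.differentiable (by simp) s).hasDerivAt.sub h1).congr_deriv ?_
    rw [show q - 1 - 1 = q - 2 by ring]
    field_simp
  have hanti : AntitoneOn (fun s => f s - b / (q - 1) * s ^ (q - 1)) (Ici 0) := by
    refine antitoneOn_of_deriv_nonpos (convex_Ici 0) ?_ ?_ ?_
    · exact (hf.continuous.sub (continuous_const.mul
        (Real.continuous_rpow_const hq1.le))).continuousOn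
    · rw [interior_Ici]
      exact fun s hs => (hder s hs).differentiableAt.differentiableWithinAt
    · rw [interior_Ici]
      intro s hs
      rw [(hder s hs).deriv]
      linarith [hd s hs]
  have := hanti (mem_Ici.2 le_rfl) (mem_Ici.2 hs) hs
  simp only [h0, Real.zero_rpow hq1.ne', mul_zero, sub_zero] at this
  linarith

lemma abs_le_of_nonneg (H : NehariNonlinearity p q b θ R h) {s : ℝ} (hs : 0 ≤ s) :
    |h s| ≤ b / (q - 1) * s ^ (q - 1) := by
  have hq : 1 < q := H.one_lt.trans H.lt
  rw [abs_le']
  constructor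
  · refine le_rpow_of_deriv_le hq H.smooth H.apply_zero (fun s hs => ?_) hs
    have := H.deriv_le s hs.ne'
    rw [abs_of_pos hs] at this
    exact (le_abs_self _).trans this
  · refine le_rpow_of_deriv_le (f := fun s => -h s) hq H.smooth.neg (by simp [H.apply_zero])
      (fun s hs => ?_) hs
    have := H.deriv_le s hs.ne'
    rw [abs_of_pos hs] at this
    rw [deriv.fun_neg]
    exact (neg_le_abs _).trans this

lemma abs_le (H : NehariNonlinearity p q b θ R h) (s : ℝ) :
    |h s| ≤ b / (q - 1) * |s| ^ (q - 1) := by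
  rcases le_total 0 s with hs | hs
  · rw [abs_of_nonneg hs]; exact H.abs_le_of_nonneg hs
  · have := H.reflect.abs_le_of_nonneg (s := -s) (by linarith)
    rw [abs_of_nonpos hs]
    simpa using this

/-- The growth bound and q > p send h(r)/r^(p-1) to 0 as r → 0⁺. The quotient increases strictly;
passing through s/2 keeps the inequality strict after taking the limit. -/
lemma pos_of_pos (H : NehariNonlinearity p q b θ R h) {s : ℝ} (hs : 0 < s) : 0 < h s := by
  have hq : 1 < q := H.one_lt.trans H.lt
  have hqp : 0 < q - p := by linarith [H.lt]
  have hsp : ∀ r : ℝ, 0 < r → 0 < r ^ (p - 1) := fun r hr => Real.rpow_pos_of_pos hr _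
  have h1 : 0 ≤ h (s / 2) / (s / 2) ^ (p - 1) := by
    have l1 : Tendsto (fun r : ℝ => -(b / (q - 1) * r ^ (q - p))) (𝓝[>] 0) (𝓝 0) := by
      have := (((Real.continuous_rpow_const hqp.le).tendsto 0).const_mul (b / (q - 1))).neg
      rw [Real.zero_rpow hqp.ne', mul_zero, neg_zero] at this
      exact this.mono_left nhdsWithin_le_nhds
    refine le_of_tendsto l1 ?_
    filter_upwards [Ioo_mem_nhdsGT (half_pos hs)] with r hr
    have h2 := H.lt_of_lt hr.1.ne' (half_pos hs).ne' hr.2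
    simp only [abs_of_pos hr.1, abs_of_pos (half_pos hs)] at h2
    refine le_trans ?_ h2.le
    rw [le_div_iff₀ (hsp r hr.1)]
    have h3 := (_root_.abs_le.1 (H.abs_le_of_nonneg hr.1.le)).1
    refine le_trans (le_of_eq ?_) h3
    rw [neg_mul, mul_assoc, ← Real.rpow_add hr.1]
    congr 3
    ring
  have h2 := H.lt_of_lt (half_pos hs).ne' hs.ne' (half_lt_self hs)
  simp only [abs_of_pos hs, abs_of_pos (half_pos hs)] at h2
  have h3 := h1.trans_lt h2
  rwa [div_pos_iff_of_pos_right (hsp s hs)] at h3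

lemma mul_self_pos (H : NehariNonlinearity p q b θ R h) {s : ℝ} (hs : s ≠ 0) : 0 < h s * s := by
  rcases lt_or_gt_of_ne hs with hs | hs
  · have := H.reflect.pos_of_pos (s := -s) (by linarith)
    simp only [neg_neg] at this
    nlinarith
  · exact mul_pos (H.pos_of_pos hs) hs

lemma mul_self_nonneg (H : NehariNonlinearity p q b θ R h) (s : ℝ) : 0 ≤ h s * s := by
  by_cases hs : s = 0
  · simp [hs]
  · exact (H.mul_self_pos hs).le

lemma scale_le_of_pos (H : NehariNonlinearity p q b θ R h) {r s : ℝ} (hr : 0 < r) (hr1 : r ≤ 1)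
    (hs : 0 < s) : h (r * s) ≤ r ^ (p - 1) * h s := by
  have hrs : 0 < r * s := mul_pos hr hs
  have h1 := H.strictMono.monotoneOn (mem_compl_singleton_iff.2 hrs.ne')
    (mem_compl_singleton_iff.2 hs.ne') (by nlinarith)
  simp only [abs_of_pos hrs, abs_of_pos hs] at h1
  rw [div_le_div_iff₀ (by positivity) (by positivity), Real.mul_rpow hr.le hs.le] at h1
  have h2 : 0 < s ^ (p - 1) := by positivity
  nlinarith

lemma scale_le (H : NehariNonlinearity p q b θ R h) {r : ℝ} (hr : 0 ≤ r) (hr1 : r ≤ 1) (s : ℝ) :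
    h (r * s) * s ≤ r ^ (p - 1) * (h s * s) := by
  have hp1 : 0 < p - 1 := by linarith [H.one_lt]
  rcases hr.eq_or_lt with rfl | hr0
  · simp [H.apply_zero, Real.zero_rpow hp1.ne']
  · rcases lt_trichotomy s 0 with hs | rfl | hs
    · have := H.reflect.scale_le_of_pos hr0 hr1 (s := -s) (by linarith)
      simp only [mul_neg, neg_neg] at this
      nlinarith
    · simp
    · have := H.scale_le_of_pos hr0 hr1 hs
      nlinarith

lemma primitive_sub (H : NehariNonlinearity p q b θ R h) (t s : ℝ) :
    (∫ τ in (0 : ℝ)..s, h τ) - ∫ τ in (0 : ℝ)..(t * s), h τ = ∫ r in t..1, h (r * s) * s := by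
  have hi : ∀ a c, IntervalIntegrable h volume a c := fun a c => H.continuous.intervalIntegrable a c
  rw [intervalIntegral.integral_interval_sub_left (hi _ _) (hi _ _),
    intervalIntegral.integral_mul_const, mul_comm (∫ r in t..1, h (r * s)), ← smul_eq_mul s,
    intervalIntegral.smul_integral_comp_mul_right, one_mul]

/-- The fibering inequality. -/
lemma primitive_sub_le (H : NehariNonlinearity p q b θ R h) {t : ℝ} (ht : 0 ≤ t) (ht1 : t ≤ 1)
    (s : ℝ) : (∫ τ in (0 : ℝ)..s, h τ) - ∫ τ in (0 : ℝ)..(t * s), h τ ≤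
      (1 - t ^ p) / p * (h s * s) := by
  have hp1 : 0 < p - 1 := by linarith [H.one_lt]
  rw [H.primitive_sub]
  have hc := H.continuous
  -- The difference of primitives is an integral over the ray from ts to s; (g3) bounds its
  -- integrand by r^(p-1) h(s)s.
  have h1 : ∫ r in t..1, h (r * s) * s ≤ ∫ r in t..1, r ^ (p - 1) * (h s * s) := by
    refine intervalIntegral.integral_mono_on ht1 ?_ ?_ fun r hr =>
      H.scale_le (ht.trans hr.1) hr.2 s
    · exact Continuous.intervalIntegrable (by fun_prop) _ _
    · exact ((Real.continuous_rpow_const hp1.le).mul continuous_const).intervalIntegrable _ _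
  refine h1.trans (le_of_eq ?_)
  rw [intervalIntegral.integral_mul_const, integral_rpow (Or.inl (by linarith)),
    sub_add_cancel, Real.one_rpow]

lemma primitive_nonneg (H : NehariNonlinearity p q b θ R h) (s : ℝ) :
    0 ≤ ∫ τ in (0 : ℝ)..s, h τ := by
  have h1 := H.primitive_sub 0 s
  simp only [zero_mul, intervalIntegral.integral_same, sub_zero] at h1
  rw [h1]
  refine intervalIntegral.integral_nonneg zero_le_one fun r hr => ?_
  rcases hr.1.eq_or_lt with rfl | hr0
  · simp [H.apply_zero]
  · have := H.mul_self_nonneg (r * s)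
    have h2 : h (r * s) * (r * s) = r * (h (r * s) * s) := by ring
    rw [h2] at this
    exact nonneg_of_mul_nonneg_right this hr0

lemma primitive_le (H : NehariNonlinearity p q b θ R h) (s : ℝ) :
    ∫ τ in (0 : ℝ)..s, h τ ≤ 1 / p * (h s * s) := by
  have hp : 0 < p := by linarith [H.one_lt]
  have := H.primitive_sub_le le_rfl zero_le_one s
  simpa [Real.zero_rpow hp.ne'] using this

lemma abs_mul_self_le (H : NehariNonlinearity p q b θ R h) (s : ℝ) :
    |h s * s| ≤ b / (q - 1) * |s| ^ q := by
  have hq : 1 < q := H.one_lt.trans H.lt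
  rw [abs_mul]
  refine (mul_le_mul_of_nonneg_right (H.abs_le s) (abs_nonneg s)).trans (le_of_eq ?_)
  by_cases hs : s = 0
  · simp [hs, Real.zero_rpow (by linarith : q ≠ 0)]
  · have hs0 : 0 < |s| := abs_pos.2 hs
    rw [mul_assoc, ← Real.rpow_add_one hs0.ne', sub_add_cancel]

lemma abs_primitive_le (H : NehariNonlinearity p q b θ R h) (s : ℝ) :
    |∫ τ in (0 : ℝ)..s, h τ| ≤ b / (q - 1) * |s| ^ q := by
  rw [abs_of_nonneg (H.primitive_nonneg s)]
  refine (H.primitive_le s).trans (le_trans ?_ (H.abs_mul_self_le s))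
  rw [abs_of_nonneg (H.mul_self_nonneg s)]
  refine mul_le_of_le_one_left (H.mul_self_nonneg s) ?_
  rw [div_le_one (by linarith [H.one_lt])]
  exact H.one_lt.le

/-- The Ambrosetti–Rabinowitz condition makes G(s)s^(-θ) nondecreasing on [R,∞), so G grows at least
like s^θ, and h(s)s ≥ θG(s). The constant may depend on the point x, as the application is through
Fatou's lemma. -/
lemma exists_le_mul_self (H : NehariNonlinearity p q b θ R h) : ∃ c : ℝ, 0 < c ∧
    ∀ s, R ≤ s → c * s ^ θ ≤ h s * s := by
  have hθ : 0 < θ := by linarith [H.one_lt, H.pθ]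
  have hR := H.Rpos
  have hG : ∀ s, HasDerivAt (fun s => ∫ τ in (0 : ℝ)..s, h τ) (h s) s := fun s =>
    intervalIntegral.integral_hasDerivAt_right (H.continuous.intervalIntegrable _ _)
      (H.continuous.stronglyMeasurableAtFilter _ _) H.continuous.continuousAt
  have hder : ∀ s, 0 < s → HasDerivAt (fun s => (∫ τ in (0 : ℝ)..s, h τ) * s ^ (-θ))
      (s ^ (-θ - 1) * (h s * s - θ * ∫ τ in (0 : ℝ)..s, h τ)) s := fun s hs => by
    have h1 := (hG s).mul (Real.hasDerivAt_rpow_const (x := s) (p := -θ) (Or.inl hs.ne'))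
    refine h1.congr_deriv ?_
    have : s ^ (-θ) = s ^ (-θ - 1) * s := by
      rw [← Real.rpow_add_one hs.ne', sub_add_cancel]
    rw [this]; ring
  have hmono : MonotoneOn (fun s => (∫ τ in (0 : ℝ)..s, h τ) * s ^ (-θ)) (Ici R) := by
    refine monotoneOn_of_deriv_nonneg (convex_Ici R) ?_ ?_ ?_
    · exact fun s hs => (hder s (hR.trans_le hs)).continuousAt.continuousWithinAt
    · rw [interior_Ici]
      exact fun s hs => (hder s (hR.trans hs)).differentiableAt.differentiableWithinAt
    · rw [interior_Ici]
      intro s hs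
      have hs0 : 0 < s := hR.trans hs
      rw [(hder s hs0).deriv]
      have := (H.superlinear s (by rw [abs_of_pos hs0]; exact le_of_lt hs)).1
      exact mul_nonneg (by positivity) (by linarith)
  have hGR := (H.superlinear R (by rw [abs_of_pos hR])).2
  refine ⟨θ * ((∫ τ in (0 : ℝ)..R, h τ) * R ^ (-θ)), by positivity, fun s hs => ?_⟩
  have hs0 : 0 < s := hR.trans_le hs
  have h1 := hmono (mem_Ici.2 le_rfl) (mem_Ici.2 hs) hs
  simp only at h1
  have h2 := (H.superlinear s (by rw [abs_of_pos hs0]; exact hs)).1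
  have h3 : s ^ (-θ) * s ^ θ = 1 := by rw [← Real.rpow_add hs0]; simp
  calc θ * ((∫ τ in (0 : ℝ)..R, h τ) * R ^ (-θ)) * s ^ θ
      ≤ θ * ((∫ τ in (0 : ℝ)..s, h τ) * s ^ (-θ)) * s ^ θ := by gcongr
    _ = θ * (∫ τ in (0 : ℝ)..s, h τ) * (s ^ (-θ) * s ^ θ) := by ring
    _ ≤ h s * s := by rw [h3, mul_one]; exact h2

lemma tendsto_atTop_of_pos (H : NehariNonlinearity p q b θ R h) {s : ℝ} (hs : 0 < s) :
    Tendsto (fun t : ℝ => h (t * s) * (t * s) / t ^ p) atTop atTop := by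
  obtain ⟨c, hc, hle⟩ := H.exists_le_mul_self
  have hθp : 0 < θ - p := by linarith [H.pθ]
  have h1 : Tendsto (fun t : ℝ => c * s ^ θ * t ^ (θ - p)) atTop atTop :=
    (tendsto_rpow_atTop hθp).const_mul_atTop (by positivity)
  refine tendsto_atTop_mono' _ ?_ h1
  filter_upwards [eventually_ge_atTop (R / s), eventually_gt_atTop 0] with t ht ht0
  rw [div_le_iff₀ hs] at ht
  rw [le_div_iff₀ (by positivity)]
  refine le_trans (le_of_eq ?_) (hle _ ht)
  rw [Real.mul_rpow ht0.le hs.le, mul_assoc, ← Real.rpow_add ht0, sub_add_cancel]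
  ring

lemma tendsto_atTop (H : NehariNonlinearity p q b θ R h) {s : ℝ} (hs : s ≠ 0) :
    Tendsto (fun t : ℝ => h (t * s) * (t * s) / t ^ p) atTop atTop := by
  rcases lt_or_gt_of_ne hs with hs | hs
  · have := H.reflect.tendsto_atTop_of_pos (s := -s) (by linarith)
    simpa using this
  · exact H.tendsto_atTop_of_pos hs

end NehariNonlinearity

end NodalNehari

/-! ### Superposition operators and the standing assumptions -/

namespace NodalNehari

variable {N : ℕ} {p lam : ℝ} {A : RN N → ℝ} {g : RN N → ℝ → ℝ}

/-! ### Measurability of superposition operators -/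

/-- A Carathéodory function agrees a.e. with a jointly measurable one. -/
lemma Caratheodory.exists_measurable (hg : Caratheodory g) : ∃ g' : RN N → ℝ → ℝ,
    Measurable (Function.uncurry g') ∧ (∀ x, Continuous (g' x)) ∧ ∀ᵐ x, g x = g' x := by
  classical
  obtain ⟨hm, hc⟩ := hg
  -- On a measurable set of full measure inside `S`, the sections are continuous and agree at
  -- rational arguments with measurable representatives. Setting the function to zero elsewhere
  -- makes every section measurable, and continuity in s gives joint measurability.
  let S : Set (RN N) := {x | Continuous (g x) ∧ ∀ r : ℚ, g x r = (hm r).mk _ x}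
  have hS : ∀ᵐ x, x ∈ S := by
    have h1 : ∀ᵐ x, ∀ r : ℚ, g x r = (hm r).mk _ x := ae_all_iff.2 fun r => (hm r).ae_eq_mk
    filter_upwards [hc, h1] with x hx hx1 using ⟨hx, hx1⟩
  let T : Set (RN N) := (toMeasurable volume Sᶜ)ᶜ
  have hTm : MeasurableSet T := (measurableSet_toMeasurable _ _).compl
  have hTS : T ⊆ S := by
    have := subset_toMeasurable (volume : Measure (RN N)) Sᶜ
    exact compl_subset_comm.1 this
  have hT : ∀ᵐ x, x ∈ T := by
    rw [ae_iff]
    have : {x | x ∉ T} = toMeasurable volume Sᶜ := by ext x; simp [T]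
    rw [this, measure_toMeasurable]
    exact ae_iff.1 hS
  let g' : RN N → ℝ → ℝ := fun x s => if x ∈ T then g x s else 0
  have hcont : ∀ x, Continuous (g' x) := fun x => by
    by_cases hx : x ∈ T
    · simpa [g', hx] using (hTS hx).1
    · simpa [g', hx] using continuous_const
  have hrat : ∀ r : ℚ, Measurable fun x => g' x r := fun r => by
    have : (fun x => g' x r) = T.indicator ((hm r).mk _) := by
      ext x
      by_cases hx : x ∈ T
      · simp [g', hx, (hTS hx).2 r]
      · simp [g', hx]
    rw [this]
    exact (hm r).measurable_mk.indicator hTm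
  have hmeas : ∀ s, Measurable fun x => g' x s := fun s => by
    have hex : ∃ r : ℕ → ℚ, Tendsto (fun n => (r n : ℝ)) atTop (𝓝 s) := by
      have hr : ∀ n : ℕ, ∃ r : ℚ, s < r ∧ (r : ℝ) < s + 1 / ((n : ℝ) + 1) := fun n =>
        exists_rat_btwn (lt_add_of_pos_right _ (by positivity))
      choose r hr1 hr2 using hr
      refine ⟨r, tendsto_of_tendsto_of_tendsto_of_le_of_le tendsto_const_nhds
        ?_ (fun n => (hr1 n).le) (fun n => (hr2 n).le)⟩
      simpa using tendsto_one_div_add_atTop_nhds_zero_nat.const_add s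
    obtain ⟨r, hr⟩ := hex
    refine measurable_of_tendsto_metrizable (fun n => hrat (r n)) (tendsto_pi_nhds.2 fun x => ?_)
    exact ((hcont x).tendsto s).comp hr
  refine ⟨g', ?_, hcont, hT.mono fun x hx => by ext s; simp [g', hx]⟩
  exact (measurable_uncurry_of_continuous_of_measurable (u := fun s x => g' x s) hcont
    hmeas).comp measurable_swap

lemma Caratheodory.aestronglyMeasurable_comp (hg : Caratheodory g) {v : RN N → ℝ}
    (hv : AEStronglyMeasurable v volume) :
    AEStronglyMeasurable (fun x => g x (v x)) volume := by
  obtain ⟨g', hm, -, hae⟩ := hg.exists_measurable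
  refine ((hm.comp_aemeasurable (aemeasurable_id.prodMk hv.aemeasurable)).congr
    ?_).aestronglyMeasurable
  filter_upwards [hae] with x hx
  simp [Function.uncurry, hx]

/-- The substitution ∫_0^v g(x,τ) dτ = v ∫_0^1 g(x,rv) dr fixes the domain of integration, so
measurability of parameter integrals applies. -/
lemma Caratheodory.aestronglyMeasurable_primG (hg : Caratheodory g) {v : RN N → ℝ}
    (hv : AEStronglyMeasurable v volume) :
    AEStronglyMeasurable (fun x => primG g x (v x)) volume := by
  obtain ⟨g', hm, -, hae⟩ := hg.exists_measurable
  obtain ⟨v', hv', hvv'⟩ := hv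
  have h1 : Measurable (Function.uncurry fun (x : RN N) (r : ℝ) => g' x (r * v' x)) :=
    hm.comp (measurable_fst.prodMk (measurable_snd.mul (hv'.measurable.comp measurable_fst)))
  have h2 : StronglyMeasurable fun x => ∫ r in Ioc (0 : ℝ) 1, g' x (r * v' x) :=
    h1.stronglyMeasurable.integral_prod_right
  refine AEStronglyMeasurable.congr (hv'.mul h2).aestronglyMeasurable ?_
  filter_upwards [hae, hvv'] with x hx hx'
  rw [primG, hx, hx', Pi.mul_apply, ← intervalIntegral.integral_of_le zero_le_one, ← smul_eq_mul,
    intervalIntegral.smul_integral_comp_mul_right, zero_mul, one_mul]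

/-! ### The standing assumptions -/

/-- The consequences of the standing assumptions that are used below. -/
structure NodalSetting {N : ℕ} (p lam : ℝ) (A : RN N → ℝ) (g : RN N → ℝ → ℝ) (q : ℝ)
    (B : RN N → ℝ) : Prop where
  one_lt : 1 < p
  lt : p < N
  memLp : MemLp A ⊤ volume
  pos : ∀ᵐ x, 0 < A x
  lam_lt : lam < lamA p A
  lt_q : p < q
  sub : IsSubcritical q (pStar N p) (fun x s => g x s * s) B
  subG : IsSubcritical q (pStar N p) (primG g) B
  nonlin : ∃ θ R : ℝ, ∀ᵐ x, ∃ b, NehariNonlinearity p q b θ R (g x)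

lemma exists_nodalSetting (hp : 1 < p) (hpN : p < N) (hA : CondA1 p A) (hlam : lam < lamA p A)
    (hg1 : CondG1 p g) (hg2 : CondG2 p g) (hg3 : CondG3 p g) :
    ∃ q B, NodalSetting p lam A g q B := by
  obtain ⟨hcar, hsm, q, hpq, hqs, B, hB, -, hBpos, hder⟩ := hg1
  obtain ⟨θ, hθ, R, hR, hsup⟩ := hg2
  have hq1 : 0 < q - 1 := by linarith
  have hs := pStar_pos hp hpN
  have hnl : ∀ᵐ x, NehariNonlinearity p q (B x) θ R (g x) := by
    filter_upwards [hsm, hBpos, hder, hsup, hg3] with x h1 h2 h3 h4 h5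
    exact ⟨hp, hpq, h2, hθ, hR, h1, h3, h4, h5⟩
  have he : 0 < pStar N p / (pStar N p - q) := div_pos hs (by linarith)
  have hBm : AEMeasurable (fun x => B x / (q - 1)) volume := hB.1.aemeasurable.div_const _
  have hint : ∫⁻ x, ENNReal.ofReal (B x / (q - 1)) ^ (pStar N p / (pStar N p - q)) < ⊤ := by
    have h1 : ∫⁻ x, ‖B x‖ₑ ^ (pStar N p / (pStar N p - q)) < ⊤ := by
      have := (eLpNorm_lt_top_iff_lintegral_rpow_enorm_lt_top (by simpa using he) (by simp)).1 hB.2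
      rwa [ENNReal.toReal_ofReal he.le] at this
    calc _ = ∫⁻ x, ENNReal.ofReal ((q - 1)⁻¹) ^ (pStar N p / (pStar N p - q)) *
          ‖B x‖ₑ ^ (pStar N p / (pStar N p - q)) := by
          refine lintegral_congr_ae (hBpos.mono fun x hx => ?_)
          simp only
          rw [Real.enorm_of_nonneg hx.le, ← ENNReal.mul_rpow_of_nonneg _ _ he.le,
            ← ENNReal.ofReal_mul (by positivity), div_eq_inv_mul]
      _ < ⊤ := by
          have ht : ENNReal.ofReal ((q - 1)⁻¹) ^ (pStar N p / (pStar N p - q)) ≠ ⊤ :=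
            ENNReal.rpow_ne_top_of_nonneg he.le ENNReal.ofReal_ne_top
          rw [lintegral_const_mul' _ _ ht]
          exact ENNReal.mul_lt_top ht.lt_top h1
  -- Integrating |g_s| ≤ B|s|^(q-2) introduces the factor 1/(q-1). The same weight bounds G because
  -- 0 ≤ G ≤ g(x,s)s/p and p > 1.
  refine ⟨q, fun x => B x / (q - 1), hp, hpN, hA.bdd, hA.pos, hlam, hpq, ?_, ?_, θ, R,
    hnl.mono fun x hx => ⟨_, hx⟩⟩
  · refine ⟨by linarith, hqs, hBm, hint, ?_, ?_, fun v hv => ?_⟩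
    · exact hnl.mono fun x hx => hx.continuous.mul continuous_id
    · exact hnl.mono fun x hx s => hx.abs_mul_self_le s
    · exact (hcar.aestronglyMeasurable_comp hv).mul hv
  · refine ⟨by linarith, hqs, hBm, hint, ?_, ?_, fun v hv => hcar.aestronglyMeasurable_primG hv⟩
    · exact hnl.mono fun x hx => intervalIntegral.continuous_primitive
        (fun a b => hx.continuous.intervalIntegrable a b) 0
    · exact hnl.mono fun x hx s => hx.abs_primitive_le s

end NodalNehari

/-! ### The Nehari manifold -/

namespace NodalNehari

variable {N : ℕ} {p lam q : ℝ} {A B : RN N → ℝ} {g : RN N → ℝ → ℝ}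

/-! ### The Nehari condition for pairs of a function and its gradient -/

/-- `∫ g(x,w) w`. -/
noncomputable def nonlinInt (g : RN N → ℝ → ℝ) (w : RN N → ℝ) : ℝ := ∫ x, g x (w x) * w x

/-- `∫ G(x,w)`. -/
noncomputable def primInt (g : RN N → ℝ → ℝ) (w : RN N → ℝ) : ℝ := ∫ x, primG g x (w x)

/-- The functional `S_λ` as a function of a pair `(w, ∇w)`. -/
noncomputable def action (p lam : ℝ) (A : RN N → ℝ) (g : RN N → ℝ → ℝ) (w : RN N → ℝ)
    (W : RN N → RN N) : ℝ :=
  (1 / p) * lamForm p lam A w W - primInt g w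

/-- The Nehari condition for a pair `(w, ∇w)`. -/
structure IsNehari (p lam : ℝ) (A : RN N → ℝ) (g : RN N → ℝ → ℝ) (w : RN N → ℝ)
    (W : RN N → RN N) : Prop where
  isWA : IsWA p A w W
  ne_zero : ¬ w =ᵐ[volume] 0
  eq : lamForm p lam A w W = nonlinInt g w

lemma nonlinInt_congr {w w' : RN N → ℝ} (h : w =ᵐ[volume] w') : nonlinInt g w = nonlinInt g w' :=
  integral_congr_ae (h.mono fun x hx => by simp only [hx])

lemma primInt_congr {w w' : RN N → ℝ} (h : w =ᵐ[volume] w') : primInt g w = primInt g w' :=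
  integral_congr_ae (h.mono fun x hx => by simp only [hx])

lemma action_congr {w w' : RN N → ℝ} {W W' : RN N → RN N} (h : w =ᵐ[volume] w')
    (h' : W =ᵐ[volume] W') : action p lam A g w W = action p lam A g w' W' := by
  rw [action, action, lamForm_congr h h', primInt_congr h]

@[simp] lemma primG_zero (x : RN N) : primG g x 0 = 0 := by simp [primG]

lemma IsNehari.congr {w w' : RN N → ℝ} {W W' : RN N → RN N} (h : IsNehari p lam A g w W)
    (hw : w =ᵐ[volume] w') (hW : W =ᵐ[volume] W') : IsNehari p lam A g w' W' :=
  ⟨h.isWA.congr hw hW, fun h0 => h.ne_zero (hw.trans h0), by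
    rw [← lamForm_congr hw hW, h.eq, nonlinInt_congr hw]⟩

namespace NodalSetting

variable {w : RN N → ℝ} {W : RN N → RN N}

lemma p_pos (H : NodalSetting p lam A g q B) : 0 < p := by linarith [H.one_lt]

lemma lpStar (H : NodalSetting p lam A g q B) (h : IsWA p A w W) :
    ∫⁻ x, ‖w x‖ₑ ^ pStar N p < ⊤ :=
  h.lintegral_pStar_lt_top H.one_lt H.lt H.memLp H.pos

lemma lpStar_smul_lt_top {t : ℝ} (H : NodalSetting p lam A g q B)
    (h : ∫⁻ x, ‖w x‖ₑ ^ pStar N p < ⊤) : ∫⁻ x, ‖(t • w) x‖ₑ ^ pStar N p < ⊤ := by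
  have hs := pStar_pos H.one_lt H.lt
  simp only [Pi.smul_apply, enorm_smul, ENNReal.mul_rpow_of_nonneg _ _ hs.le]
  have ht : ‖t‖ₑ ^ pStar N p ≠ ⊤ := ENNReal.rpow_ne_top_of_nonneg hs.le (by simp)
  rw [lintegral_const_mul' _ _ ht]
  exact ENNReal.mul_lt_top ht.lt_top h

lemma integrable_nonlin (H : NodalSetting p lam A g q B) (h : IsWA p A w W) :
    Integrable (fun x => g x (w x) * w x) := H.sub.integrable h.aesm (H.lpStar h)

lemma integrable_prim (H : NodalSetting p lam A g q B) (h : IsWA p A w W) :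
    Integrable (fun x => primG g x (w x)) := H.subG.integrable h.aesm (H.lpStar h)

lemma nonlinInt_smul_le (H : NodalSetting p lam A g q B) (h : IsWA p A w W) {r : ℝ} (hr : 0 ≤ r)
    (hr1 : r ≤ 1) : nonlinInt g (r • w) ≤ r ^ p * nonlinInt g w := by
  obtain ⟨θ, R, hnl⟩ := H.nonlin
  rw [nonlinInt, nonlinInt, ← integral_const_mul]
  refine integral_mono_ae (H.integrable_nonlin (h.const_smul H.p_pos r))
    ((H.integrable_nonlin h).const_mul _) ?_
  filter_upwards [hnl] with x ⟨b, hx⟩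
  simp only [Pi.smul_apply, smul_eq_mul]
  have h1 := mul_le_mul_of_nonneg_left (hx.scale_le hr hr1 (w x)) hr
  rcases hr.eq_or_lt with rfl | hr0
  · simp [Real.zero_rpow H.p_pos.ne']
  · have h2 : r ^ p = r * r ^ (p - 1) := by
      rw [mul_comm, ← Real.rpow_add_one hr0.ne', sub_add_cancel]
    rw [h2]
    linarith

/-- The fibering inequality bounds the loss of ∫ G between w and tw by (1 - t^p)/p times the
nonlinear integral. The identity J(w) = 0 makes this exactly the loss of the form term. -/
lemma action_smul_le (H : NodalSetting p lam A g q B) (h : IsWA p A w W)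
    (he : lamForm p lam A w W = nonlinInt g w) {t : ℝ} (ht : 0 ≤ t) (ht1 : t ≤ 1) :
    action p lam A g (t • w) (t • W) ≤ action p lam A g w W := by
  obtain ⟨θ, R, hnl⟩ := H.nonlin
  have h1 : primInt g w - primInt g (t • w) ≤ (1 - t ^ p) / p * nonlinInt g w := by
    rw [primInt, primInt, nonlinInt, ← integral_const_mul,
      ← integral_sub (H.integrable_prim h) (H.integrable_prim (h.const_smul H.p_pos t))]
    refine integral_mono_ae ((H.integrable_prim h).sub
      (H.integrable_prim (h.const_smul H.p_pos t))) ((H.integrable_nonlin h).const_mul _) ?_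
    filter_upwards [hnl] with x ⟨b, hx⟩
    exact hx.primitive_sub_le ht ht1 (w x)
  rw [action, action, lamForm_smul, he, abs_of_nonneg ht]
  have h2 : (1 - t ^ p) / p * nonlinInt g w =
      1 / p * nonlinInt g w - 1 / p * (t ^ p * nonlinInt g w) := by ring
  linarith

lemma action_nonneg (H : NodalSetting p lam A g q B) (h : IsWA p A w W)
    (he : lamForm p lam A w W = nonlinInt g w) : 0 ≤ action p lam A g w W := by
  refine le_trans (le_of_eq ?_) (H.action_smul_le h he le_rfl zero_le_one)
  rw [action, lamForm_smul]
  simp [primInt, Real.zero_rpow H.p_pos.ne']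

lemma energy_pos (H : NodalSetting p lam A g q B) (h : IsWA p A w W)
    (h0 : ¬ w =ᵐ[volume] 0) : 0 < (energy p A w W).toReal := by
  refine ENNReal.toReal_pos (fun he => h0 ?_) (h.energy_lt_top H.one_lt.le H.memLp).ne
  have h1 : ∫⁻ x, ENNReal.ofReal (A x) * ‖w x‖ₑ ^ p = 0 :=
    le_antisymm ((lintegral_weight_le_energy w W).trans he.le) zero_le
  rw [lintegral_eq_zero_iff' (H.memLp.1.aemeasurable.ennreal_ofReal.fun_mul
    (h.aesm.enorm.pow_const _))] at h1
  filter_upwards [h1, H.pos] with x hx hx0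
  simpa [hx0, H.p_pos, H.p_pos.le, not_le.2 hx0, H.p_pos.not_gt] using hx

/-- Dividing w by the p-th root of its energy normalises the energy to 1. The truncated Young
inequality with parameter 1 and the Sobolev bound then control ∫ B|w|^q uniformly; q-homogeneity
restores the factor. -/
lemma exists_nonlinInt_le (H : NodalSetting p lam A g q B) : ∃ K : ℝ, 0 < K ∧
    ∀ (w : RN N → ℝ) (W : RN N → RN N), IsWA p A w W → ¬ w =ᵐ[volume] 0 →
      nonlinInt g w ≤ K * (energy p A w W).toReal ^ (q / p) := by
  have hp := H.p_pos
  obtain ⟨M, hM, hMb⟩ := exists_lpStar_bound H.one_lt H.lt H.memLp H.pos ENNReal.one_ne_top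
  set I := ∫⁻ x, ENNReal.ofReal (B x) ^ (pStar N p / (pStar N p - q)) with hI
  have hIM : I + M ≠ ⊤ := ENNReal.add_ne_top.2 ⟨H.sub.int.ne, hM⟩
  refine ⟨(I + M).toReal + 1, by positivity, fun w W h h0 => ?_⟩
  have hE := H.energy_pos h h0
  set E := (energy p A w W).toReal with hEd
  set k : ℝ := E ^ (1 / p) with hk
  have hk0 : 0 < k := Real.rpow_pos_of_pos hE _
  have hkp : k ^ p = E := by rw [hk, ← Real.rpow_mul hE.le, one_div_mul_cancel hp.ne', Real.rpow_one]
  have hkq : k ^ q = E ^ (q / p) := by rw [hk, ← Real.rpow_mul hE.le]; congr 1; ring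
  have hv := h.const_smul hp k⁻¹
  have hen : energy p A (k⁻¹ • w) (k⁻¹ • W) ≤ 1 := by
    rw [energy_const_smul hp.le, ← ENNReal.ofReal_toReal (h.energy_lt_top H.one_lt.le H.memLp).ne,
      ← hEd, Real.enorm_of_nonneg (by positivity), ENNReal.ofReal_rpow_of_nonneg (by positivity) hp.le,
      ← ENNReal.ofReal_mul (by positivity), Real.inv_rpow hk0.le, hkp, inv_mul_cancel₀ hE.ne',
      ENNReal.ofReal_one]
  have hQ : ∫⁻ x, ENNReal.ofReal (B x) * ‖(k⁻¹ • w) x‖ₑ ^ q ≤ I + M := by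
    calc _ ≤ ∫⁻ x, (ENNReal.ofReal (B x) ^ (pStar N p / (pStar N p - q)) +
          ‖(k⁻¹ • w) x‖ₑ ^ pStar N p) := by
          refine lintegral_mono fun x => ?_
          rcases mul_rpow_le_max H.sub.pos H.sub.lt one_ne_zero ENNReal.one_ne_top
            (ENNReal.ofReal (B x)) ‖(k⁻¹ • w) x‖ₑ with h1 | h1
          · exact (by simpa using h1 : _ ≤ _).trans le_self_add
          · exact (by simpa using h1 : _ ≤ _).trans le_add_self
      _ ≤ I + M := by
          rw [lintegral_add_left' (H.sub.aem.ennreal_ofReal.pow_const _)]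
          gcongr
          exact hMb _ _ hv hen
  have hw : ENNReal.ofReal (nonlinInt g w) ≤ ENNReal.ofReal (k ^ q) * (I + M) := by
    calc ENNReal.ofReal (nonlinInt g w) ≤ ‖nonlinInt g w‖ₑ := by
          rw [← ofReal_norm]; exact ENNReal.ofReal_le_ofReal (Real.le_norm_self _)
      _ ≤ ∫⁻ x, ‖g x (w x) * w x‖ₑ := enorm_integral_le_lintegral_enorm _
      _ ≤ ∫⁻ x, ENNReal.ofReal (k ^ q) * (ENNReal.ofReal (B x) * ‖(k⁻¹ • w) x‖ₑ ^ q) := by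
          refine lintegral_mono_ae ?_
          filter_upwards [H.sub.enorm_le] with x hx
          refine (hx (w x)).trans (le_of_eq ?_)
          have : w x = k • (k⁻¹ • w) x := by
            simp [mul_inv_cancel_left₀ hk0.ne']
          conv_lhs => rw [this]
          rw [enorm_smul, ENNReal.mul_rpow_of_nonneg _ _ H.sub.pos.le,
            Real.enorm_of_nonneg hk0.le, ENNReal.ofReal_rpow_of_nonneg hk0.le H.sub.pos.le]
          ring
      _ ≤ _ := by
          rw [lintegral_const_mul' _ _ ENNReal.ofReal_ne_top]
          gcongr
  rw [← ENNReal.ofReal_toReal hIM, ← ENNReal.ofReal_mul (by positivity),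
    ENNReal.ofReal_le_ofReal_iff (by positivity), hkq] at hw
  refine hw.trans ?_
  have : 0 < E ^ (q / p) := Real.rpow_pos_of_pos hE _
  nlinarith

/-- The nonlinear term is bounded away from zero on the Nehari manifold. -/
lemma exists_nonlinInt_ge (H : NodalSetting p lam A g q B) : ∃ ρ : ℝ, 0 < ρ ∧
    ∀ (w : RN N → ℝ) (W : RN N → RN N), IsNehari p lam A g w W → ρ ≤ nonlinInt g w := by
  obtain ⟨K, hK, hKb⟩ := H.exists_nonlinInt_le
  obtain ⟨c, hc, hcb⟩ := exists_coercive H.one_lt H.lt H.memLp H.pos H.lam_lt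
  have hp := H.p_pos
  have hqp : 0 < q / p - 1 := by
    rw [sub_pos, one_lt_div hp]; exact H.lt_q
  -- On the Nehari manifold cE ≤ form = nonlinear integral ≤ K E^(q/p). Since E > 0 and q > p, this
  -- bounds E from below, and coercivity transfers the bound.
  refine ⟨c * (c / K) ^ (1 / (q / p - 1)), by positivity, fun w W h => ?_⟩
  have hE := H.energy_pos h.isWA h.ne_zero
  have h1 := hcb w W h.isWA
  have h2 := hKb w W h.isWA h.ne_zero
  rw [← h.eq] at h2 ⊢
  set E := (energy p A w W).toReal
  refine le_trans (mul_le_mul_of_nonneg_left ?_ hc.le) h1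
  have h3 : c / K ≤ E ^ (q / p - 1) := by
    rw [div_le_iff₀ hK, Real.rpow_sub_one hE.ne', div_mul_eq_mul_div, le_div_iff₀ hE]
    linarith
  calc (c / K) ^ (1 / (q / p - 1)) ≤ (E ^ (q / p - 1)) ^ (1 / (q / p - 1)) := by gcongr
    _ = E := by rw [← Real.rpow_mul hE.le, mul_one_div_cancel hqp.ne', Real.rpow_one]

lemma tendsto_nonlinInt_smul (H : NodalSetting p lam A g q B) (h : IsWA p A w W) {t : ℕ → ℝ}
    {t' : ℝ} (ht : Tendsto t atTop (𝓝 t')) :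
    Tendsto (fun n => nonlinInt g (t n • w)) atTop (𝓝 (nonlinInt g (t' • w))) := by
  have hs := pStar_pos H.one_lt H.lt
  obtain ⟨T, hT⟩ := ht.abs.bddAbove_range
  refine H.sub.tendsto_integral (fun n => h.aesm.const_smul (t n))
    (H.lpStar_smul_lt_top (t := T) (H.lpStar h)).ne (fun n => ?_)
    (Eventually.of_forall fun x => ht.smul_const (w x))
  refine lintegral_mono fun x => ?_
  simp only [Pi.smul_apply, enorm_smul]
  gcongr
  rw [← ofReal_norm, ← ofReal_norm]
  exact ENNReal.ofReal_le_ofReal ((hT ⟨n, rfl⟩).trans (Real.le_norm_self _))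

lemma lamForm_pos (H : NodalSetting p lam A g q B) (h : IsWA p A w W)
    (h0 : ¬ w =ᵐ[volume] 0) : 0 < lamForm p lam A w W := by
  obtain ⟨c, hc, hcb⟩ := exists_coercive H.one_lt H.lt H.memLp H.pos H.lam_lt
  exact (mul_pos hc (H.energy_pos h h0)).trans_le (hcb w W h)

lemma smul_ne_zero_ae {t : ℝ} (ht : t ≠ 0) (h0 : ¬ w =ᵐ[volume] 0) :
    ¬ (t • w) =ᵐ[volume] 0 := fun h => h0 (by
  filter_upwards [h] with x hx
  simpa [ht] using hx)

/-- Projection onto the Nehari manifold from outside. -/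
lemma exists_isNehari_smul_of_le (H : NodalSetting p lam A g q B) (h : IsWA p A w W)
    (h0 : ¬ w =ᵐ[volume] 0) (hle : lamForm p lam A w W ≤ nonlinInt g w) :
    ∃ t : ℝ, 0 < t ∧ t ≤ 1 ∧ IsNehari p lam A g (t • w) (t • W) := by
  obtain ⟨K, hK, hKb⟩ := H.exists_nonlinInt_le
  have hp := H.p_pos
  have hE := H.energy_pos h h0
  have hL := H.lamForm_pos h h0
  set E := (energy p A w W).toReal with hEd
  set L := lamForm p lam A w W
  have hqp : 0 < q - p := by linarith [H.lt_q]
  have hbd : ∀ t : ℝ, 0 < t → nonlinInt g (t • w) ≤ K * E ^ (q / p) * t ^ q := fun t ht => by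
    have h1 := hKb _ _ (h.const_smul hp t) (smul_ne_zero_ae ht.ne' h0)
    have h2 : (energy p A (t • w) (t • W)).toReal = t ^ p * E := by
      rw [energy_const_smul hp.le, ENNReal.toReal_mul, ← hEd, Real.enorm_of_nonneg ht.le,
        ENNReal.ofReal_rpow_of_nonneg ht.le hp.le, ENNReal.toReal_ofReal (by positivity)]
    rw [h2, Real.mul_rpow (by positivity) hE.le, ← Real.rpow_mul ht.le, mul_div_cancel₀ _ hp.ne'] at h1
    linarith
  have hD : 0 < K * E ^ (q / p) := by positivity
  obtain ⟨t₀, ht₀, ht₀1, ht₀b⟩ : ∃ t : ℝ, 0 < t ∧ t ≤ 1 ∧ nonlinInt g (t • w) ≤ t ^ p * L := by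
    -- This t makes t^(q-p) at most L/(K E^(q/p)), so the nonlinear term of order t^q lies below t^p
    -- L. At t = 1 the hypothesis gives the reverse inequality, and the intermediate value theorem
    -- applies between them.
    refine ⟨min 1 ((L / (K * E ^ (q / p))) ^ (1 / (q - p))), by positivity, min_le_left _ _, ?_⟩
    set t := min 1 ((L / (K * E ^ (q / p))) ^ (1 / (q - p))) with htd
    have ht : 0 < t := by positivity
    have h1 : t ^ (q - p) ≤ L / (K * E ^ (q / p)) := by
      calc t ^ (q - p) ≤ ((L / (K * E ^ (q / p))) ^ (1 / (q - p))) ^ (q - p) := by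
            gcongr; exact min_le_right _ _
        _ = _ := by
            rw [← Real.rpow_mul (by positivity), one_div_mul_cancel hqp.ne', Real.rpow_one]
    rw [le_div_iff₀ hD] at h1
    refine (hbd t ht).trans ?_
    have h2 : t ^ q = t ^ p * t ^ (q - p) := by rw [← Real.rpow_add ht]; congr 1; ring
    rw [h2]
    calc _ = t ^ p * (t ^ (q - p) * (K * E ^ (q / p))) := by ring
      _ ≤ _ := by gcongr
  have hcont : Continuous fun t : ℝ => nonlinInt g (t • w) - t ^ p * L := by
    refine Continuous.sub ?_ ((Real.continuous_rpow_const hp.le).mul continuous_const)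
    rw [continuous_iff_seqContinuous]
    exact fun t t' ht => H.tendsto_nonlinInt_smul h ht
  obtain ⟨t, ht, hz⟩ := intermediate_value_Icc ht₀1 hcont.continuousOn
    (show (0 : ℝ) ∈ Icc _ _ from ⟨by linarith, by simpa using hle⟩)
  have htp : 0 < t := ht₀.trans_le ht.1
  refine ⟨t, htp, ht.2, h.const_smul hp t, smul_ne_zero_ae htp.ne' h0, ?_⟩
  rw [lamForm_smul, abs_of_pos htp]
  simp only at hz
  linarith

/-- Superlinearity: `∫ g(x,nw) nw` cannot be `O(n^p)` unless `w = 0`. -/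
lemma ae_eq_zero_of_nonlinInt_le (H : NodalSetting p lam A g q B)
    (hw : AEStronglyMeasurable w volume) (hwt : ∫⁻ x, ‖w x‖ₑ ^ pStar N p < ⊤) {C : ℝ}
    (hC : ∀ n : ℕ, 0 < n → nonlinInt g ((n : ℝ) • w) ≤ C * (n : ℝ) ^ p) : w =ᵐ[volume] 0 := by
  obtain ⟨θ, R, hnl⟩ := H.nonlin
  have hint : ∀ n : ℕ, Integrable (fun x => g x (((n : ℝ) • w) x) * ((n : ℝ) • w) x) := fun n =>
    H.sub.integrable (hw.const_smul _) (H.lpStar_smul_lt_top hwt)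
  -- The hypothesis bounds ∫ F_n, while superlinearity sends F_n(x) to ∞ wherever w(x) ≠ 0. Fatou's
  -- lemma leaves only a null set of such points.
  let F : ℕ → RN N → ℝ≥0∞ := fun n x =>
    ENNReal.ofReal (g x ((n : ℝ) * w x) * ((n : ℝ) * w x) / (n : ℝ) ^ p)
  have hF : ∀ n, AEMeasurable (F n) volume := fun n =>
    ((hint n).1.aemeasurable.div_const _).ennreal_ofReal
  have hFle : ∀ n : ℕ, 0 < n → ∫⁻ x, F n x ≤ ENNReal.ofReal C := fun n hn => by
    have hnp : 0 < (n : ℝ) ^ p := Real.rpow_pos_of_pos (by exact_mod_cast hn) _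
    have hi : Integrable (fun x => g x (((n : ℝ) • w) x) * ((n : ℝ) • w) x / (n : ℝ) ^ p) :=
      (hint n).div_const _
    have h0 : 0 ≤ᵐ[volume] fun x => g x (((n : ℝ) • w) x) * ((n : ℝ) • w) x / (n : ℝ) ^ p := by
      filter_upwards [hnl] with x ⟨b, hx⟩
      exact div_nonneg (hx.mul_self_nonneg _) hnp.le
    have := ofReal_integral_eq_lintegral_ofReal hi h0
    refine this.symm.le.trans (ENNReal.ofReal_le_ofReal ?_)
    rw [integral_div, div_le_iff₀ hnp]
    exact hC n hn
  have hlim : ∫⁻ x, liminf (fun n => F n x) atTop ≤ ENNReal.ofReal C := by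
    refine (lintegral_liminf_le' hF).trans ?_
    refine liminf_le_of_frequently_le' (Eventually.frequently ?_)
    filter_upwards [eventually_gt_atTop 0] with n hn using hFle n hn
  have hmk : ∀ᵐ x, ∀ n, F n x = (hF n).mk _ x := ae_all_iff.2 fun n => (hF n).ae_eq_mk
  have hm : AEMeasurable (fun x => liminf (fun n => F n x) atTop) volume :=
    ⟨_, Measurable.liminf fun n => (hF n).measurable_mk, hmk.mono fun x hx => by simp only [hx]⟩
  have hfin := ae_lt_top' hm (hlim.trans_lt ENNReal.ofReal_lt_top).ne
  filter_upwards [hfin, hnl] with x hx ⟨b, hb⟩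
  by_contra hne
  have h1 : Tendsto (fun n : ℕ => F n x) atTop (𝓝 ⊤) :=
    ENNReal.tendsto_ofReal_atTop.comp ((hb.tendsto_atTop hne).comp tendsto_natCast_atTop_atTop)
  rw [h1.liminf_eq] at hx
  exact lt_irrefl _ hx

/-- Every nonzero element has a positive multiple on the Nehari manifold. -/
lemma exists_isNehari_smul (H : NodalSetting p lam A g q B) (h : IsWA p A w W)
    (h0 : ¬ w =ᵐ[volume] 0) : ∃ t : ℝ, 0 < t ∧ IsNehari p lam A g (t • w) (t • W) := by
  obtain ⟨n, hn, hle⟩ : ∃ n : ℕ, 0 < n ∧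
      lamForm p lam A ((n : ℝ) • w) ((n : ℝ) • W) ≤ nonlinInt g ((n : ℝ) • w) := by
    by_contra! hcon
    refine h0 (H.ae_eq_zero_of_nonlinInt_le (C := lamForm p lam A w W) h.aesm (H.lpStar h)
      fun n hn => (hcon n hn).le.trans (le_of_eq ?_))
    rw [lamForm_smul, Nat.abs_cast, mul_comm]
  have hn0 : (0 : ℝ) < n := by exact_mod_cast hn
  obtain ⟨t, ht, -, hN⟩ := H.exists_isNehari_smul_of_le (h.const_smul H.p_pos n)
    (smul_ne_zero_ae hn0.ne' h0) hle
  refine ⟨t * n, by positivity, ?_⟩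
  simpa [smul_smul] using hN

lemma lamForm_le (H : NodalSetting p lam A g q B) (h : IsWA p A w W) :
    lamForm p lam A w W ≤ (1 + |lam|) * (energy p A w W).toReal := by
  rw [h.lamForm_eq H.one_lt.le H.memLp H.pos, h.toReal_energy H.one_lt.le H.memLp H.pos]
  have h1 : 0 ≤ ∫ x, ‖W x‖ ^ p := integral_nonneg fun x => by positivity
  have h2 : 0 ≤ ∫ x, A x * |w x| ^ p := by
    refine integral_nonneg_of_ae ?_
    filter_upwards [H.pos] with x hx
    positivity
  nlinarith [mul_nonneg (abs_nonneg lam) h1, mul_le_mul_of_nonneg_right (neg_abs_le lam) h2]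

/-- Sublevel sets of the functional on the Nehari manifold are bounded. -/
lemma exists_energy_le (H : NodalSetting p lam A g q B) (m : ℝ) : ∃ C : ℝ≥0∞, C ≠ ⊤ ∧
    ∀ (w : RN N → ℝ) (W : RN N → RN N), IsNehari p lam A g w W → action p lam A g w W ≤ m →
      energy p A w W ≤ C := by
  by_contra! hcon
  have hp := H.p_pos
  have hs := pStar_pos H.one_lt H.lt
  choose w W hN hm hE using fun n : ℕ => hcon n (ENNReal.natCast_ne_top n)
  have hfin : ∀ n, energy p A (w n) (W n) ≠ ⊤ := fun n =>
    ((hN n).isWA.energy_lt_top H.one_lt.le H.memLp).ne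
  let E : ℕ → ℝ := fun n => (energy p A (w n) (W n)).toReal
  have hE0 : ∀ n, 0 < E n := fun n => H.energy_pos (hN n).isWA (hN n).ne_zero
  have hEn : ∀ n : ℕ, (n : ℝ) ≤ E n := fun n => by
    have := ENNReal.toReal_mono (hfin n) (hE n).le
    simpa using this
  -- If energies were unbounded, the quotients w_n/k_n would have unit energy and a subsequence
  -- would converge a.e. to some v. Each fixed multiple j w_n/k_n is eventually a multiple of w_n by
  -- a factor in [0,1], where the Nehari comparisons apply.
  let k : ℕ → ℝ := fun n => E n ^ (1 / p)
  have hk0 : ∀ n, 0 < k n := fun n => Real.rpow_pos_of_pos (hE0 n) _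
  have hkp : ∀ n, k n ^ p = E n := fun n => by
    simp only [k]; rw [← Real.rpow_mul (hE0 n).le, one_div_mul_cancel hp.ne', Real.rpow_one]
  have hktop : Tendsto k atTop atTop :=
    (tendsto_rpow_atTop (by positivity)).comp
      (tendsto_atTop_mono hEn tendsto_natCast_atTop_atTop)
  have hv : ∀ n, IsWA p A ((k n)⁻¹ • w n) ((k n)⁻¹ • W n) := fun n => (hN n).isWA.const_smul hp _
  have hen : ∀ n, energy p A ((k n)⁻¹ • w n) ((k n)⁻¹ • W n) = 1 := fun n => by
    rw [energy_const_smul hp.le, ← ENNReal.ofReal_toReal (hfin n),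
      Real.enorm_of_nonneg (inv_nonneg.2 (hk0 n).le),
      ENNReal.ofReal_rpow_of_nonneg (inv_nonneg.2 (hk0 n).le) hp.le,
      ← ENNReal.ofReal_mul (Real.rpow_nonneg (inv_nonneg.2 (hk0 n).le) _),
      Real.inv_rpow (hk0 n).le, hkp]
    change ENNReal.ofReal ((E n)⁻¹ * E n) = 1
    rw [inv_mul_cancel₀ (hE0 n).ne', ENNReal.ofReal_one]
  obtain ⟨ns, hns, v, V, hvV, hlim⟩ := exists_subseq_ae_tendsto H.one_lt H.lt H.memLp H.pos hv
    ENNReal.one_ne_top (fun n => (hen n).le)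
  obtain ⟨M, hM, hMb⟩ := exists_lpStar_bound H.one_lt H.lt H.memLp H.pos ENNReal.one_ne_top
  -- everything below is along the subsequence and for a fixed dilation `j`
  have hsm : ∀ (j : ℝ) n, j • ((k n)⁻¹ • w n) = (j / k n) • w n := fun j n => by
    rw [smul_smul, div_eq_mul_inv]
  have hsmV : ∀ (j : ℝ) n, j • ((k n)⁻¹ • W n) = (j / k n) • W n := fun j n => by
    rw [smul_smul, div_eq_mul_inv]
  have hbnd : ∀ (j : ℝ) n, ∫⁻ x, ‖(j • ((k (ns n))⁻¹ • w (ns n))) x‖ₑ ^ pStar N p ≤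
      ‖j‖ₑ ^ pStar N p * M := fun j n => by
    have hj : ‖j‖ₑ ^ pStar N p ≠ ⊤ := ENNReal.rpow_ne_top_of_nonneg hs.le (by simp)
    calc _ = ∫⁻ x, ‖j‖ₑ ^ pStar N p * ‖((k (ns n))⁻¹ • w (ns n)) x‖ₑ ^ pStar N p := by
          refine lintegral_congr fun x => ?_
          rw [Pi.smul_apply, enorm_smul, ENNReal.mul_rpow_of_nonneg _ _ hs.le]
      _ ≤ _ := by
          rw [lintegral_const_mul' _ _ hj]
          gcongr
          exact hMb _ _ (hv _) (hen _).le
  have hMj : ∀ j : ℝ, ‖j‖ₑ ^ pStar N p * M ≠ ⊤ := fun j =>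
    ENNReal.mul_ne_top (ENNReal.rpow_ne_top_of_nonneg hs.le (by simp)) hM
  have haes : ∀ (j : ℝ) n,
      AEStronglyMeasurable (j • ((k (ns n))⁻¹ • w (ns n))) volume := fun j n =>
    (hv (ns n)).aesm.const_smul j
  have hlimj : ∀ j : ℝ, ∀ᵐ x, Tendsto (fun n => (j • ((k (ns n))⁻¹ • w (ns n))) x) atTop
      (𝓝 ((j • v) x)) := fun j => hlim.mono fun x hx => hx.const_smul j
  have hev : ∀ j : ℝ, ∀ᶠ n in atTop, j ≤ k (ns n) := fun j =>
    (hktop.comp hns.tendsto_atTop).eventually_ge_atTop j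
  -- The nonlinear integral of j w_n/k_n is at most (j/k_n)^p times that of w_n. By the Nehari
  -- identity this is the form at j w_n/k_n, hence O(j^p). In the limit superlinearity forces v = 0.
  have hv0 : v =ᵐ[volume] 0 := by
    refine H.ae_eq_zero_of_nonlinInt_le (C := 1 + |lam|) hvV.aesm (H.lpStar hvV) fun j hj => ?_
    refine le_of_tendsto (H.sub.tendsto_integral (haes j) (hMj j) (hbnd j) (hlimj j)) ?_
    filter_upwards [hev j] with n hn
    change nonlinInt g _ ≤ _
    have hr0 : 0 ≤ (j : ℝ) / k (ns n) := div_nonneg (Nat.cast_nonneg j) (hk0 _).le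
    have h1 := H.nonlinInt_smul_le (hN (ns n)).isWA hr0 ((div_le_one (hk0 _)).2 hn)
    have h2 := lamForm_smul (p := p) (lam := lam) (A := A) ((j : ℝ) / k (ns n)) (w (ns n)) (W (ns n))
    rw [abs_of_nonneg hr0, (hN (ns n)).eq, ← hsm, ← hsmV, lamForm_smul, Nat.abs_cast] at h2
    have h3 := H.lamForm_le (hv (ns n))
    rw [hen, ENNReal.toReal_one, mul_one] at h3
    rw [hsm]
    refine h1.trans (h2.symm.le.trans ?_)
    rw [mul_comm]
    gcongr
  obtain ⟨c, hc, hcb⟩ := exists_coercive H.one_lt H.lt H.memLp H.pos H.lam_lt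
  -- As v = 0, the integral of G at j w_n/k_n tends to zero. Then m ≥ S(w_n) ≥ S(j w_n/k_n) ≥ c
  -- j^p/p - o(1), which is impossible for large j.
  have hfinal : ∀ j : ℝ, 0 < j → 1 / p * (j ^ p * c) ≤ m := fun j hj => by
    have h0 : primInt g (j • v) = 0 := by
      rw [primInt_congr (w' := 0) (hv0.mono fun x hx => by simp [hx])]
      simp [primInt]
    have h1 := H.subG.tendsto_integral (haes j) (hMj j) (hbnd j) (hlimj j)
    have h2 : Tendsto (fun n => 1 / p * (j ^ p * c) -
        ∫ x, primG g x ((j • ((k (ns n))⁻¹ • w (ns n))) x)) atTop (𝓝 (1 / p * (j ^ p * c) - 0)) := by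
      rw [← h0]; exact h1.const_sub _
    rw [sub_zero] at h2
    refine le_of_tendsto h2 ?_
    filter_upwards [hev j] with n hn
    have hr0 : 0 ≤ j / k (ns n) := div_nonneg hj.le (hk0 _).le
    have h3 := (H.action_smul_le (hN (ns n)).isWA (hN (ns n)).eq hr0
      ((div_le_one (hk0 _)).2 hn)).trans (hm (ns n))
    rw [← hsm, ← hsmV, action, lamForm_smul, abs_of_pos hj] at h3
    have h4 := hcb _ _ (hv (ns n))
    rw [hen, ENNReal.toReal_one, mul_one] at h4
    refine le_trans ?_ h3
    have h5 : 1 / p * (j ^ p * c) ≤ 1 / p *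
      (j ^ p * lamForm p lam A ((k (ns n))⁻¹ • w (ns n)) ((k (ns n))⁻¹ • W (ns n))) := by gcongr
    exact sub_le_sub_right h5 _
  have htop : Tendsto (fun j : ℝ => 1 / p * (j ^ p * c)) atTop atTop :=
    ((tendsto_rpow_atTop hp).atTop_mul_const hc).const_mul_atTop (by positivity)
  obtain ⟨j, hj, hj0⟩ := ((htop.eventually_gt_atTop m).and (eventually_gt_atTop 0)).exists
  exact absurd (hfinal j hj0) (not_le.2 hj)

end NodalSetting

end NodalNehari

/-! ### Nodal pairs and minimisation -/

namespace NodalNehari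

variable {N : ℕ} {p lam q : ℝ} {A B : RN N → ℝ} {g : RN N → ℝ → ℝ}

/-! ### Nodal pairs -/

/-- Two elements of the Nehari manifold that are the parts of a sign-changing function. -/
structure NodalPair (p lam : ℝ) (A : RN N → ℝ) (g : RN N → ℝ → ℝ) (a b : RN N → ℝ)
    (Va Vb : RN N → RN N) : Prop where
  left : IsNehari p lam A g a Va
  right : IsNehari p lam A g b Vb
  nonneg : ∀ᵐ x, 0 ≤ a x
  nonpos : ∀ᵐ x, b x ≤ 0
  disjoint : ∀ᵐ x, a x * b x = 0

lemma Slam_eq_action (u : RN N →ₘ[volume] ℝ) :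
    Slam p lam A g u = action p lam A g u (weakGrad u) := rfl

namespace NodalSetting

variable {a b : RN N → ℝ} {Va Vb : RN N → RN N}

lemma mem_Nlam_iff (H : NodalSetting p lam A g q B) (u : RN N →ₘ[volume] ℝ) :
    u ∈ Nlam p lam A g ↔ IsNehari p lam A g u (weakGrad u) := by
  have h0 : u ≠ 0 ↔ ¬ (u : RN N → ℝ) =ᵐ[volume] 0 := by
    rw [not_iff_not]
    constructor
    · rintro rfl; exact AEEqFun.coeFn_zero
    · exact fun h => AEEqFun.ext (h.trans AEEqFun.coeFn_zero.symm)
  constructor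
  · rintro ⟨h1, h2, h3⟩
    exact ⟨(mem_WA_iff H.one_lt H.lt H.memLp H.pos u).1 h1, h0.1 h2, sub_eq_zero.1 h3⟩
  · rintro ⟨h1, h2, h3⟩
    exact ⟨(mem_WA_iff H.one_lt H.lt H.memLp H.pos u).2 h1, h0.2 h2, sub_eq_zero.2 h3⟩

lemma integrable_form (H : NodalSetting p lam A g q B) (h : IsWA p A a Va) :
    Integrable fun x => ‖Va x‖ ^ p - lam * A x * |a x| ^ p := by
  have h2 := (h.integrable_weight H.one_lt.le H.memLp H.pos).1.const_mul lam
  simp only [← mul_assoc] at h2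
  exact (h.integrable_grad H.one_lt.le H.memLp).sub h2

/-- At almost every point one of the functions vanishes and, by `IsWA.grad_eq_zero_ae`, so does its
gradient. The integrands therefore add pointwise with no cross term. -/
lemma action_add (H : NodalSetting p lam A g q B) (ha : IsWA p A a Va) (hb : IsWA p A b Vb)
    (hd : ∀ᵐ x, a x * b x = 0) :
    action p lam A g (a + b) (Va + Vb) = action p lam A g a Va + action p lam A g b Vb := by
  have hp := H.p_pos
  have h1 : lamForm p lam A (a + b) (Va + Vb) = lamForm p lam A a Va + lamForm p lam A b Vb := by
    rw [lamForm, lamForm, lamForm, ← integral_add (H.integrable_form ha) (H.integrable_form hb)]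
    refine integral_congr_ae ?_
    filter_upwards [hd, ha.grad_eq_zero_ae H.one_lt H.lt H.memLp H.pos,
      hb.grad_eq_zero_ae H.one_lt H.lt H.memLp H.pos] with x hx hax hbx
    rcases mul_eq_zero.1 hx with h0 | h0
    · simp [h0, hax h0, hp.ne']
    · simp [h0, hbx h0, hp.ne']
  have h2 : primInt g (a + b) = primInt g a + primInt g b := by
    rw [primInt, primInt, primInt, ← integral_add (H.integrable_prim ha) (H.integrable_prim hb)]
    refine integral_congr_ae ?_
    filter_upwards [hd] with x hx
    rcases mul_eq_zero.1 hx with h0 | h0 <;> simp [h0]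
  rw [action, action, action, h1, h2]
  ring

/-- The element of `M_λ` given by a nodal pair. -/
lemma exists_mem_Mlam (H : NodalSetting p lam A g q B) (h : NodalPair p lam A g a b Va Vb) :
    ∃ u ∈ Mlam p lam A g,
      Slam p lam A g u = action p lam A g a Va + action p lam A g b Vb := by
  have hW := h.left.isWA.add H.one_lt.le H.memLp.1.aemeasurable h.right.isWA
  let u : RN N →ₘ[volume] ℝ := AEEqFun.mk (a + b) hW.aesm
  have hu : u =ᵐ[volume] a + b := AEEqFun.coeFn_mk _ hW.aesm
  have hplus : a =ᵐ[volume] uPlus u := by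
    filter_upwards [hu, AEEqFun.coeFn_sup u 0, AEEqFun.coeFn_zero (μ := volume) (β := ℝ) (α := RN N),
      h.nonneg, h.nonpos, h.disjoint] with x h1 h2 h3 h4 h5 h6
    rw [uPlus, h2, h1, h3, Pi.add_apply]
    rcases mul_eq_zero.1 h6 with h0 | h0
    · simp [h0, h5]
    · simp [h0, h4]
  have hminus : b =ᵐ[volume] uMinus u := by
    filter_upwards [hu, AEEqFun.coeFn_neg (-u ⊔ 0), AEEqFun.coeFn_sup (-u) 0, AEEqFun.coeFn_neg u,
      AEEqFun.coeFn_zero (μ := volume) (β := ℝ) (α := RN N),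
      h.nonneg, h.nonpos, h.disjoint] with x h1 h2 h2' h2'' h3 h4 h5 h6
    rw [uMinus, h2, Pi.neg_apply, h2', h2'', Pi.neg_apply, h1, h3, Pi.add_apply]
    rcases mul_eq_zero.1 h6 with h0 | h0
    · simp [h0, h5]
    · simp [h0, h4]
  refine ⟨u, ⟨mem_WA_of_isWA H.one_lt H.lt H.memLp H.pos hW hu, (H.mem_Nlam_iff _).2 ?_,
    (H.mem_Nlam_iff _).2 ?_⟩, ?_⟩
  · exact h.left.congr hplus ((h.left.isWA.congr hplus EventuallyEq.rfl).weakGrad_ae_eq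
      H.one_lt H.lt H.memLp H.pos).symm
  · exact h.right.congr hminus ((h.right.isWA.congr hminus EventuallyEq.rfl).weakGrad_ae_eq
      H.one_lt H.lt H.memLp H.pos).symm
  · rw [← H.action_add h.left.isWA h.right.isWA h.disjoint, Slam_eq_action]
    exact action_congr hu ((hW.congr hu.symm EventuallyEq.rfl).weakGrad_ae_eq
      H.one_lt H.lt H.memLp H.pos)

/-- The nodal pair given by an element of `M_λ`. -/
lemma exists_nodalPair (H : NodalSetting p lam A g q B) {u : RN N →ₘ[volume] ℝ}
    (hu : u ∈ Mlam p lam A g) : ∃ a b Va Vb, NodalPair p lam A g a b Va Vb ∧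
      Slam p lam A g u = action p lam A g a Va + action p lam A g b Vb := by
  obtain ⟨h1, h2, h3⟩ := hu
  rw [H.mem_Nlam_iff] at h2 h3
  have hval : ∀ᵐ x, uPlus u x = max (u x) 0 ∧ uMinus u x = -max (-u x) 0 := by
    filter_upwards [AEEqFun.coeFn_sup u 0, AEEqFun.coeFn_neg (-u ⊔ 0), AEEqFun.coeFn_sup (-u) 0,
      AEEqFun.coeFn_neg u, AEEqFun.coeFn_zero (μ := volume) (β := ℝ) (α := RN N)]
      with x k1 k2 k3 k4 k5
    rw [uPlus, uMinus, k1, k2, Pi.neg_apply, k3, k4, k5]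
    exact ⟨rfl, rfl⟩
  have hP : NodalPair p lam A g (uPlus u) (uMinus u) (weakGrad (uPlus u)) (weakGrad (uMinus u)) := by
    refine ⟨h2, h3, hval.mono fun x hx => ?_, hval.mono fun x hx => ?_, hval.mono fun x hx => ?_⟩
    · rw [hx.1]; exact le_max_right _ _
    · rw [hx.2]; exact neg_nonpos.2 (le_max_right _ _)
    · rw [hx.1, hx.2]
      rcases le_total (u x) 0 with h | h <;> simp [h]
  refine ⟨_, _, _, _, hP, ?_⟩
  rw [← H.action_add h2.isWA h3.isWA hP.disjoint, Slam_eq_action]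
  have hsum : (uPlus u : RN N → ℝ) + (uMinus u : RN N → ℝ) =ᵐ[volume] u := by
    filter_upwards [hval] with x hx
    rw [Pi.add_apply, hx.1, hx.2]
    rcases le_total (u x) 0 with h | h <;> simp [h]
  exact action_congr hsum.symm (((h2.isWA.add H.one_lt.le H.memLp.1.aemeasurable h3.isWA).congr hsum
    EventuallyEq.rfl).weakGrad_ae_eq H.one_lt H.lt H.memLp H.pos)

lemma exists_bump (x₀ : RN N) : ∃ φ : RN N → ℝ, TestFun φ ∧ (∀ x, 0 ≤ φ x) ∧ φ x₀ = 1 ∧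
    ∀ x, 1 ≤ dist x x₀ → φ x = 0 := by
  let f : ContDiffBump x₀ := ⟨1 / 2, 1, by norm_num, by norm_num⟩
  refine ⟨f, ⟨f.contDiff, f.hasCompactSupport⟩, fun x => f.nonneg, ?_, fun x hx =>
    f.zero_of_le_dist hx⟩
  exact f.one_of_mem_closedBall (Metric.mem_closedBall_self (by norm_num [f]))

/-- Two bumps of radius 1 with centres at distance 3 have disjoint supports; one is taken with a
minus sign and each is scaled onto the Nehari manifold. -/
lemma nonempty_nodalPair (H : NodalSetting p lam A g q B) :
    ∃ a b Va Vb, NodalPair p lam A g a b Va Vb := by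
  have hN : 1 < N := by
    have := H.one_lt.trans H.lt
    exact_mod_cast this
  let y : RN N := EuclideanSpace.single ⟨0, by omega⟩ (3 : ℝ)
  have hy : dist y 0 = 3 := by simp [y]
  obtain ⟨φ, hφ, hφ0, hφ1, hφs⟩ := exists_bump (0 : RN N)
  obtain ⟨ψ, hψ, hψ0, hψ1, hψs⟩ := exists_bump y
  have hne : ∀ {f : RN N → ℝ} {x : RN N}, TestFun f → f x ≠ 0 → ¬ f =ᵐ[volume] 0 :=
    fun hf hx h0 => hx (congrFun ((Continuous.ae_eq_iff_eq volume hf.continuous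
      continuous_const).1 h0) _)
  obtain ⟨s, hs, hNs⟩ := H.exists_isNehari_smul (hφ.isWA H.p_pos)
    (hne hφ (x := 0) (by simp [hφ1]))
  obtain ⟨t, ht, hNt⟩ := H.exists_isNehari_smul ((hψ.const_smul (-1)).isWA H.p_pos)
    (hne (hψ.const_smul (-1)) (x := y) (by simp [hψ1]))
  refine ⟨_, _, _, _, hNs, hNt, Eventually.of_forall fun x => ?_, Eventually.of_forall fun x => ?_,
    Eventually.of_forall fun x => ?_⟩
  · exact mul_nonneg hs.le (hφ0 x)
  · simpa using mul_nonneg ht.le (hψ0 x)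
  · rcases le_or_gt 1 (dist x 0) with h | h
    · simp [hφs x h]
    · have : 1 ≤ dist x y := by
        have := dist_triangle_left y 0 x
        linarith
      simp [hψs x this]

/-- Minimisation over nodal pairs. -/
lemma exists_minimizer (H : NodalSetting p lam A g q B) {a b : ℕ → RN N → ℝ}
    {Va Vb : ℕ → RN N → RN N} {m : ℝ}
    (h : ∀ n, NodalPair p lam A g (a n) (b n) (Va n) (Vb n))
    (hm : ∀ n : ℕ, action p lam A g (a n) (Va n) + action p lam A g (b n) (Vb n) <
      m + 1 / ((n : ℝ) + 1)) :
    ∃ a' b' Va' Vb', NodalPair p lam A g a' b' Va' Vb' ∧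
      action p lam A g a' Va' + action p lam A g b' Vb' ≤ m := by
  have hp := H.p_pos
  -- Both summands are nonnegative, so each part separately has action below m + 1 and thus bounded
  -- energy.
  obtain ⟨C, hC, hbd⟩ := H.exists_energy_le (m + 1)
  have hone : ∀ n : ℕ, 1 / ((n : ℝ) + 1) ≤ 1 := fun n => by
    rw [div_le_one (by positivity)]; linarith [Nat.cast_nonneg (α := ℝ) n]
  have ha0 : ∀ n, 0 ≤ action p lam A g (a n) (Va n) := fun n =>
    H.action_nonneg (h n).left.isWA (h n).left.eq
  have hb0 : ∀ n, 0 ≤ action p lam A g (b n) (Vb n) := fun n =>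
    H.action_nonneg (h n).right.isWA (h n).right.eq
  have hEa : ∀ n, energy p A (a n) (Va n) ≤ C := fun n =>
    hbd _ _ (h n).left (by linarith [hm n, hb0 n, hone n])
  have hEb : ∀ n, energy p A (b n) (Vb n) ≤ C := fun n =>
    hbd _ _ (h n).right (by linarith [hm n, ha0 n, hone n])
  obtain ⟨ns, hns, a', Wa, hWa, hlima⟩ := exists_subseq_ae_tendsto H.one_lt H.lt H.memLp H.pos
    (fun n => (h n).left.isWA) hC hEa
  obtain ⟨ms, hms, b', Wb, hWb, hlimb⟩ := exists_subseq_ae_tendsto H.one_lt H.lt H.memLp H.pos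
    (fun n => (h (ns n)).right.isWA) hC (fun n => hEb (ns n))
  let k : ℕ → ℕ := fun n => ns (ms n)
  have hk : Tendsto k atTop atTop := hns.tendsto_atTop.comp hms.tendsto_atTop
  have hla : ∀ᵐ x, Tendsto (fun n => a (k n) x) atTop (𝓝 (a' x)) :=
    hlima.mono fun x hx => hx.comp hms.tendsto_atTop
  have hlb : ∀ᵐ x, Tendsto (fun n => b (k n) x) atTop (𝓝 (b' x)) := hlimb
  obtain ⟨ρ, hρ, hρb⟩ := H.exists_nonlinInt_ge
  -- projection of the limit of one of the two parts
  have key : ∀ {w : ℕ → RN N → ℝ} {W : ℕ → RN N → RN N} {w' : RN N → ℝ} {W' : RN N → RN N},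
      (∀ n, IsNehari p lam A g (w n) (W n)) → (∀ n, energy p A (w n) (W n) ≤ C) →
      IsWA p A w' W' → (∀ᵐ x, Tendsto (fun n => w n x) atTop (𝓝 (w' x))) →
      ∃ t : ℝ, 0 < t ∧ IsNehari p lam A g (t • w') (t • W') ∧ ∀ ε : ℝ, 0 < ε →
        ∀ᶠ n in atTop, action p lam A g (t • w') (t • W') ≤ action p lam A g (w n) (W n) + ε := by
    intro w W w' W' hN hE hW' hl
    obtain ⟨M, hM, hMb⟩ := exists_lpStar_bound H.one_lt H.lt H.memLp H.pos hC
    have hnl : Tendsto (fun n => nonlinInt g (w n)) atTop (𝓝 (nonlinInt g w')) :=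
      H.sub.tendsto_integral (fun n => (hN n).isWA.aesm) hM
        (fun n => hMb _ _ (hN n).isWA (hE n)) hl
    -- The positive lower bound on the nonlinear integrals passes to the limit and prevents a part
    -- from vanishing.
    have hne : ¬ w' =ᵐ[volume] 0 := fun h0 => by
      have h1 : ρ ≤ nonlinInt g w' := ge_of_tendsto' hnl fun n => hρb _ _ (hN n)
      rw [nonlinInt_congr h0] at h1
      simp only [nonlinInt, Pi.zero_apply, mul_zero, integral_zero] at h1
      linarith
    -- Lower semicontinuity preserves only this inequality of the Nehari identity. It is the one
    -- that yields a projection factor t ≤ 1.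
    have hle : lamForm p lam A w' W' ≤ nonlinInt g w' := by
      refine le_of_forall_pos_le_add fun ε hε => ?_
      refine ge_of_tendsto (hnl.add_const ε) ?_
      filter_upwards [eventually_lamForm_le H.one_lt H.lt H.memLp H.pos H.lam_lt
        (fun n => (hN n).isWA) hC hE hl hW' hε] with n hn
      rwa [(hN n).eq] at hn
    obtain ⟨t, ht, ht1, hNt⟩ := H.exists_isNehari_smul_of_le hW' hne hle
    refine ⟨t, ht, hNt, fun ε hε => ?_⟩
    have htw : ∀ n, IsWA p A (t • w n) (t • W n) := fun n => (hN n).isWA.const_smul hp t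
    have hEt : ∀ n, energy p A (t • w n) (t • W n) ≤ C := fun n => by
      rw [energy_const_smul hp.le]
      refine le_trans (mul_le_of_le_one_left zero_le ?_) (hE n)
      refine ENNReal.rpow_le_one ?_ hp.le
      rw [Real.enorm_of_nonneg ht.le]
      exact ENNReal.ofReal_le_one.2 ht1
    have hlt : ∀ᵐ x, Tendsto (fun n => (t • w n) x) atTop (𝓝 ((t • w') x)) :=
      hl.mono fun x hx => hx.const_smul t
    have hG : Tendsto (fun n => primInt g (t • w n)) atTop (𝓝 (primInt g (t • w'))) :=
      H.subG.tendsto_integral (fun n => (htw n).aesm) hM (fun n => hMb _ _ (htw n) (hEt n)) hlt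
    filter_upwards [eventually_lamForm_le H.one_lt H.lt H.memLp H.pos H.lam_lt htw hC hEt hlt
      hNt.isWA (half_pos hε), hG.eventually_lt_const
      (show primInt g (t • w') < primInt g (t • w') + ε / 2 by linarith)] with n hn1 hn2
    -- The limit tw' is compared with tw_n, and the latter with w_n itself: since t ≤ 1 and w_n is
    -- on the Nehari manifold, rescaling does not increase the action.
    refine le_trans ?_ (add_le_add_left (H.action_smul_le (hN n).isWA (hN n).eq ht.le ht1) ε)
    rw [action, action]
    have h1 : 1 / p * lamForm p lam A (t • w') (t • W') ≤
        1 / p * lamForm p lam A (t • w n) (t • W n) + ε / 2 := by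
      have hp1 : 1 / p ≤ 1 := by rw [div_le_one hp]; exact H.one_lt.le
      calc _ ≤ 1 / p * (lamForm p lam A (t • w n) (t • W n) + ε / 2) := by gcongr
        _ ≤ _ := by
          rw [mul_add]
          have := mul_le_mul_of_nonneg_right hp1 (half_pos hε).le
          linarith
    linarith
  obtain ⟨t, ht, hNt, htε⟩ := key (fun n => (h (k n)).left) (fun n => hEa (k n)) hWa hla
  obtain ⟨s, hs, hNs, hsε⟩ := key (fun n => (h (k n)).right) (fun n => hEb (k n)) hWb hlb
  have hall : ∀ᵐ x, ∀ n, 0 ≤ a n x ∧ b n x ≤ 0 ∧ a n x * b n x = 0 := ae_all_iff.2 fun n => by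
    filter_upwards [(h n).nonneg, (h n).nonpos, (h n).disjoint] with x h1 h2 h3 using ⟨h1, h2, h3⟩
  refine ⟨_, _, _, _, ⟨hNt, hNs, ?_, ?_, ?_⟩, ?_⟩
  · filter_upwards [hall, hla] with x hx hx1
    exact mul_nonneg ht.le (ge_of_tendsto' hx1 fun n => (hx _).1)
  · filter_upwards [hall, hlb] with x hx hx1
    exact mul_nonpos_of_nonneg_of_nonpos hs.le (le_of_tendsto' hx1 fun n => (hx _).2.1)
  · filter_upwards [hall, hla, hlb] with x hx hx1 hx2
    have h0 : a' x * b' x = 0 :=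
      tendsto_nhds_unique (hx1.mul hx2) (by simp [(hx _).2.2])
    simp only [Pi.smul_apply, smul_eq_mul]
    calc _ = t * s * (a' x * b' x) := by ring
      _ = 0 := by rw [h0, mul_zero]
  · refine le_of_forall_pos_le_add fun ε hε => ?_
    have hsmall : Tendsto (fun n => 1 / ((k n : ℝ) + 1)) atTop (𝓝 0) :=
      tendsto_one_div_add_atTop_nhds_zero_nat.comp hk
    have hε3 : 0 < ε / 3 := by linarith
    obtain ⟨n, h1, h2, h3⟩ := ((htε _ hε3).and ((hsε _ hε3).and
      (hsmall.eventually_lt_const hε3))).exists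
    have := hm (k n)
    linarith

end NodalSetting

end NodalNehari
-- Assembly
theorem mainTheorem6 (N : ℕ) (p : ℝ) (hp : 1 < p) (hpN : p < N)
    (A : NodalNehari.RN N → ℝ) (hA : NodalNehari.CondA1 p A)
    (lam : ℝ) (hlam : lam < NodalNehari.lamA p A)
    (g : NodalNehari.RN N → ℝ → ℝ) (hg1 : NodalNehari.CondG1 p g)
    (hg2 : NodalNehari.CondG2 p g) (hg3 : NodalNehari.CondG3 p g) :
    IsGLB (NodalNehari.Slam p lam A g '' NodalNehari.Mlam p lam A g)
        (NodalNehari.mlam p lam A g) ∧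
      ∃ u ∈ NodalNehari.Mlam p lam A g,
        NodalNehari.Slam p lam A g u = NodalNehari.mlam p lam A g := by
  obtain ⟨q, B, H⟩ := NodalNehari.exists_nodalSetting hp hpN hA hlam hg1 hg2 hg3
  have hne : (NodalNehari.Slam p lam A g '' NodalNehari.Mlam p lam A g).Nonempty := by
    obtain ⟨a, b, Va, Vb, hP⟩ := H.nonempty_nodalPair
    obtain ⟨u, hu, -⟩ := H.exists_mem_Mlam hP
    exact ⟨_, u, hu, rfl⟩
  have hbdd : BddBelow (NodalNehari.Slam p lam A g '' NodalNehari.Mlam p lam A g) := by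
    refine ⟨0, ?_⟩
    rintro _ ⟨u, hu, rfl⟩
    obtain ⟨a, b, Va, Vb, hP, hS⟩ := H.exists_nodalPair hu
    rw [hS]
    exact add_nonneg (H.action_nonneg hP.left.isWA hP.left.eq)
      (H.action_nonneg hP.right.isWA hP.right.eq)
  -- The real `sInf` is 0 by default for an empty or unbounded set; nonemptiness and the lower bound
  -- 0 make `mlam` a genuine infimum.
  have hglb := isGLB_csInf hne hbdd
  refine ⟨hglb, ?_⟩
  have hseq : ∀ n : ℕ, ∃ a b Va Vb, NodalNehari.NodalPair p lam A g a b Va Vb ∧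
      NodalNehari.action p lam A g a Va + NodalNehari.action p lam A g b Vb <
        NodalNehari.mlam p lam A g + 1 / ((n : ℝ) + 1) := fun n => by
    obtain ⟨_, ⟨u, hu, rfl⟩, hlt⟩ := exists_lt_of_csInf_lt hne
      (show NodalNehari.mlam p lam A g < NodalNehari.mlam p lam A g + 1 / ((n : ℝ) + 1) from
        lt_add_of_pos_right _ (by positivity))
    obtain ⟨a, b, Va, Vb, hP, hS⟩ := H.exists_nodalPair hu
    exact ⟨a, b, Va, Vb, hP, by rwa [← hS]⟩
  choose a b Va Vb hP hm using hseq
  obtain ⟨a', b', Va', Vb', hP', hle⟩ := H.exists_minimizer hP hm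
  obtain ⟨u, hu, hS⟩ := H.exists_mem_Mlam hP'
  exact ⟨u, hu, le_antisymm (hS.trans_le hle) (hglb.1 ⟨u, hu, rfl⟩)⟩
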